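/- Let $\mathbf v_0=(1,0)$, $\mathbf v_1=(-\tfrac12,\tfrac{\sqrt3}2)$, $\mathbf v_2=(-\tfrac12,-\tfrac{\sqrt3}2)$ in $\mathbb R^2$, and let $\Lambda$ be the lattice they generate. Consider the trihexagonal tiling (edge-to-edge, by regular hexagons and equilateral triangles with sides of length one) whose hexagons are centered at the points of $2\Lambda$. The refractive flow $T$ on unit tangent vectors of the plane moves with unit speed along straight lines inside the tiles; when a trajectory crosses an edge, the component of its velocity along the edge is reversed and the component orthogonal to the edge is kept. Trajectories are not defined through vertices of the tiling; a trajectory is non-singular if it is defined for all time. A non-singular trajectory is called drift-periodic if, as a set of unit tangent vectors, it is invariant under a non-trivial translational symmetry of the tiling. For $\theta\in S^1$ and a sign $s\in\{+,-\}$, the trajectories of $T_{\theta,s}$ are the trajectories of $T$ that inside hexagons travel only in the directions obtained from $\theta$ by rotation by $0$, $\tfrac{2\pi}3$ or $\tfrac{4\pi}3$, and that travel counter-clockwise (if $s=+$), respectively clockwise (if $s=-$), around the centers of the hexagons. For $\mathbf w\in\mathbb R^2$ let $$\|\mathbf w\|_{\mathrm{hex}}=\min\{|a|+|b|+|c| :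 a,b,c\in\mathbb R,\ \mathbf w=a\mathbf v_0+b\mathbf v_1+c\mathbf v_2\},$$ and let $\mathcal D\subset S^1$ be the set of all $\mathbf w/|\mathbf w|$ such that $\mathbf w\in\Lambda$, $c\,\mathbf w\notin\Lambda$ for all real $c$ with $0<c<1$, and $\|\mathbf w\|_{\mathrm{hex}}$ is an integer divisible by $3$. Then: 1. Every drift-periodic trajectory of $T$ is invariant under translation by at least one of $2\mathbf v_0$, $2\mathbf v_1$, $2\mathbf v_2$. 2. For every $\theta\in\mathcal D$, every sign $s\in\{+,-\}$ and every $i\in\{0,1,2\}$, there is a non-singular trajectory of $T_{\theta,s}$ that is invariant under translation by $2\mathbf v_i$. -/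

import Mathlib

open Filter Topology

namespace TriHex

/-- The vectors `v₀ = (1, 0)`, `v₁ = (-1/2, √3/2)`, `v₂ = (-1/2, -√3/2)`, in the Euclidean plane `ℂ`. -/
noncomputable def v : Fin 3 → ℂ :=
  ![1, ⟨-1 / 2, √3 / 2⟩, ⟨-1 / 2, -(√3 / 2)⟩]

/-- The Eisenstein lattice `Λ`, generated by `v₀, v₁, v₂`. -/
noncomputable def lattice : AddSubgroup ℂ := AddSubgroup.closure (Set.range v)

/-- The centers of the hexagons of the tiling: the points of `2Λ`. -/
def centers : Set ℂ := {c | ∃ l ∈ lattice, c = 2 * l}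

/-- The (closed) regular hexagon with center `c` and unit sides; its vertices are `c ± vᵢ`. -/
def hexagon (c : ℂ) : Set ℂ :=
  convexHull ℝ (Set.range (fun i => c + v i) ∪ Set.range (fun i => c - v i))

/-- For `i ≠ j` the points `c + vᵢ` and `c - vⱼ` are adjacent vertices of the hexagon with center
`c`. This is the (closed) equilateral triangle on the other side of that edge. -/
def triangle (c : ℂ) (i j : Fin 3) : Set ℂ :=
  convexHull ℝ {c + v i, c - v j, c + v i - v j}

/-- The tiles of the trihexagonal tiling. -/
def tiles : Set (Set ℂ) :=
  {P | ∃ c ∈ centers, P = hexagon c} ∪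
    {P | ∃ c ∈ centers, ∃ i j : Fin 3, i ≠ j ∧ P = triangle c i j}

/-- The point `z` is a vertex of the tiling. -/
def IsVertex (z : ℂ) : Prop := ∃ c ∈ centers, ∃ i : Fin 3, z = c + v i ∨ z = c - v i

/-- The segment from `a` to `b` is an edge of the tiling. (Every edge is an edge of exactly one
hexagon; with this choice of the order of the endpoints each edge is listed once.) -/
def IsEdge (a b : ℂ) : Prop :=
  ∃ c ∈ centers, ∃ i j : Fin 3, i ≠ j ∧ a = c + v i ∧ b = c - v j

/-- Refraction with index `-1` in an edge with unit direction vector `d`: the component of the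
velocity `u` along the edge is reversed, the component orthogonal to the edge is kept. -/
noncomputable def refract (d u : ℂ) : ℂ := u - (2 * inner ℝ d u) • d

/-- `γ` is a non-singular trajectory of the refractive (tiling billiard) flow, as a curve in the unit
tangent bundle: `(γ t).1` is the position and `(γ t).2` the direction of travel at time `t`; at a
time at which an edge is crossed, `(γ t).2` is the outgoing direction. The trajectory has unit speed,
is defined for all time, never meets a vertex, moves along straight lines away from the edges, and is
refracted at every edge that it meets. -/
structure IsTrajectory (γ : ℝ → ℂ × ℂ) : Prop where
  unit_speed : ∀ t, ‖(γ t).2‖ = 1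
  not_vertex : ∀ t, ¬ IsVertex (γ t).1
  forward : ∀ t, ∀ᶠ s in 𝓝[>] t, γ s = ((γ t).1 + (s - t) • (γ t).2, (γ t).2)
  backward : ∀ t, (∀ a b, IsEdge a b → (γ t).1 ∉ segment ℝ a b) →
    ∀ᶠ s in 𝓝[<] t, γ s = ((γ t).1 + (s - t) • (γ t).2, (γ t).2)
  backward_edge : ∀ t a b, IsEdge a b → (γ t).1 ∈ segment ℝ a b →
    ∀ᶠ s in 𝓝[<] t,
      γ s = ((γ t).1 + (s - t) • refract (b - a) (γ t).2, refract (b - a) (γ t).2)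

/-- The translation by `w` on the tangent bundle of the plane. -/
def translate (w : ℂ) (x : ℂ × ℂ) : ℂ × ℂ := (x.1 + w, x.2)

/-- The trajectory `γ`, as a subset of the unit tangent bundle, is invariant under the translation
by `w`. -/
def InvariantUnder (w : ℂ) (γ : ℝ → ℂ × ℂ) : Prop :=
  translate w '' Set.range γ = Set.range γ

/-- The translation by `w` is a symmetry of the tiling: it permutes the tiles. -/
def IsTranslationalSymmetry (w : ℂ) : Prop :=
  (fun P : Set ℂ => (fun z => z + w) '' P) '' tiles = tiles

/-- A trajectory is drift-periodic if it is invariant under a non-trivial translational symmetry of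
the tiling. -/
def IsDriftPeriodic (γ : ℝ → ℂ × ℂ) : Prop :=
  ∃ w : ℂ, w ≠ 0 ∧ IsTranslationalSymmetry w ∧ InvariantUnder w γ

/-- The non-singular trajectory `γ` is a trajectory of the restricted flow `T_{θ,σ}`: inside hexagons
it travels only in the directions `θ`, `θ + 2π/3`, `θ + 4π/3` (the rotations of `θ` by `0`, `2π/3`,
`4π/3` are the multiplications by the unit complex numbers `v₀`, `v₁`, `v₂`), and it travels around
the centers of hexagons counter-clockwise if `σ = 1`, clockwise if `σ = -1`. -/
structure IsTrajectoryOf (θ : ℂ) (σ : ℤˣ) (γ : ℝ → ℂ × ℂ) : Prop where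
  isTrajectory : IsTrajectory γ
  direction : ∀ t, ∀ c ∈ centers, (γ t).1 ∈ interior (hexagon c) →
    ∃ k : Fin 3, (γ t).2 = v k * θ
  sign : ∀ t, ∀ c ∈ centers, (γ t).1 ∈ interior (hexagon c) →
    0 < ((σ : ℤ) : ℝ) * ((starRingEnd ℂ ((γ t).1 - c)) * (γ t).2).im

/-- The lattice points visible from the origin. -/
def visible : Set ℂ := {w | w ∈ lattice ∧ ∀ c : ℝ, 0 < c → c < 1 → c • w ∉ lattice}

/-- The hexagonal norm `min {|a| + |b| + |c| : z = a v₀ + b v₁ + c v₂}`. -/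
noncomputable def hexNorm (z : ℂ) : ℝ :=
  sInf {r | ∃ a b c : ℝ, z = a • v 0 + b • v 1 + c • v 2 ∧ r = |a| + |b| + |c|}

/-- The set `𝓓` of drift-periodic directions: the directions `w / |w|` of the visible lattice points
`w` whose hexagonal norm is a multiple of three. -/
def driftDirections : Set ℂ :=
  {θ | ∃ w ∈ visible, (∃ k : ℤ, hexNorm w = 3 * k) ∧ θ = w / (‖w‖ : ℂ)}

end TriHex

/-!
In the coordinates `(p, q)` of the point `p v₀ - q v₂` the lattice `Λ` is `ℤ × ℤ`, the edges of
the tiling fill the lines on which one of the three forms `q`, `-(p + q)`, `p` (the *heights*,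
with sum zero) is an odd integer, and refraction in such an edge keeps the corresponding height of
the velocity and exchanges the other two. An orbit therefore has very few directions. Up to a
symmetry of the hexagon, its velocity in some hexagon is `d (1 - ρ, ρ)` with `0 ≤ ρ ≤ 1`, and it
travels counter-clockwise around the center.

*The first return map.* Such an orbit crosses the radius from the center to the vertex `(1, -1)`,
at a distance `r ∈ (0, 1)`. It then passes through one triangle into a next hexagon, and crosses
there the radius to the image of that vertex under the rotation by `-2π/3`, in the direction
rotated in the same way (`exists_round`). The new distance is `r - ρ` modulo one: the first return
map to the radii is a rotation of the circle. The next center differs from the old one by `(2, 0)`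
if `r < ρ` and by `(2, -2)` if `r > ρ`; if `r = ρ` the ray ends in a vertex. After `n` rounds the
jump is rotated by `n` thirds of a turn, and the sum of the jumps is the displacement `center ρ r
n`.

*The drift.* Let `ρ = P / Q` in lowest terms. If `3 ∤ Q`, three periods of the rotation of the
circle add up `y`, `rot y`, `rot (rot y)` in some order, so that there is no drift
(`center_eq_zero`). If `3 ∣ Q`, the rounds of one period with the jump `(2, 0)` correspond to `P`
consecutive residues modulo `Q`; the constant part of the jumps cancels, and the rest is a sum of
`P` consecutive terms of a three-periodic sequence of vectors with sum zero. As `3 ∤ P`, the sum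
is, up to sign, one of these vectors: the drift is `±2 vᵢ` (`unitStep_center`).

*Drift-periodic orbits.* An orbit is determined by its state at one time (`IsOrbit.eq_of_eq`).
Every orbit meets a hexagon and, up to a symmetry of the tiling, crosses a radius
(`IsOrbit.exists_crossing`). If it is invariant under a translation, it returns to the same
position on a translate of this radius after some number `n` of rounds; so `n ρ` is an integer,
and the displacement is non-zero only if `3 ∣ Q`. Then already `Q` rounds give a translation of
the orbit, by `±2 vᵢ` (`IsOrbit.exists_unitStep`).

*Existence.* A visible lattice point whose coordinates `(a, P)` are non-negative has hexagonal
norm `Q = a + P`, and its direction has the parameter `ρ = P / Q`, in lowest terms. If `3 ∣ Q`,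
the orbit with the initial distance `1 / (2 Q)` avoids the vertices and has a drift by `±2 vᵢ` for
one `i` (`exists_isOrbit_drift`). The symmetries of the hexagon yield the other directions of `𝓓`,
both signs, and, because a rotation by a third of a turn preserves the restricted flow `T_{θ,s}`,
all `i`.
-/

namespace TriHex

open Set

/-! ### The flow in lattice coordinates -/

/-- Coordinates `(p, q)` of the point `p v₀ - q v₂` of the plane. The lattice `Λ` becomes `ℤ × ℤ`. -/
abbrev Coord := ℝ × ℝ

/-- The real number `x` is an odd integer. -/
def OddInt (x : ℝ) : Prop := ∃ n : ℤ, x = 2 * n + 1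

/-- The point has even integer coordinates: it is the center of a hexagon. -/
def EvenPt (x : Coord) : Prop := ∃ m n : ℤ, x = (2 * (m : ℝ), 2 * (n : ℝ))

/-- The linear form `height k` vanishes in the direction `v k` of the edges; the three forms add up
to zero, and the edges of the tiling fill the lines on which one of them is an odd integer. -/
def height : Fin 3 → Coord →ₗ[ℝ] ℝ :=
  ![LinearMap.snd ℝ ℝ ℝ, -(LinearMap.fst ℝ ℝ ℝ + LinearMap.snd ℝ ℝ ℝ), LinearMap.fst ℝ ℝ ℝ]

/-- Refraction in an edge of direction `v k`. It fixes `height k` and exchanges the other two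
heights. -/
def mirror : Fin 3 → Coord →ₗ[ℝ] Coord :=
  ![(-LinearMap.fst ℝ ℝ ℝ - LinearMap.snd ℝ ℝ ℝ).prod (LinearMap.snd ℝ ℝ ℝ),
    (LinearMap.snd ℝ ℝ ℝ).prod (LinearMap.fst ℝ ℝ ℝ),
    (LinearMap.fst ℝ ℝ ℝ).prod (-LinearMap.fst ℝ ℝ ℝ - LinearMap.snd ℝ ℝ ℝ)]

/-- The rotation by `-2π/3`. -/
def rot : Coord ≃ₗ[ℝ] Coord :=
  LinearEquiv.ofLinearMap
    ((LinearMap.snd ℝ ℝ ℝ).prod (-LinearMap.fst ℝ ℝ ℝ - LinearMap.snd ℝ ℝ ℝ))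
    ((-LinearMap.fst ℝ ℝ ℝ - LinearMap.snd ℝ ℝ ℝ).prod (LinearMap.fst ℝ ℝ ℝ))
    (by ext <;> simp) (by ext <;> simp)

@[simp] lemma height_zero (x : Coord) : height 0 x = x.2 := rfl
@[simp] lemma height_one (x : Coord) : height 1 x = -(x.1 + x.2) := rfl
@[simp] lemma height_two (x : Coord) : height 2 x = x.1 := rfl
@[simp] lemma mirror_zero (x : Coord) : mirror 0 x = (-x.1 - x.2, x.2) := rfl
@[simp] lemma mirror_one (x : Coord) : mirror 1 x = (x.2, x.1) := rfl
@[simp] lemma mirror_two (x : Coord) : mirror 2 x = (x.1, -x.1 - x.2) := rfl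
@[simp] lemma rot_apply (x : Coord) : rot x = (x.2, -x.1 - x.2) := rfl

/-- The point `x` lies on a line of edges of direction `v k`. -/
def OnWall (k : Fin 3) (x : Coord) : Prop := OddInt (height k x)

/-- The point `x` is not a vertex of the tiling: it lies on at most one line of edges. -/
def Regular (x : Coord) : Prop := ∀ j k, OnWall j x → OnWall k x → j = k

/-- A ray that arrives at `x` with velocity `u` leaves it with velocity `u'`. -/
def Refracts (x u u' : Coord) : Prop :=
  ((∀ k, ¬ OnWall k x) → u' = u) ∧ ∀ k, OnWall k x → u' = mirror k u

/-- Immediately after the time `t` the curve `γ` moves along a straight line. -/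
def Departs (γ : ℝ → Coord × Coord) (t : ℝ) : Prop :=
  ∀ᶠ s in 𝓝[>] t, γ s = ((γ t).1 + (s - t) • (γ t).2, (γ t).2)

/-- Immediately before the time `t` the curve `γ` moves along a straight line, with the velocity
that is refracted to the one at the time `t`. -/
def Arrives (γ : ℝ → Coord × Coord) (t : ℝ) : Prop :=
  ∃ u, Refracts (γ t).1 u (γ t).2 ∧ ∀ᶠ s in 𝓝[<] t, γ s = ((γ t).1 + (s - t) • u, u)

/-- The curve `γ` follows the flow, at any constant speed, during the interval `[a, b]`. -/
structure IsPath (γ : ℝ → Coord × Coord) (a b : ℝ) : Prop where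
  regular : ∀ t ∈ Icc a b, Regular (γ t).1
  departs : ∀ t ∈ Ico a b, Departs γ t
  arrives : ∀ t ∈ Ioc a b, Arrives γ t

/-- The curve `γ` is a complete, non-singular orbit of the flow. -/
def IsOrbit (γ : ℝ → Coord × Coord) : Prop := ∀ a b, IsPath γ a b

/-- The translation by `c` of the tangent bundle. -/
def shift (c : Coord) (z : Coord × Coord) : Coord × Coord := (z.1 + c, z.2)

lemma OddInt.neg_iff {x : ℝ} : OddInt (-x) ↔ OddInt x := by
  constructor <;> rintro ⟨n, h⟩ <;> refine ⟨-n - 1, ?_⟩ <;> push_cast <;> linarith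

lemma OddInt.add_even_iff {x : ℝ} (m : ℤ) : OddInt (x + 2 * m) ↔ OddInt x := by
  constructor <;> rintro ⟨n, h⟩
  · refine ⟨n - m, ?_⟩; push_cast; linarith
  · refine ⟨n + m, ?_⟩; push_cast; linarith

lemma not_oddInt_of_lt {x : ℝ} (m : ℤ) (h₁ : 2 * m - 1 < x) (h₂ : x < 2 * m + 1) :
    ¬ OddInt x := by
  rintro ⟨n, rfl⟩
  have h3 : (m : ℝ) < n + 1 := by linarith
  have h4 : (n : ℝ) < m := by linarith
  have h3' : m < n + 1 := by exact_mod_cast h3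
  have h4' : n < m := by exact_mod_cast h4
  omega

lemma mirror_mirror (k : Fin 3) (u : Coord) : mirror k (mirror k u) = u := by
  fin_cases k <;> ext <;> simp

lemma EvenPt.neg {c : Coord} (h : EvenPt c) : EvenPt (-c) := by
  obtain ⟨m, n, rfl⟩ := h
  exact ⟨-m, -n, by ext <;> simp⟩

lemma EvenPt.add {c d : Coord} (h : EvenPt c) (h' : EvenPt d) : EvenPt (c + d) := by
  obtain ⟨m, n, rfl⟩ := h
  obtain ⟨m', n', rfl⟩ := h'
  exact ⟨m + m', n + n', by ext <;> simp <;> ring⟩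

lemma evenPt_zero : EvenPt 0 := ⟨0, 0, by ext <;> simp⟩

lemma onWall_add_even {k : Fin 3} {x c : Coord} (hc : EvenPt c) :
    OnWall k (x + c) ↔ OnWall k x := by
  obtain ⟨m, n, rfl⟩ := hc
  unfold OnWall
  fin_cases k
  · simpa using OddInt.add_even_iff (x := x.2) n
  · have := OddInt.add_even_iff (x := -(x.1 + x.2)) (-m - n)
    push_cast at this
    change OddInt (-(x.1 + 2 * m + (x.2 + 2 * n))) ↔ OddInt (-(x.1 + x.2))
    rw [← this]
    ring_nf
  · simpa using OddInt.add_even_iff (x := x.1) m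

lemma Refracts.forward_unique {x u u₁ u₂ : Coord} (h₁ : Refracts x u u₁) (h₂ : Refracts x u u₂) :
    u₁ = u₂ := by
  by_cases h : ∀ k, ¬ OnWall k x
  · rw [h₁.1 h, h₂.1 h]
  · push Not at h
    obtain ⟨k, hk⟩ := h
    rw [h₁.2 k hk, h₂.2 k hk]

lemma Refracts.backward_unique {x u u₁ u₂ : Coord} (h₁ : Refracts x u₁ u) (h₂ : Refracts x u₂ u) :
    u₁ = u₂ := by
  by_cases h : ∀ k, ¬ OnWall k x
  · rw [← h₁.1 h, ← h₂.1 h]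
  · push Not at h
    obtain ⟨k, hk⟩ := h
    rw [← mirror_mirror k u₁, ← h₁.2 k hk, h₂.2 k hk, mirror_mirror]

lemma Regular.refracts_mirror {x u : Coord} {k : Fin 3} (hx : Regular x) (hk : OnWall k x) :
    Refracts x u (mirror k u) :=
  ⟨fun h => absurd hk (h k), fun j hj => by rw [hx j k hj hk]⟩

lemma refracts_self {x u : Coord} (hx : ∀ k, ¬ OnWall k x) : Refracts x u u :=
  ⟨fun _ => rfl, fun k hk => absurd hk (hx k)⟩

lemma regular_of_not_onWall {x : Coord} (hx : ∀ k, ¬ OnWall k x) : Regular x :=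
  fun j _ hj => absurd hj (hx j)

/-! ### Uniqueness of orbits -/

lemma tendsto_line (x u : Coord) (t : ℝ) (l : Filter ℝ) (hl : l ≤ 𝓝 t) :
    Tendsto (fun s => x + (s - t) • u) l (𝓝 x) := by
  have : Tendsto (fun s : ℝ => x + (s - t) • u) (𝓝 t) (𝓝 (x + (t - t) • u)) :=
    Continuous.tendsto (by fun_prop) t
  simpa using this.mono_left hl

/-- The state at the time `t` is determined by the states immediately before. -/
lemma Arrives.eq_of_eventually_eq {f g : ℝ → Coord × Coord} {t : ℝ} (hf : Arrives f t)
    (hg : Arrives g t) (h : ∀ᶠ s in 𝓝[<] t, f s = g s) : f t = g t := by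
  obtain ⟨u, hu, hfu⟩ := hf
  obtain ⟨w, hw, hgw⟩ := hg
  have key : ∀ᶠ s in 𝓝[<] t, (f t).1 + (s - t) • u = (g t).1 + (s - t) • w ∧ u = w := by
    filter_upwards [h, hfu, hgw] with s h1 h2 h3
    rw [h2, h3] at h1
    exact ⟨congrArg Prod.fst h1, congrArg Prod.snd h1⟩
  obtain ⟨s, -, huw⟩ := key.exists
  subst huw
  have hpos : (f t).1 = (g t).1 :=
    tendsto_nhds_unique_of_eventuallyEq (tendsto_line _ _ t _ nhdsWithin_le_nhds)
      (tendsto_line _ _ t _ nhdsWithin_le_nhds) (key.mono fun s hs => hs.1)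
  rw [hpos] at hu
  exact Prod.ext hpos (hu.forward_unique hw)

/-- The state at the time `t` is determined by the states immediately after. -/
lemma Departs.eq_of_eventually_eq {f g : ℝ → Coord × Coord} {t : ℝ} (hf : Departs f t)
    (hg : Departs g t) (h : ∀ᶠ s in 𝓝[>] t, f s = g s) : f t = g t := by
  have key : ∀ᶠ s in 𝓝[>] t,
      (f t).1 + (s - t) • (f t).2 = (g t).1 + (s - t) • (g t).2 ∧ (f t).2 = (g t).2 := by
    filter_upwards [h, hf, hg] with s h1 h2 h3
    have h4 := h2.symm.trans (h1.trans h3)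
    exact Prod.mk.inj h4
  obtain ⟨s, -, huw⟩ := key.exists
  exact Prod.ext (tendsto_nhds_unique_of_eventuallyEq (tendsto_line _ _ t _ nhdsWithin_le_nhds)
      (tendsto_line _ _ t _ nhdsWithin_le_nhds) (key.mono fun s hs => hs.1)) huw

lemma Departs.eventually_eq {f g : ℝ → Coord × Coord} {t : ℝ} (hf : Departs f t)
    (hg : Departs g t) (h : f t = g t) : ∀ᶠ s in 𝓝[>] t, f s = g s := by
  filter_upwards [hf, hg] with s h1 h2
  rw [h1, h2, h]

lemma Arrives.eventually_eq {f g : ℝ → Coord × Coord} {t : ℝ} (hf : Arrives f t)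
    (hg : Arrives g t) (h : f t = g t) : ∀ᶠ s in 𝓝[<] t, f s = g s := by
  obtain ⟨u, hu, hfu⟩ := hf
  obtain ⟨w, hw, hgw⟩ := hg
  rw [h] at hu
  have huw := hu.backward_unique hw
  filter_upwards [hfu, hgw] with s h1 h2
  rw [h1, h2, h, huw]

/-- Two paths with the same initial state agree. -/
lemma IsPath.eqOn_of_eq_left {f g : ℝ → Coord × Coord} {a b : ℝ} (hf : IsPath f a b)
    (hg : IsPath g a b) (h : f a = g a) : ∀ t ∈ Icc a b, f t = g t := by
  intro t₀ ht₀
  have hab : a ≤ b := ht₀.1.trans ht₀.2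
  set S : Set ℝ := {t ∈ Icc a b | ∀ s ∈ Icc a t, f s = g s} with hS
  have haS : a ∈ S := ⟨⟨le_rfl, hab⟩, fun s hs => by rw [le_antisymm hs.2 hs.1, h]⟩
  have hbdd : BddAbove S := ⟨b, fun t ht => ht.1.2⟩
  set x := sSup S
  have hax : a ≤ x := le_csSup hbdd haS
  have hxb : x ≤ b := csSup_le ⟨a, haS⟩ fun t ht => ht.1.2
  have hlt : ∀ s ∈ Ico a x, f s = g s := by
    intro s hs
    obtain ⟨t, ht, hst⟩ := exists_lt_of_lt_csSup ⟨a, haS⟩ hs.2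
    exact ht.2 s ⟨hs.1, hst.le⟩
  have hx : f x = g x := by
    rcases hax.eq_or_lt with hax' | hax'
    · rw [← hax', h]
    · refine (hf.arrives x ⟨hax', hxb⟩).eq_of_eventually_eq (hg.arrives x ⟨hax', hxb⟩) ?_
      filter_upwards [Ioo_mem_nhdsLT hax'] with s hs using hlt s ⟨hs.1.le, hs.2⟩
  have hle : ∀ s ∈ Icc a x, f s = g s := fun s hs =>
    hs.2.eq_or_lt.elim (fun e => by rw [e, hx]) fun hl => hlt s ⟨hs.1, hl⟩
  rcases hxb.eq_or_lt with hxb' | hxb'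
  · exact hle t₀ ⟨ht₀.1, ht₀.2.trans hxb'.ge⟩
  · exfalso
    have hev := (hf.departs x ⟨hax, hxb'⟩).eventually_eq (hg.departs x ⟨hax, hxb'⟩) hx
    obtain ⟨y, hxy, hy⟩ := (mem_nhdsGT_iff_exists_Ioo_subset' hxb').1 hev
    rw [mem_Ioi] at hxy
    obtain ⟨z, hz1, hz2⟩ := exists_between (lt_min hxy hxb')
    have hzS : z ∈ S := by
      refine ⟨⟨hax.trans hz1.le, (hz2.trans_le (min_le_right _ _)).le⟩, fun s hs => ?_⟩
      rcases le_or_gt s x with hsx | hsx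
      · exact hle s ⟨hs.1, hsx⟩
      · exact hy ⟨hsx, hs.2.trans_lt (hz2.trans_le (min_le_left _ _))⟩
    exact absurd (le_csSup hbdd hzS) (not_le.2 hz1)

/-- Two paths with the same final state agree. -/
lemma IsPath.eqOn_of_eq_right {f g : ℝ → Coord × Coord} {a b : ℝ} (hf : IsPath f a b)
    (hg : IsPath g a b) (h : f b = g b) : ∀ t ∈ Icc a b, f t = g t := by
  intro t₀ ht₀
  have hab : a ≤ b := ht₀.1.trans ht₀.2
  set S : Set ℝ := {t ∈ Icc a b | ∀ s ∈ Icc t b, f s = g s} with hS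
  have hbS : b ∈ S := ⟨⟨hab, le_rfl⟩, fun s hs => by rw [le_antisymm hs.2 hs.1, h]⟩
  have hbdd : BddBelow S := ⟨a, fun t ht => ht.1.1⟩
  set x := sInf S
  have hxb : x ≤ b := csInf_le hbdd hbS
  have hax : a ≤ x := le_csInf ⟨b, hbS⟩ fun t ht => ht.1.1
  have hlt : ∀ s ∈ Ioc x b, f s = g s := by
    intro s hs
    obtain ⟨t, ht, hst⟩ := exists_lt_of_csInf_lt ⟨b, hbS⟩ hs.1
    exact ht.2 s ⟨hst.le, hs.2⟩
  have hx : f x = g x := by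
    rcases hxb.eq_or_lt with hxb' | hxb'
    · rw [hxb', h]
    · refine (hf.departs x ⟨hax, hxb'⟩).eq_of_eventually_eq (hg.departs x ⟨hax, hxb'⟩) ?_
      filter_upwards [Ioo_mem_nhdsGT hxb'] with s hs using hlt s ⟨hs.1, hs.2.le⟩
  have hle : ∀ s ∈ Icc x b, f s = g s := fun s hs =>
    hs.1.eq_or_lt.elim (fun e => by rw [← e, hx]) fun hl => hlt s ⟨hl, hs.2⟩
  rcases hax.eq_or_lt with hax' | hax'
  · exact hle t₀ ⟨hax'.ge.trans ht₀.1, ht₀.2⟩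
  · exfalso
    have hev := (hf.arrives x ⟨hax', hxb⟩).eventually_eq (hg.arrives x ⟨hax', hxb⟩) hx
    obtain ⟨y, hxy, hy⟩ := (mem_nhdsLT_iff_exists_Ioo_subset' hax').1 hev
    rw [mem_Iio] at hxy
    obtain ⟨z, hz1, hz2⟩ := exists_between (max_lt hxy hax')
    have hzS : z ∈ S := by
      refine ⟨⟨((le_max_right _ _).trans_lt hz1).le, hz2.le.trans hxb⟩, fun s hs => ?_⟩
      rcases le_or_gt x s with hsx | hsx
      · exact hle s ⟨hsx, hs.2⟩
      · exact hy ⟨((le_max_left _ _).trans_lt hz1).trans_le hs.1, hsx⟩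
    exact absurd (csInf_le hbdd hzS) (not_le.2 hz2)

lemma IsOrbit.eq_of_eq {f g : ℝ → Coord × Coord} (hf : IsOrbit f) (hg : IsOrbit g) {t : ℝ}
    (h : f t = g t) : f = g := by
  funext s
  rcases le_total t s with hts | hts
  · exact (hf t s).eqOn_of_eq_left (hg t s) h s ⟨hts, le_rfl⟩
  · exact (hf s t).eqOn_of_eq_right (hg s t) h s ⟨le_rfl, hts⟩

/-! ### Constructing paths -/

lemma Departs.congr {f g : ℝ → Coord × Coord} {a b : ℝ} (hf : Departs f a) (hab : a < b)
    (h : ∀ t ∈ Ico a b, g t = f t) : Departs g a := by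
  filter_upwards [hf, Ioo_mem_nhdsGT hab] with s hs hs'
  rw [h s ⟨hs'.1.le, hs'.2⟩, h a ⟨le_rfl, hab⟩, hs]

lemma Arrives.congr {f g : ℝ → Coord × Coord} {a b : ℝ} (hf : Arrives f b) (hab : a < b)
    (h : ∀ t ∈ Ioc a b, g t = f t) : Arrives g b := by
  obtain ⟨u, hu, hfu⟩ := hf
  refine ⟨u, by rwa [h b ⟨hab, le_rfl⟩], ?_⟩
  filter_upwards [hfu, Ioo_mem_nhdsLT hab] with s hs hs'
  rw [h s ⟨hs'.1, hs'.2.le⟩, h b ⟨hab, le_rfl⟩, hs]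

lemma IsPath.congr {f g : ℝ → Coord × Coord} {a b : ℝ} (hf : IsPath f a b)
    (h : ∀ t ∈ Icc a b, g t = f t) : IsPath g a b where
  regular t ht := by rw [h t ht]; exact hf.regular t ht
  departs t ht := (hf.departs t ht).congr ht.2 fun s hs => h s ⟨ht.1.trans hs.1, hs.2.le⟩
  arrives t ht := (hf.arrives t ht).congr ht.1 fun s hs => h s ⟨hs.1.le, hs.2.trans ht.2⟩

lemma IsPath.mono {f : ℝ → Coord × Coord} {a b a' b' : ℝ} (hf : IsPath f a b) (ha : a ≤ a')
    (hb : b' ≤ b) : IsPath f a' b' where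
  regular t ht := hf.regular t ⟨ha.trans ht.1, ht.2.trans hb⟩
  departs t ht := hf.departs t ⟨ha.trans ht.1, ht.2.trans_le hb⟩
  arrives t ht := hf.arrives t ⟨ha.trans_lt ht.1, ht.2.trans hb⟩

lemma IsPath.union {f : ℝ → Coord × Coord} {a b c : ℝ} (h₁ : IsPath f a b) (h₂ : IsPath f b c) :
    IsPath f a c where
  regular t ht := (le_total t b).elim (fun h => h₁.regular t ⟨ht.1, h⟩)
    fun h => h₂.regular t ⟨h, ht.2⟩
  departs t ht := (lt_or_ge t b).elim (fun h => h₁.departs t ⟨ht.1, h⟩)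
    fun h => h₂.departs t ⟨h, ht.2⟩
  arrives t ht := (le_or_gt t b).elim (fun h => h₁.arrives t ⟨ht.1, h⟩)
    fun h => h₂.arrives t ⟨h, ht.2⟩

lemma tendsto_sub_nhdsGT (t c : ℝ) : Tendsto (fun s => s - c) (𝓝[>] t) (𝓝[>] (t - c)) := by
  refine tendsto_nhdsWithin_iff.2 ⟨(Continuous.tendsto (by fun_prop) t).mono_left
    nhdsWithin_le_nhds, ?_⟩
  filter_upwards [self_mem_nhdsWithin] with s hs
  exact sub_lt_sub_right (mem_Ioi.1 hs) c

lemma tendsto_sub_nhdsLT (t c : ℝ) : Tendsto (fun s => s - c) (𝓝[<] t) (𝓝[<] (t - c)) := by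
  refine tendsto_nhdsWithin_iff.2 ⟨(Continuous.tendsto (by fun_prop) t).mono_left
    nhdsWithin_le_nhds, ?_⟩
  filter_upwards [self_mem_nhdsWithin] with s hs
  exact sub_lt_sub_right (mem_Iio.1 hs) c

lemma IsPath.comp_sub {f : ℝ → Coord × Coord} {a b : ℝ} (hf : IsPath f a b) (c : ℝ) :
    IsPath (fun t => f (t - c)) (a + c) (b + c) where
  regular t ht := hf.regular _ ⟨by linarith [ht.1], by linarith [ht.2]⟩
  departs t ht := by
    have := (tendsto_sub_nhdsGT t c).eventually
      (hf.departs (t - c) ⟨by linarith [ht.1], by linarith [ht.2]⟩)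
    filter_upwards [this] with s hs
    rw [hs, sub_sub_sub_cancel_right]
  arrives t ht := by
    obtain ⟨u, hu, h⟩ := hf.arrives (t - c) ⟨by linarith [ht.1], by linarith [ht.2]⟩
    refine ⟨u, hu, ?_⟩
    filter_upwards [(tendsto_sub_nhdsLT t c).eventually h] with s hs
    rw [hs, sub_sub_sub_cancel_right]

lemma IsOrbit.comp_add {f : ℝ → Coord × Coord} (hf : IsOrbit f) (c : ℝ) :
    IsOrbit (fun t => f (t + c)) := fun a b => by
  simpa using (hf (a + c) (b + c)).comp_sub (-c)

/-- A straight segment without walls in its interior is a path. -/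
lemma isPath_segment {x u u' : Coord} {T : ℝ} (h₀ : Regular x) (h₁ : Regular (x + T • u))
    (h : ∀ t ∈ Ioo 0 T, ∀ k, ¬ OnWall k (x + t • u)) (hu : Refracts (x + T • u) u u') :
    IsPath (fun t => if t < T then (x + t • u, u) else (x + T • u, u')) 0 T where
  regular t ht := by
    rcases ht.2.lt_or_eq with htT | rfl
    · rw [if_pos htT]
      rcases ht.1.eq_or_lt with rfl | h0
      · simpa using h₀
      · exact regular_of_not_onWall (h t ⟨h0, htT⟩)
    · simpa using h₁
  departs t ht := by
    unfold Departs
    filter_upwards [Ioo_mem_nhdsGT ht.2] with s hs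
    simp only [if_pos hs.2, if_pos ht.2, add_assoc, ← add_smul]
    simp
  arrives t ht := by
    rcases ht.2.lt_or_eq with htT | rfl
    · refine ⟨u, ?_, ?_⟩
      · simp only [if_pos htT]
        exact refracts_self (h t ⟨ht.1, htT⟩)
      · filter_upwards [self_mem_nhdsWithin] with s hs
        simp only [if_pos ((mem_Iio.1 hs).trans htT), if_pos htT, add_assoc, ← add_smul]
        simp
    · refine ⟨u, by simpa using hu, ?_⟩
      filter_upwards [self_mem_nhdsWithin] with s hs
      simp only [if_pos (mem_Iio.1 hs), lt_irrefl, if_false, add_assoc, ← add_smul]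
      simp

/-- The flow leads from the state `z` to the state `z'` in the time `T`, and all the states strictly
between satisfy `P`. -/
def Connects (P : Coord × Coord → Prop) (z z' : Coord × Coord) (T : ℝ) : Prop :=
  ∃ f, IsPath f 0 T ∧ f 0 = z ∧ f T = z' ∧ ∀ t ∈ Ioo 0 T, P (f t)

lemma connects_segment {P : Coord × Coord → Prop} {x u x' u' : Coord} {T : ℝ} (hT : 0 < T)
    (hx : x + T • u = x') (h₀ : Regular x) (h₁ : Regular x')
    (h : ∀ t ∈ Ioo 0 T, ∀ k, ¬ OnWall k (x + t • u)) (hu : Refracts x' u u')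
    (hP : ∀ t ∈ Ioo 0 T, P (x + t • u, u)) : Connects P (x, u) (x', u') T := by
  subst hx
  refine ⟨_, isPath_segment h₀ h₁ h hu, by simp [hT], by simp, fun t ht => ?_⟩
  simpa [ht.2] using hP t ht

lemma Connects.trans {P : Coord × Coord → Prop} {z z' z'' : Coord × Coord} {S T : ℝ}
    (hS : 0 ≤ S) (hT : 0 ≤ T) (h₁ : Connects P z z' S) (hP : P z') (h₂ : Connects P z' z'' T) :
    Connects P z z'' (S + T) := by
  obtain ⟨f, hf, rfl, rfl, hfP⟩ := h₁
  obtain ⟨g, hg, hfg, rfl, hgP⟩ := h₂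
  have hr : ∀ t ∈ Icc S (S + T), (if t ≤ S then f t else g (t - S)) = g (t - S) := by
    intro t ht
    rcases ht.1.eq_or_lt with rfl | h
    · simp [hfg]
    · rw [if_neg (not_le.2 h)]
  have hg' : IsPath (fun t => g (t - S)) S (S + T) := by
    simpa [add_comm] using hg.comp_sub S
  refine ⟨fun t => if t ≤ S then f t else g (t - S), ?_, by simp [hS], ?_, fun t ht => ?_⟩
  · exact (hf.congr fun t ht => if_pos ht.2).union (hg'.congr hr)
  · simp only
    rw [hr _ ⟨by linarith, le_rfl⟩, add_sub_cancel_left]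
  · simp only
    rcases lt_trichotomy t S with h | rfl | h
    · rw [if_pos h.le]
      exact hfP t ⟨ht.1, h⟩
    · rwa [if_pos le_rfl]
    · rw [if_neg (not_le.2 h)]
      exact hgP _ ⟨by linarith, by linarith [ht.2]⟩

lemma Connects.mono {P Q : Coord × Coord → Prop} {z z' : Coord × Coord} {T : ℝ}
    (h : Connects P z z' T) (hPQ : ∀ z, P z → Q z) : Connects Q z z' T := by
  obtain ⟨f, hf, h0, hT, hP⟩ := h
  exact ⟨f, hf, h0, hT, fun t ht => hPQ _ (hP t ht)⟩

/-- An orbit through `z` follows the paths that start at `z`. -/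
lemma IsOrbit.connects {P : Coord × Coord → Prop} {γ : ℝ → Coord × Coord} (hγ : IsOrbit γ)
    {z z' : Coord × Coord} {t T : ℝ} (hT : 0 ≤ T) (h : Connects P z z' T) (hz : γ t = z) :
    γ (t + T) = z' ∧ ∀ s ∈ Ioo 0 T, P (γ (t + s)) := by
  obtain ⟨f, hf, rfl, rfl, hP⟩ := h
  have key : ∀ s ∈ Icc 0 T, γ (t + s) = f s := by
    have := (hγ.comp_add t 0 T).eqOn_of_eq_left hf (by simpa using hz)
    simpa [add_comm] using this
  exact ⟨key T ⟨hT, le_rfl⟩, fun s hs => by rw [key s ⟨hs.1.le, hs.2.le⟩]; exact hP s hs⟩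

/-- An orbit moves straight until it meets a wall. At the end of the segment the velocity may be
refracted, so that only the position is determined. -/
lemma IsOrbit.fst_eq_of_segment {γ : ℝ → Coord × Coord} (hγ : IsOrbit γ) {x u : Coord} {t T : ℝ}
    (hz : γ t = (x, u)) (hT : 0 < T) (h : ∀ s ∈ Ioo 0 T, ∀ k, ¬ OnWall k (x + s • u)) :
    (γ (t + T)).1 = x + T • u := by
  have hx : Regular x := by
    have := (hγ t t).regular t ⟨le_rfl, le_rfl⟩
    rwa [hz] at this
  have key : ∀ s ∈ Ioo 0 T, γ (t + s) = (x + s • u, u) := by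
    intro s hs
    refine (hγ.connects (P := fun _ => True) hs.1.le (connects_segment hs.1 rfl hx
      (regular_of_not_onWall (h s hs)) (fun r hr => h r ⟨hr.1, hr.2.trans hs.2⟩)
      (refracts_self (h s hs)) fun _ _ => trivial) hz).1
  obtain ⟨w, -, hw⟩ := (hγ t (t + T)).arrives (t + T) ⟨by linarith, le_rfl⟩
  have h1 : Tendsto (fun s => (γ (t + T)).1 + (s - (t + T)) • w) (𝓝[<] (t + T))
      (𝓝 (γ (t + T)).1) := tendsto_line _ _ _ _ nhdsWithin_le_nhds
  have h2 : Tendsto (fun s => (x + T • u) + (s - (t + T)) • u) (𝓝[<] (t + T))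
      (𝓝 (x + T • u)) := tendsto_line _ _ _ _ nhdsWithin_le_nhds
  refine tendsto_nhds_unique_of_eventuallyEq h1 h2 ?_
  filter_upwards [hw, Ioo_mem_nhdsLT (show t < t + T by linarith)] with s hs hs'
  have := key (s - t) ⟨by linarith [hs'.1], by linarith [hs'.2]⟩
  rw [add_sub_cancel, hs] at this
  refine (congrArg Prod.fst this).trans ?_
  simp only [add_assoc, ← add_smul]
  congr 2
  ring

/-- An orbit moves straight, forwards and backwards, as long as it meets no wall. -/
lemma IsOrbit.eq_of_segment {γ : ℝ → Coord × Coord} (hγ : IsOrbit γ) {x u : Coord} {t T : ℝ}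
    (hz : γ t = (x, u)) (h : ∀ s ∈ uIcc 0 T, ∀ k, ¬ OnWall k (x + s • u)) :
    γ (t + T) = (x + T • u, u) := by
  rcases lt_trichotomy T 0 with hT | rfl | hT
  · rw [uIcc_of_ge hT.le] at h
    have hc : x + T • u + (-T) • u = x := by rw [add_assoc, ← add_smul]; simp
    have hp := isPath_segment (u := u) (u' := u) (T := -T)
      (regular_of_not_onWall (h T ⟨le_rfl, hT.le⟩))
      (by rw [hc]; simpa using regular_of_not_onWall (h 0 ⟨hT.le, le_rfl⟩))
      (fun s hs => by
        rw [add_assoc, ← add_smul]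
        exact h _ ⟨by linarith [hs.1], by linarith [hs.2]⟩)
      (by rw [hc]; simpa using refracts_self (h 0 ⟨hT.le, le_rfl⟩))
    have := (hγ.comp_add (t + T) 0 (-T)).eqOn_of_eq_right hp (by simp [hz]) 0
      ⟨le_rfl, by linarith⟩
    simpa [hT] using this
  · simpa using hz
  · rw [uIcc_of_le hT.le] at h
    exact (hγ.connects (P := fun _ => True) hT.le (connects_segment hT rfl
      (by simpa using regular_of_not_onWall (h 0 ⟨le_rfl, hT.le⟩))
      (regular_of_not_onWall (h T ⟨hT.le, le_rfl⟩)) (fun r hr => h r ⟨hr.1.le, hr.2.le⟩)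
      (refracts_self (h T ⟨hT.le, le_rfl⟩)) fun _ _ => trivial) hz).1

lemma IsPath.shift {f : ℝ → Coord × Coord} {a b : ℝ} (hf : IsPath f a b) {c : Coord}
    (hc : EvenPt c) : IsPath (fun t => TriHex.shift c (f t)) a b where
  regular t ht j k hj hk := hf.regular t ht j k ((onWall_add_even hc).1 hj)
    ((onWall_add_even hc).1 hk)
  departs t ht := by
    filter_upwards [hf.departs t ht] with s hs
    rw [hs]
    simp only [TriHex.shift, add_right_comm]
  arrives t ht := by
    obtain ⟨u, hu, h⟩ := hf.arrives t ht
    refine ⟨u, ⟨fun hk => hu.1 fun k hk' => hk k ((onWall_add_even hc).2 hk'),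
      fun k hk => hu.2 k ((onWall_add_even hc).1 hk)⟩, ?_⟩
    filter_upwards [h] with s hs
    rw [hs]
    simp only [TriHex.shift, add_right_comm]

lemma EvenPt.zsmul {c : Coord} (h : EvenPt c) (m : ℤ) : EvenPt (m • c) := by
  obtain ⟨a, b, rfl⟩ := h
  exact ⟨m * a, m * b, by ext <;> simp <;> ring⟩

/-- A path from `z` to a translate of `z` extends to an orbit that is periodic up to that
translation. -/
lemma Connects.exists_isOrbit {P : Coord × Coord → Prop} {z : Coord × Coord} {e : Coord} {T : ℝ}
    (hT : 0 < T) (he : EvenPt e) (h : Connects P z (shift e z) T) (hz : P z)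
    (hP : ∀ z c, EvenPt c → P z → P (shift c z)) :
    ∃ γ, IsOrbit γ ∧ γ 0 = z ∧ (∀ t, P (γ t)) ∧ ∀ t, γ (t + T) = shift e (γ t) := by
  obtain ⟨f, hf, h0, h1, hfP⟩ := h
  set γ : ℝ → Coord × Coord := fun t => shift (⌊t / T⌋ • e) (f (t - ⌊t / T⌋ * T)) with hγ
  have hfloor : ∀ t, ⌊t / T⌋ * T ≤ t ∧ t < (⌊t / T⌋ + 1) * T := fun t =>
    ⟨(le_div_iff₀ hT).1 (Int.floor_le _), (div_lt_iff₀ hT).1 (Int.lt_floor_add_one _)⟩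
  have hper : ∀ t, γ (t + T) = shift e (γ t) := by
    intro t
    have : ⌊(t + T) / T⌋ = ⌊t / T⌋ + 1 := by
      rw [add_div, div_self hT.ne', Int.floor_add_one]
    simp only [hγ, this, shift, add_smul, one_smul, add_assoc]
    push_cast
    rw [show t + T - (⌊t / T⌋ + 1) * T = t - ⌊t / T⌋ * T by ring]
  have key : ∀ m : ℤ, ∀ t ∈ Icc (m * T) ((m + 1) * T), γ t = shift (m • e) (f (t - m * T)) := by
    intro m t ht
    rcases ht.2.lt_or_eq with hlt | heq
    · have : ⌊t / T⌋ = m := by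
        rw [Int.floor_eq_iff, le_div_iff₀ hT, div_lt_iff₀ hT]
        exact ⟨ht.1, hlt⟩
      simp only [hγ, this]
    · have : ⌊t / T⌋ = m + 1 := by
        rw [heq, mul_div_cancel_right₀ _ hT.ne']
        exact_mod_cast Int.floor_intCast (m + 1)
      simp only [hγ, this]
      push_cast
      rw [heq, sub_self, h0, show (m + 1) * T - m * T = T by ring, h1]
      simp only [shift, add_smul, one_smul]
      rw [add_assoc, add_comm e]
  have hpath : ∀ m : ℤ, IsPath γ (m * T) ((m + 1) * T) := by
    intro m
    have := ((hf.comp_sub (m * T)).shift (he.zsmul m)).congr (g := γ)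
    rw [zero_add, show T + m * T = (m + 1) * T by ring] at this
    exact this (key m)
  have hpaths : ∀ (m : ℤ) (n : ℕ), IsPath γ (m * T) ((m + n) * T) := by
    intro m n
    induction n with
    | zero => exact (hpath m).mono le_rfl (by rw [Nat.cast_zero]; nlinarith)
    | succ n ih =>
      have := hpath (m + n)
      push_cast at this ⊢
      rw [← add_assoc]
      exact ih.union this
  refine ⟨γ, fun a b => ?_, by simp [hγ, h0, shift], fun t => ?_, hper⟩
  · obtain ⟨n, hn⟩ := exists_nat_gt ((b - ⌊a / T⌋ * T) / T)
    rw [div_lt_iff₀ hT] at hn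
    exact (hpaths ⌊a / T⌋ n).mono (hfloor a).1 (by linarith)
  · rw [key ⌊t / T⌋ t ⟨(hfloor t).1, (hfloor t).2.le⟩]
    refine hP _ _ (he.zsmul _) ?_
    rcases (hfloor t).1.eq_or_lt with heq | hlt
    · rw [sub_eq_zero.2 heq.symm, h0]
      exact hz
    · exact hfP _ ⟨by linarith, by linarith [(hfloor t).2]⟩

/-! ### The symmetries of a hexagon -/

/-- The point has integer coordinates: it belongs to the lattice `Λ`. -/
def IntPt (x : Coord) : Prop := ∃ m n : ℤ, x = ((m : ℝ), (n : ℝ))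

/-- The open hexagon centered at the origin. -/
def Hex : Set Coord := {x | ∀ k, |height k x| < 1}

/-- The signed area of the parallelogram spanned by `x` and `y`, in units of a fundamental domain. -/
def det (x y : Coord) : ℝ := x.1 * y.2 - x.2 * y.1

/-- A linear symmetry, of determinant `s`, of the hexagon centered at the origin. -/
structure IsSymm (s : ℤˣ) (A : Coord ≃ₗ[ℝ] Coord) : Prop where
  perm : ∃ σ : Equiv.Perm (Fin 3), ∀ k, (∀ x, |height k (A x)| = |height (σ k) x|) ∧
    ∀ u, mirror k (A u) = A (mirror (σ k) u)
  intPt : ∀ x, IntPt (A x) ↔ IntPt x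
  det_apply : ∀ x y, det (A x) (A y) = ((s : ℤ) : ℝ) * det x y
  rot_comm : (∀ x, A (rot x) = rot (A x)) ∨ ∀ x, A (rot x) = rot (rot (A x))

lemma rot_rot_rot (x : Coord) : rot (rot (rot x)) = x := by
  ext <;> simp <;> ring

lemma rot_pow_three : rot ^ 3 = 1 := by
  ext x <;> simp [pow_succ] <;> ring

lemma evenPt_iff {x : Coord} : EvenPt x ↔ IntPt ((2⁻¹ : ℝ) • x) := by
  constructor
  · rintro ⟨m, n, rfl⟩
    exact ⟨m, n, by ext <;> simp⟩
  · rintro ⟨m, n, h⟩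
    refine ⟨m, n, ?_⟩
    rw [← smul_inv_smul₀ (two_ne_zero' ℝ) x, h]
    ext <;> simp

lemma isSymm_one : IsSymm 1 1 where
  perm := ⟨1, fun k => ⟨fun x => rfl, fun u => rfl⟩⟩
  intPt x := Iff.rfl
  det_apply x y := by simp
  rot_comm := Or.inl fun x => rfl

lemma IsSymm.mul {s t : ℤˣ} {A B : Coord ≃ₗ[ℝ] Coord} (hA : IsSymm s A) (hB : IsSymm t B) :
    IsSymm (s * t) (A * B) where
  perm := by
    obtain ⟨σ, hσ⟩ := hA.perm
    obtain ⟨τ, hτ⟩ := hB.perm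
    refine ⟨τ * σ, fun k => ⟨fun x => ?_, fun u => ?_⟩⟩
    · exact ((hσ k).1 (B x)).trans ((hτ (σ k)).1 x)
    · exact ((hσ k).2 (B u)).trans (congrArg A ((hτ (σ k)).2 u))
  intPt x := (hA.intPt (B x)).trans (hB.intPt x)
  det_apply x y := by
    refine (hA.det_apply (B x) (B y)).trans ?_
    rw [hB.det_apply, Units.val_mul, Int.cast_mul, mul_assoc]
  rot_comm := by
    simp only [LinearEquiv.mul_apply]
    rcases hA.rot_comm with h | h <;> rcases hB.rot_comm with h' | h' <;>
      simp only [h, h', rot_rot_rot]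
    · exact Or.inl fun x => trivial
    · exact Or.inr fun x => trivial
    · exact Or.inr fun x => trivial
    · exact Or.inl fun x => trivial

lemma IsSymm.inv {s : ℤˣ} {A : Coord ≃ₗ[ℝ] Coord} (hA : IsSymm s A) : IsSymm s A⁻¹ where
  perm := by
    obtain ⟨σ, hσ⟩ := hA.perm
    refine ⟨σ⁻¹, fun k => ⟨fun x => ?_, fun u => ?_⟩⟩
    · simpa using ((hσ (σ⁻¹ k)).1 (A⁻¹ x)).symm
    · apply A.injective
      simpa using ((hσ (σ⁻¹ k)).2 (A⁻¹ u)).symm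
  intPt x := by
    simpa using (hA.intPt (A⁻¹ x)).symm
  det_apply x y := by
    have := hA.det_apply (A⁻¹ x) (A⁻¹ y)
    have hs : ((s : ℤ) : ℝ) * ((s : ℤ) : ℝ) = 1 := by
      rw [← Int.cast_mul, ← Units.val_mul, Int.units_mul_self]; simp
    simp only [LinearEquiv.coe_inv, LinearEquiv.apply_symm_apply] at this
    rw [this, ← mul_assoc, hs, one_mul]
    rfl
  rot_comm := by
    rcases hA.rot_comm with h | h
    · left
      intro x
      apply A.injective
      rw [h]
      simp only [LinearEquiv.coe_inv, LinearEquiv.apply_symm_apply]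
    · right
      intro x
      apply A.injective
      rw [h, h]
      simp only [LinearEquiv.coe_inv, LinearEquiv.apply_symm_apply, rot_rot_rot]

lemma isSymm_rot : IsSymm 1 rot where
  perm := by
    refine ⟨finRotate 3, fun k => ⟨fun x => ?_, fun u => ?_⟩⟩ <;> fin_cases k
    · change |-x.1 - x.2| = |-(x.1 + x.2)|
      rw [neg_add']
    · change |-(x.2 + (-x.1 - x.2))| = |x.1|
      ring_nf
    · rfl
    · change ((-u.2 - (-u.1 - u.2), -u.1 - u.2) : Coord) = (u.1, -u.2 - u.1)
      ext <;> simp <;> ring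
    · change ((-u.1 - u.2, u.2) : Coord) = (-u.1 - u.2, -u.1 - (-u.1 - u.2))
      simp
    · change ((u.2, -u.2 - (-u.1 - u.2)) : Coord) = (u.2, -(-u.1 - u.2) - u.2)
      ext <;> simp
      ring
  intPt x := by
    constructor
    · rintro ⟨m, n, h⟩
      have h1 : x.2 = m := congrArg Prod.fst h
      have h2 : -x.1 - x.2 = n := congrArg Prod.snd h
      exact ⟨-m - n, m, by ext <;> push_cast <;> linarith⟩
    · rintro ⟨m, n, rfl⟩
      exact ⟨n, -m - n, by ext <;> simp⟩
  det_apply x y := by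
    simp only [det, rot_apply]
    push_cast
    ring
  rot_comm := Or.inl fun x => rfl

lemma isSymm_neg : IsSymm 1 (LinearEquiv.neg ℝ) where
  perm := by
    refine ⟨1, fun k => ⟨fun x => ?_, fun u => ?_⟩⟩
    · simp [map_neg, abs_neg]
    · simp [map_neg]
  intPt x := by
    constructor
    · rintro ⟨m, n, h⟩
      have h' : -x = ((m : ℝ), (n : ℝ)) := by simpa using h
      refine ⟨-m, -n, ?_⟩
      rw [← neg_neg x, h']
      ext <;> simp
    · rintro ⟨m, n, rfl⟩
      exact ⟨-m, -n, by ext <;> simp⟩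
  det_apply x y := by
    simp [det]
  rot_comm := Or.inl fun x => by simp [sub_eq_add_neg, add_comm]

lemma isSymm_swap : IsSymm (-1) (LinearEquiv.prodComm ℝ ℝ ℝ) where
  perm := by
    refine ⟨Equiv.swap 0 2, fun k => ⟨fun x => ?_, fun u => ?_⟩⟩ <;> fin_cases k
    · rfl
    · change |-(x.2 + x.1)| = |-(x.1 + x.2)|
      rw [add_comm]
    · rfl
    · change ((-u.2 - u.1, u.1) : Coord) = (-u.1 - u.2, u.1)
      rw [sub_eq_add_neg, sub_eq_add_neg, add_comm]
    · rfl
    · change ((u.2, -u.2 - u.1) : Coord) = (u.2, -u.1 - u.2)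
      rw [sub_eq_add_neg, sub_eq_add_neg, add_comm]
  intPt x := by
    constructor
    · rintro ⟨m, n, h⟩
      exact ⟨n, m, Prod.ext (congrArg Prod.snd h) (congrArg Prod.fst h)⟩
    · rintro ⟨m, n, rfl⟩
      exact ⟨n, m, rfl⟩
  det_apply x y := by
    simp [det]
  rot_comm := Or.inr fun x => by
    ext <;> simp <;> ring

lemma isSymm_rot_pow (n : ℕ) : IsSymm 1 (rot ^ n) := by
  induction n with
  | zero => exact isSymm_one
  | succ n ih => simpa [pow_succ] using ih.mul isSymm_rot

lemma IsSymm.exists_rot_pow {s : ℤˣ} {A : Coord ≃ₗ[ℝ] Coord} (hA : IsSymm s A) (n : ℕ) :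
    ∃ m : ℕ, ∀ x, A ((rot ^ n) x) = (rot ^ m) (A x) := by
  rcases hA.rot_comm with h | h
  · refine ⟨n, fun x => ?_⟩
    induction n with
    | zero => rfl
    | succ n ih => rw [pow_succ', LinearEquiv.mul_apply, LinearEquiv.mul_apply, h, ih]
  · refine ⟨2 * n, fun x => ?_⟩
    induction n with
    | zero => rfl
    | succ n ih =>
      rw [pow_succ', LinearEquiv.mul_apply, h, ih, mul_add, mul_one, pow_succ', pow_succ']
      rfl

lemma IsSymm.evenPt {s : ℤˣ} {A : Coord ≃ₗ[ℝ] Coord} (hA : IsSymm s A) {x : Coord} :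
    EvenPt (A x) ↔ EvenPt x := by
  rw [evenPt_iff, evenPt_iff, ← hA.intPt (_ • x), map_smul]

lemma IsSymm.evenPt_symm {s : ℤˣ} {A : Coord ≃ₗ[ℝ] Coord} (hA : IsSymm s A) {x : Coord} :
    EvenPt (A.symm x) ↔ EvenPt x := by
  rw [← hA.evenPt, LinearEquiv.apply_symm_apply]

lemma IsSymm.mem_hex {s : ℤˣ} {A : Coord ≃ₗ[ℝ] Coord} (hA : IsSymm s A) {x : Coord} :
    A x ∈ Hex ↔ x ∈ Hex := by
  obtain ⟨σ, hσ⟩ := hA.perm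
  constructor
  · intro h k
    have := h (σ⁻¹ k)
    rw [(hσ _).1] at this
    simpa using this
  · intro h k
    rw [(hσ k).1]
    exact h _

lemma oddInt_iff_of_abs_eq {x y : ℝ} (h : |x| = |y|) : OddInt x ↔ OddInt y := by
  rcases abs_eq_abs.1 h with rfl | rfl
  · rfl
  · exact OddInt.neg_iff

lemma IsSymm.isPath {s : ℤˣ} {A : Coord ≃ₗ[ℝ] Coord} (hA : IsSymm s A) {f : ℝ → Coord × Coord}
    {a b : ℝ} (hf : IsPath f a b) : IsPath (fun t => (A (f t).1, A (f t).2)) a b := by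
  obtain ⟨σ, hσ⟩ := hA.perm
  have hw : ∀ k x, OnWall k (A x) ↔ OnWall (σ k) x := fun k x => oddInt_iff_of_abs_eq ((hσ k).1 x)
  refine ⟨fun t ht j k hj hk => ?_, fun t ht => ?_, fun t ht => ?_⟩
  · exact σ.injective (hf.regular t ht _ _ ((hw _ _).1 hj) ((hw _ _).1 hk))
  · filter_upwards [hf.departs t ht] with s hs
    simp [hs]
  · obtain ⟨u, hu, h⟩ := hf.arrives t ht
    refine ⟨A u, ⟨fun hk => ?_, fun k hk => ?_⟩, ?_⟩
    · refine congrArg A (hu.1 fun k hk' => hk (σ⁻¹ k) ?_)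
      rw [hw]
      simpa using hk'
    · rw [(hσ k).2]
      exact congrArg A (hu.2 _ ((hw _ _).1 hk))
    · filter_upwards [h] with s hs
      simp [hs]

/-- The action on the tangent bundle of the affine map `x ↦ A x + c`. -/
def move (A : Coord ≃ₗ[ℝ] Coord) (c : Coord) (z : Coord × Coord) : Coord × Coord :=
  (A z.1 + c, A z.2)

lemma IsSymm.connects {s : ℤˣ} {A : Coord ≃ₗ[ℝ] Coord} (hA : IsSymm s A) {c : Coord}
    (hc : EvenPt c) {P Q : Coord × Coord → Prop} {z z' : Coord × Coord} {T : ℝ}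
    (h : Connects P z z' T) (hPQ : ∀ z, P z → Q (move A c z)) :
    Connects Q (move A c z) (move A c z') T := by
  obtain ⟨f, hf, rfl, rfl, hP⟩ := h
  exact ⟨fun t => move A c (f t), (hA.isPath hf).shift hc, rfl, rfl, fun t ht => hPQ _ (hP t ht)⟩

lemma IsSymm.isOrbit {s : ℤˣ} {A : Coord ≃ₗ[ℝ] Coord} (hA : IsSymm s A) {c : Coord}
    (hc : EvenPt c) {γ : ℝ → Coord × Coord} (hγ : IsOrbit γ) :
    IsOrbit (fun t => move A c (γ t)) :=
  fun a b => (hA.isPath (hγ a b)).shift hc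

lemma exists_isSymm_one_nonneg (x : Coord) :
    ∃ A, IsSymm 1 A ∧ 0 ≤ (A x).1 ∧ 0 ≤ (A x).2 := by
  -- up to sign, the first coordinate is non-negative
  wlog hx : 0 ≤ x.1 generalizing x
  · obtain ⟨A, hA, h⟩ := this (LinearEquiv.neg ℝ x) (by simpa using (not_le.1 hx).le)
    exact ⟨A * LinearEquiv.neg ℝ, by simpa using hA.mul isSymm_neg, h⟩
  rcases le_total 0 x.2 with h2 | h2
  · exact ⟨1, isSymm_one, hx, h2⟩
  rcases le_total 0 (x.1 + x.2) with h3 | h3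
  · refine ⟨LinearEquiv.neg ℝ * rot, by simpa using isSymm_neg.mul isSymm_rot, ?_, ?_⟩
    · simpa using h2
    · simpa [add_comm] using h3
  · refine ⟨rot * rot, by simpa using isSymm_rot.mul isSymm_rot, ?_, ?_⟩
    · simp; linarith
    · simpa using hx

/-- Every vector is moved into the cone of vectors with non-negative coordinates by a symmetry of
the hexagon of any given determinant. -/
lemma exists_isSymm_nonneg (s : ℤˣ) (x : Coord) :
    ∃ A, IsSymm s A ∧ 0 ≤ (A x).1 ∧ 0 ≤ (A x).2 := by
  obtain ⟨A, hA, h1, h2⟩ := exists_isSymm_one_nonneg x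
  rcases Int.units_eq_one_or s with rfl | rfl
  · exact ⟨A, hA, h1, h2⟩
  · exact ⟨LinearEquiv.prodComm ℝ ℝ ℝ * A, by simpa using isSymm_swap.mul hA, h2, h1⟩

lemma convex_hex : Convex ℝ Hex := by
  have : Hex = ⋂ k, height k ⁻¹' Ioo (-1) 1 := by
    ext x
    simp [Hex, abs_lt]
  rw [this]
  exact convex_iInter fun k => (convex_Ioo _ _).linear_preimage _

lemma not_onWall_of_mem_hex {x : Coord} (hx : x ∈ Hex) (k : Fin 3) : ¬ OnWall k x :=
  not_oddInt_of_lt 0 (by simpa using (abs_lt.1 (hx k)).1) (by simpa using (abs_lt.1 (hx k)).2)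

lemma add_smul_mem_hex {x u : Coord} {s T : ℝ} (hx : x ∈ Hex) (hT : x + T • u ∈ Hex)
    (hs : s ∈ uIcc 0 T) : x + s • u ∈ Hex := by
  rw [← segment_eq_uIcc] at hs
  obtain ⟨a, b, ha, hb, hab, rfl⟩ := hs
  have := convex_hex hx hT ha hb hab
  convert this using 1
  rw [smul_zero, zero_add, smul_add, ← add_assoc, ← add_smul, hab, one_smul, smul_smul, smul_eq_mul]

/-! ### One round: from a hexagon through a triangle to the next hexagon -/

/-- The vector of slope parameter `ρ` and size `d` in the cone of non-negative coordinates. -/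
def coneVec (d ρ : ℝ) : Coord := d • (1 - ρ, ρ)

/-- The state that crosses, with velocity `coneVec d ρ`, the radius from the center `0` of a hexagon
to its vertex `(1, -1)`; `r` is the distance from the center. -/
def crossing (d ρ r : ℝ) : Coord × Coord := ((r, -r), coneVec d ρ)

/-- The distance from the center at which the radius of the next hexagon is crossed: the rotation of
the circle by `-ρ`. -/
noncomputable def nextOffset (ρ r : ℝ) : ℝ := if r < ρ then r + 1 - ρ else r - ρ

/-- The center of the next hexagon. -/
noncomputable def jump (ρ r : ℝ) : Coord := if r < ρ then (2, 0) else (2, -2)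

/-- The state `z`, if inside a hexagon, has a direction obtained from `u` by a rotation, travels
counter-clockwise around the center, and does not lie on the corresponding rotation of the line
through the center and the vertex `(1, -1)`. -/
def Between (u : Coord) (z : Coord × Coord) : Prop :=
  ∀ c, EvenPt c → z.1 - c ∈ Hex →
    ∃ n : ℕ, z.2 = (rot ^ n) u ∧ 0 < det (z.1 - c) z.2 ∧ height 1 ((rot ^ n).symm (z.1 - c)) ≠ 0

lemma eq_of_mem_hex {x c c' : Coord} (hc : EvenPt c) (hc' : EvenPt c') (h : x - c ∈ Hex)
    (h' : x - c' ∈ Hex) : c = c' := by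
  obtain ⟨m, n, rfl⟩ := hc
  obtain ⟨m', n', rfl⟩ := hc'
  have key : ∀ (a : ℝ) (i j : ℤ), |a - 2 * i| < 1 → |a - 2 * j| < 1 → i = j := by
    intro a i j hi hj
    rw [abs_lt] at hi hj
    have h1 : (i : ℝ) < j + 1 := by linarith
    have h2 : (j : ℝ) < i + 1 := by linarith
    have h1' : i < j + 1 := by exact_mod_cast h1
    have h2' : j < i + 1 := by exact_mod_cast h2
    omega
  rw [key _ _ _ (h 2) (h' 2), key _ _ _ (h 0) (h' 0)]

lemma Between.of_center {u c₀ : Coord} {z : Coord × Coord} (hc₀ : EvenPt c₀) (hz : z.1 - c₀ ∈ Hex)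
    (n : ℕ) (hn : z.2 = (rot ^ n) u) (hdet : 0 < det (z.1 - c₀) z.2)
    (hh : height 1 ((rot ^ n).symm (z.1 - c₀)) ≠ 0) : Between u z := by
  intro c hc hzc
  rw [eq_of_mem_hex hc hc₀ hzc hz]
  exact ⟨n, hn, hdet, hh⟩

lemma Between.of_onWall {u : Coord} {z : Coord × Coord} {k : Fin 3} (hk : OnWall k z.1) :
    Between u z := by
  intro c hc hzc
  refine absurd ?_ (not_onWall_of_mem_hex hzc k)
  rw [sub_eq_add_neg, onWall_add_even hc.neg]
  exact hk

lemma mem_hex {p q : ℝ} (h1 : -1 < p) (h2 : p < 1) (h3 : -1 < q) (h4 : q < 1) (h5 : -1 < p + q)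
    (h6 : p + q < 1) : ((p, q) : Coord) ∈ Hex := by
  intro k
  fin_cases k
  · exact abs_lt.2 ⟨h3, h4⟩
  · change |-(p + q)| < 1
    rw [abs_neg]
    exact abs_lt.2 ⟨h5, h6⟩
  · exact abs_lt.2 ⟨h1, h2⟩

lemma not_onWall {p q : ℝ} (m n l : ℤ) (hp : 2 * m - 1 < p ∧ p < 2 * m + 1)
    (hq : 2 * n - 1 < q ∧ q < 2 * n + 1) (hpq : 2 * l - 1 < p + q ∧ p + q < 2 * l + 1)
    (k : Fin 3) : ¬ OnWall k ((p, q) : Coord) := by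
  fin_cases k
  · exact not_oddInt_of_lt n hq.1 hq.2
  · refine not_oddInt_of_lt (-l) ?_ ?_ <;> simp <;> linarith
  · exact not_oddInt_of_lt m hp.1 hp.2

/-- A point that lies in the strips belonging to even numbers `2 m`, `2 n`, `2 l` with `m + n ≠ l`
is not in any hexagon: it is in a triangle. -/
lemma Between.of_triangle {u w : Coord} {p q : ℝ} (m n l : ℤ) (hp : 2 * m - 1 < p ∧ p < 2 * m + 1)
    (hq : 2 * n - 1 < q ∧ q < 2 * n + 1) (hpq : 2 * l - 1 < p + q ∧ p + q < 2 * l + 1)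
    (hne : m + n ≠ l) : Between u ((p, q), w) := by
  rintro c ⟨m', n', rfl⟩ h
  have h2 := abs_lt.1 (h 2)
  have h0 := abs_lt.1 (h 0)
  have h1 := abs_lt.1 (h 1)
  simp only [height_zero, height_one, height_two, Prod.fst_sub, Prod.snd_sub] at h0 h1 h2
  have key : ∀ (i j : ℤ), (i : ℝ) < j + 1 → (j : ℝ) < i + 1 → i = j := by
    intro i j hi hj
    have hi' : i < j + 1 := by exact_mod_cast hi
    have hj' : j < i + 1 := by exact_mod_cast hj
    omega
  have e1 := key m m' (by linarith) (by linarith)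
  have e2 := key n n' (by linarith) (by linarith)
  have e3 := key l (m' + n') (by push_cast; linarith) (by push_cast; linarith)
  omega

/-- A form of `connects_segment` in which the velocity is a multiple of the vector `w`. -/
lemma connects_segment_smul {P : Coord × Coord → Prop} {x w x' u' : Coord} {d τ : ℝ} (hd : 0 < d)
    (hτ : 0 < τ) (hx : x + τ • w = x') (h₀ : Regular x) (h₁ : Regular x')
    (h : ∀ s ∈ Ioo 0 τ, ∀ k, ¬ OnWall k (x + s • w)) (hu : Refracts x' (d • w) u')
    (hP : ∀ s ∈ Ioo 0 τ, P (x + s • w, d • w)) : Connects P (x, d • w) (x', u') (τ / d) := by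
  have hs : ∀ t ∈ Ioo 0 (τ / d), t * d ∈ Ioo 0 τ := fun t ht =>
    ⟨mul_pos ht.1 hd, (lt_div_iff₀ hd).1 ht.2⟩
  refine connects_segment (div_pos hτ hd) ?_ h₀ h₁ (fun t ht => ?_) hu (fun t ht => ?_)
  · rw [smul_smul, div_mul_cancel₀ _ hd.ne', hx]
  · rw [smul_smul]
    exact h _ (hs t ht)
  · rw [smul_smul]
    exact hP _ (hs t ht)

lemma regular_of_only_wall {x : Coord} (k : Fin 3) (h : ∀ j, j ≠ k → ¬ OnWall j x) :
    Regular x := by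
  have key : ∀ j, OnWall j x → j = k := fun j hj => by_contra fun hne => h j hne hj
  exact fun i j hi hj => (key i hi).trans (key j hj).symm

lemma regular_of_wall_two {p q : ℝ} (n l : ℤ) (hq : 2 * n - 1 < q ∧ q < 2 * n + 1)
    (hpq : 2 * l - 1 < p + q ∧ p + q < 2 * l + 1) : Regular ((p, q) : Coord) := by
  have h0 : ¬ OnWall 0 ((p, q) : Coord) := not_oddInt_of_lt n hq.1 hq.2
  have h1 : ¬ OnWall 1 ((p, q) : Coord) := by
    refine not_oddInt_of_lt (-l) ?_ ?_ <;> simp <;> linarith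
  refine regular_of_only_wall 2 fun j hj => ?_
  fin_cases j
  · exact h0
  · exact h1
  · exact absurd rfl hj

lemma regular_of_wall_zero {p q : ℝ} (n l : ℤ) (hp : 2 * n - 1 < p ∧ p < 2 * n + 1)
    (hpq : 2 * l - 1 < p + q ∧ p + q < 2 * l + 1) : Regular ((p, q) : Coord) := by
  have h0 : ¬ OnWall 2 ((p, q) : Coord) := not_oddInt_of_lt n hp.1 hp.2
  have h1 : ¬ OnWall 1 ((p, q) : Coord) := by
    refine not_oddInt_of_lt (-l) ?_ ?_ <;> simp <;> linarith
  refine regular_of_only_wall 0 fun j hj => ?_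
  fin_cases j
  · exact absurd rfl hj
  · exact h1
  · exact h0

lemma regular_of_wall_one {p q : ℝ} (m n : ℤ) (hp : 2 * m - 1 < p ∧ p < 2 * m + 1)
    (hq : 2 * n - 1 < q ∧ q < 2 * n + 1) : Regular ((p, q) : Coord) := by
  have h0 : ¬ OnWall 2 ((p, q) : Coord) := not_oddInt_of_lt m hp.1 hp.2
  have h1 : ¬ OnWall 0 ((p, q) : Coord) := not_oddInt_of_lt n hq.1 hq.2
  refine regular_of_only_wall 1 fun j hj => ?_
  fin_cases j
  · exact h1
  · exact absurd rfl hj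
  · exact h0

lemma mem_hex_radius {r : ℝ} (h0 : 0 ≤ r) (h1 : r < 1) : ((r, -r) : Coord) ∈ Hex :=
  mem_hex (by linarith) h1 (by linarith) (by linarith) (by linarith) (by linarith)

lemma evenPt_jump (ρ r : ℝ) : EvenPt (jump ρ r) := by
  unfold jump
  split_ifs
  · exact ⟨1, 0, by simp⟩
  · exact ⟨1, -1, by simp⟩

lemma exists_round_of_gt {d ρ r : ℝ} (hd : 0 < d) (hρ : 0 ≤ ρ) (hr : r < 1) (h : ρ < r) :
    ∃ T, 1 / d ≤ T ∧ Connects (Between (coneVec d ρ)) (crossing d ρ r)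
      (move rot (2, -2) (crossing d ρ (r - ρ))) T := by
  have hρ1 : 0 < 1 - ρ := by linarith
  obtain ⟨τ, hτ⟩ : ∃ τ, τ * (1 - ρ) = 1 - r := ⟨_, div_mul_cancel₀ _ hρ1.ne'⟩
  have hτ0 : 0 < τ := pos_of_mul_pos_left (by rw [hτ]; linarith) hρ1.le
  have hτ1 : τ < 1 := lt_of_mul_lt_mul_right (by linarith) hρ1.le
  have hm2 : mirror 2 (1 - ρ, ρ) = (1 - ρ, -1) := by ext <;> simp
  have hm0 : mirror 0 (1 - ρ, -1) = (ρ, -1) := by ext <;> simp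
  have hc : EvenPt (2, -2) := ⟨1, -1, by simp⟩
  have hmul : ∀ s, 0 < s → s < 1 → 0 ≤ s * ρ ∧ s * ρ < r ∧ 0 < s * (1 - ρ) ∧
      s * (1 - ρ) < 1 - ρ := by
    intro s h0 h1
    refine ⟨by positivity, ?_, by positivity, by nlinarith⟩
    nlinarith
  -- through the hexagon, to the edge on the line `p = 1`
  have seg1 : Connects (Between (coneVec d ρ)) ((r, -r), d • (1 - ρ, ρ))
      ((1, τ - 1), d • (1 - ρ, -1)) (τ / d) := by
    have hx : ∀ s : ℝ, ((r, -r) : Coord) + s • ((1 - ρ, ρ) : Coord) =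
        (r + s * (1 - ρ), -r + s * ρ) := fun s => by simp
    have hhex : ∀ s ∈ Ioo 0 τ, ((r, -r) : Coord) + s • ((1 - ρ, ρ) : Coord) ∈ Hex := by
      intro s hs
      obtain ⟨h1, h2, h3, h4⟩ := hmul s hs.1 (hs.2.trans hτ1)
      have h5 : s * (1 - ρ) < τ * (1 - ρ) := mul_lt_mul_of_pos_right hs.2 hρ1
      rw [hx]
      exact mem_hex (by linarith) (by linarith) (by linarith) (by linarith)
        (by linarith [hs.1]) (by linarith [hs.2])
    refine connects_segment_smul hd hτ0 (by rw [hx]; ext <;> simp <;> linarith)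
      (regular_of_not_onWall (not_onWall_of_mem_hex (mem_hex_radius (by linarith) hr)))
      (regular_of_wall_two 0 0 ?_ ?_) (fun s hs => not_onWall_of_mem_hex (hhex s hs)) ?_ ?_
    · constructor <;> push_cast <;> linarith
    · constructor <;> push_cast <;> linarith
    · rw [← hm2, ← map_smul]
      refine Regular.refracts_mirror (regular_of_wall_two 0 0 ?_ ?_) ⟨0, by simp⟩
      · constructor <;> push_cast <;> linarith
      · constructor <;> push_cast <;> linarith
    · intro s hs
      refine Between.of_center (c₀ := 0) evenPt_zero (by simpa using hhex s hs) 0 rfl ?_ ?_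
      · have : 0 < d * r := mul_pos hd (by linarith)
        simp [det]
        nlinarith
      · change height 1 (((r, -r) : Coord) + s • ((1 - ρ, ρ) : Coord) - 0) ≠ 0
        rw [sub_zero, hx, height_one]
        intro h
        linarith [hs.1]
  -- through the triangle, to the edge on the line `q = -1`
  have seg2 : Connects (Between (coneVec d ρ)) ((1, τ - 1), d • (1 - ρ, -1))
      ((2 - r, -1), d • (ρ, -1)) (τ / d) := by
    have hx : ∀ s : ℝ, ((1, τ - 1) : Coord) + s • ((1 - ρ, -1) : Coord) =
        (1 + s * (1 - ρ), τ - 1 - s) := fun s => by ext <;> simp; ring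
    have hin : ∀ s ∈ Ioo 0 τ, 0 < s * (1 - ρ) ∧ s * (1 - ρ) < 1 ∧ 0 < τ - s * ρ ∧ 0 ≤ s * ρ := by
      intro s hs
      obtain ⟨h1, h2, h3, h4⟩ := hmul s hs.1 (hs.2.trans hτ1)
      exact ⟨h3, by linarith, by nlinarith [hs.2], h1⟩
    have hreg : Regular ((2 - r, -1) : Coord) := by
      refine regular_of_wall_zero 1 0 ?_ ?_ <;> constructor <;> push_cast <;> linarith
    refine connects_segment_smul hd hτ0 (by rw [hx]; ext <;> simp <;> linarith)
      (regular_of_wall_two 0 0 ?_ ?_) hreg (fun s hs => ?_) ?_ ?_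
    · constructor <;> push_cast <;> linarith
    · constructor <;> push_cast <;> linarith
    · obtain ⟨h1, h2, h3, h4⟩ := hin s hs
      have := hs.1
      have := hs.2
      rw [hx]
      refine not_onWall 1 0 0 ?_ ?_ ?_ <;> constructor <;> push_cast <;> linarith
    · rw [← hm0, ← map_smul]
      exact hreg.refracts_mirror ⟨-1, by norm_num⟩
    · intro s hs
      obtain ⟨h1, h2, h3, h4⟩ := hin s hs
      have := hs.1
      have := hs.2
      rw [hx]
      refine Between.of_triangle 1 0 0 ?_ ?_ ?_ (by norm_num) <;> constructor <;> push_cast <;>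
        linarith
  -- through the next hexagon, to the radius
  have seg3 : Connects (Between (coneVec d ρ)) ((2 - r, -1), d • (ρ, -1))
      ((2 - (r - ρ), -2), d • (ρ, -1)) (1 / d) := by
    have hx : ∀ s : ℝ, ((2 - r, -1) : Coord) + s • ((ρ, -1) : Coord) =
        (2 - r + s * ρ, -1 - s) := fun s => by ext <;> simp; ring
    have hx' : ∀ s : ℝ, ((2 - r, -1) : Coord) + s • ((ρ, -1) : Coord) - (2, -2) =
        (-r + s * ρ, 1 - s) := fun s => by ext <;> (simp; ring)
    have hhex : ∀ s ∈ Ioo (0 : ℝ) 1,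
        ((2 - r, -1) : Coord) + s • ((ρ, -1) : Coord) - (2, -2) ∈ Hex := by
      intro s hs
      obtain ⟨h1, h2, h3, h4⟩ := hmul s hs.1 hs.2
      have := hs.1
      have := hs.2
      rw [hx']
      exact mem_hex (by linarith) (by linarith) (by linarith) (by linarith)
        (by linarith) (by linarith)
    have hend : ∀ k, ¬ OnWall k ((2 - (r - ρ), -2) : Coord) := by
      refine not_onWall 1 (-1) 0 ?_ ?_ ?_ <;> constructor <;> push_cast <;> linarith
    refine connects_segment_smul hd one_pos (by rw [hx]; ext <;> simp <;> linarith)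
      ?_ (regular_of_not_onWall hend) (fun s hs => ?_) (refracts_self hend) ?_
    · refine regular_of_wall_zero 1 0 ?_ ?_ <;> constructor <;> push_cast <;> linarith
    · obtain ⟨h1, h2, h3, h4⟩ := hmul s hs.1 hs.2
      have := hs.1
      have := hs.2
      rw [hx]
      refine not_onWall 1 (-1) 0 ?_ ?_ ?_ <;> constructor <;> push_cast <;> linarith
    · intro s hs
      refine Between.of_center hc (hhex s hs) 1 ?_ ?_ ?_
      · ext <;> simp [coneVec]
        ring
      · have : 0 < d * (r - ρ) := mul_pos hd (by linarith)
        simp only [hx', det]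
        simp
        nlinarith
      · simp only [hx']
        have := hs.2
        simp [rot]
        intro h
        nlinarith
  refine ⟨τ / d + (τ / d + 1 / d), ?_, ?_⟩
  · have : 0 < τ / d := by positivity
    linarith
  · have := seg1.trans (by positivity) (by positivity) (Between.of_onWall (k := 2) ⟨0, by simp⟩)
      (seg2.trans (by positivity) (by positivity)
        (Between.of_onWall (k := 0) ⟨-1, by norm_num⟩) seg3)
    have e : move rot (2, -2) (crossing d ρ (r - ρ)) = ((2 - (r - ρ), -2), d • (ρ, -1)) := by
      simp [move, crossing, coneVec]
      constructor <;> ring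
    rw [e]
    exact this

lemma exists_round_of_lt {d ρ r : ℝ} (hd : 0 < d) (hρ : ρ ≤ 1) (hr : 0 < r) (h : r < ρ) :
    ∃ T, 1 / d ≤ T ∧ Connects (Between (coneVec d ρ)) (crossing d ρ r)
      (move rot (2, 0) (crossing d ρ (r + 1 - ρ))) T := by
  have hρ0 : 0 < ρ := by linarith
  obtain ⟨τ, hτ⟩ : ∃ τ, τ * ρ = ρ - r := ⟨_, div_mul_cancel₀ _ hρ0.ne'⟩
  have hτ0 : 0 < τ := pos_of_mul_pos_left (by rw [hτ]; linarith) hρ0.le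
  have hτ1 : τ < 1 := lt_of_mul_lt_mul_right (by linarith) hρ0.le
  have hm1 : mirror 1 (1 - ρ, ρ) = (ρ, 1 - ρ) := by ext <;> simp
  have hm2 : mirror 2 (ρ, 1 - ρ) = (ρ, -1) := by ext <;> simp; ring
  have hc : EvenPt (2, 0) := ⟨1, 0, by simp⟩
  -- through the hexagon, to the edge on the line `p + q = 1`
  have seg1 : Connects (Between (coneVec d ρ)) ((r, -r), d • (1 - ρ, ρ))
      ((r + 1 - ρ, ρ - r), d • (ρ, 1 - ρ)) (1 / d) := by
    have hx : ∀ s : ℝ, ((r, -r) : Coord) + s • ((1 - ρ, ρ) : Coord) =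
        (r + s * (1 - ρ), -r + s * ρ) := fun s => by simp
    have hhex : ∀ s ∈ Ioo (0 : ℝ) 1, ((r, -r) : Coord) + s • ((1 - ρ, ρ) : Coord) ∈ Hex := by
      intro s hs
      have h1 : 0 ≤ s * (1 - ρ) := mul_nonneg hs.1.le (by linarith)
      have h2 : s * (1 - ρ) ≤ 1 - ρ := mul_le_of_le_one_left (by linarith) hs.2.le
      have h3 : 0 < s * ρ := mul_pos hs.1 hρ0
      have h4 : s * ρ < ρ := mul_lt_of_lt_one_left hρ0 hs.2
      rw [hx]
      exact mem_hex (by linarith) (by linarith) (by linarith) (by linarith)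
        (by linarith [hs.1]) (by linarith [hs.2])
    have hreg : Regular ((r + 1 - ρ, ρ - r) : Coord) := by
      refine regular_of_wall_one 0 0 ?_ ?_ <;> constructor <;> push_cast <;> linarith
    refine connects_segment_smul hd one_pos (by rw [hx]; ext <;> simp <;> linarith)
      (regular_of_not_onWall (not_onWall_of_mem_hex (mem_hex_radius hr.le (by linarith))))
      hreg (fun s hs => not_onWall_of_mem_hex (hhex s hs)) ?_ ?_
    · rw [← hm1, ← map_smul]
      exact hreg.refracts_mirror ⟨-1, by simp; ring⟩
    · intro s hs
      refine Between.of_center (c₀ := 0) evenPt_zero (by simpa using hhex s hs) 0 rfl ?_ ?_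
      · have : 0 < d * r := mul_pos hd (by linarith)
        simp [det]
        nlinarith
      · change height 1 (((r, -r) : Coord) + s • ((1 - ρ, ρ) : Coord) - 0) ≠ 0
        rw [sub_zero, hx, height_one]
        intro h
        linarith [hs.1]
  -- through the triangle, to the edge on the line `p = 1`
  have seg2 : Connects (Between (coneVec d ρ)) ((r + 1 - ρ, ρ - r), d • (ρ, 1 - ρ))
      ((1, τ), d • (ρ, -1)) (τ / d) := by
    have hx : ∀ s : ℝ, ((r + 1 - ρ, ρ - r) : Coord) + s • ((ρ, 1 - ρ) : Coord) =
        (r + 1 - ρ + s * ρ, ρ - r + s * (1 - ρ)) := fun s => by simp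
    have hin : ∀ s ∈ Ioo 0 τ, 0 < s * ρ ∧ s * ρ < ρ - r ∧ 0 ≤ s * (1 - ρ) ∧
        s * (1 - ρ) ≤ τ * (1 - ρ) := by
      intro s hs
      refine ⟨mul_pos hs.1 hρ0, ?_, mul_nonneg hs.1.le (by linarith), ?_⟩
      · rw [← hτ]
        exact mul_lt_mul_of_pos_right hs.2 hρ0
      · exact mul_le_mul_of_nonneg_right hs.2.le (by linarith)
    have hreg : Regular ((1, τ) : Coord) := by
      refine regular_of_wall_two 0 1 ?_ ?_ <;> constructor <;> push_cast <;> linarith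
    refine connects_segment_smul hd hτ0 (by rw [hx]; ext <;> simp <;> linarith)
      (regular_of_wall_one 0 0 ?_ ?_) hreg (fun s hs => ?_) ?_ ?_
    · constructor <;> push_cast <;> linarith
    · constructor <;> push_cast <;> linarith
    · obtain ⟨h1, h2, h3, h4⟩ := hin s hs
      have := hs.1
      have := hs.2
      rw [hx]
      refine not_onWall 0 0 1 ?_ ?_ ?_ <;> constructor <;> push_cast <;> linarith
    · rw [← hm2, ← map_smul]
      exact hreg.refracts_mirror ⟨0, by norm_num⟩
    · intro s hs
      obtain ⟨h1, h2, h3, h4⟩ := hin s hs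
      have := hs.1
      have := hs.2
      rw [hx]
      refine Between.of_triangle 0 0 1 ?_ ?_ ?_ (by norm_num) <;> constructor <;> push_cast <;>
        linarith
  -- through the next hexagon, to the radius
  have seg3 : Connects (Between (coneVec d ρ)) ((1, τ), d • (ρ, -1))
      ((1 + ρ - r, 0), d • (ρ, -1)) (τ / d) := by
    have hx : ∀ s : ℝ, ((1, τ) : Coord) + s • ((ρ, -1) : Coord) =
        (1 + s * ρ, τ - s) := fun s => by ext <;> simp; ring
    have hx' : ∀ s : ℝ, ((1, τ) : Coord) + s • ((ρ, -1) : Coord) - (2, 0) =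
        (-1 + s * ρ, τ - s) := fun s => by ext <;> (simp; try ring)
    have hin : ∀ s ∈ Ioo 0 τ, 0 < s * ρ ∧ s * ρ < ρ - r ∧ s * ρ ≤ s ∧
        -1 < -1 + s * ρ + (τ - s) := by
      intro s hs
      refine ⟨mul_pos hs.1 hρ0, ?_, mul_le_of_le_one_right hs.1.le hρ, ?_⟩
      · rw [← hτ]
        exact mul_lt_mul_of_pos_right hs.2 hρ0
      · nlinarith [hs.1, hs.2]
    have hend : ∀ k, ¬ OnWall k ((1 + ρ - r, 0) : Coord) := by
      refine not_onWall 1 0 1 ?_ ?_ ?_ <;> constructor <;> push_cast <;> linarith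
    refine connects_segment_smul hd hτ0 (by rw [hx]; ext <;> simp <;> linarith)
      ?_ (regular_of_not_onWall hend) (fun s hs => ?_) (refracts_self hend) ?_
    · refine regular_of_wall_two 0 1 ?_ ?_ <;> constructor <;> push_cast <;> linarith
    · obtain ⟨h1, h2, h3, h4⟩ := hin s hs
      have := hs.1
      have := hs.2
      rw [hx]
      refine not_onWall 1 0 1 ?_ ?_ ?_ <;> constructor <;> push_cast <;> linarith
    · intro s hs
      obtain ⟨h1, h2, h3, h4⟩ := hin s hs
      have := hs.1
      have := hs.2
      have hhex : ((1, τ) : Coord) + s • ((ρ, -1) : Coord) - (2, 0) ∈ Hex := by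
        rw [hx']
        exact mem_hex (by linarith) (by linarith) (by linarith) (by linarith)
          (by linarith) (by linarith)
      refine Between.of_center hc hhex 1 ?_ ?_ ?_
      · ext <;> simp [coneVec]
        ring
      · have : 0 < d * (1 - τ * ρ) := mul_pos hd (by linarith)
        simp only [hx', det]
        simp
        nlinarith
      · simp only [hx']
        simp [rot]
        intro h
        nlinarith
  refine ⟨1 / d + (τ / d + τ / d), ?_, ?_⟩
  · have : 0 < τ / d := by positivity
    linarith
  · have := seg1.trans (by positivity) (by positivity)
      (Between.of_onWall (k := 1) ⟨-1, by simp; ring⟩)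
      (seg2.trans (by positivity) (by positivity)
        (Between.of_onWall (k := 2) ⟨0, by norm_num⟩) seg3)
    have e : move rot (2, 0) (crossing d ρ (r + 1 - ρ)) = ((1 + ρ - r, 0), d • (ρ, -1)) := by
      simp [move, crossing, coneVec]
      constructor <;> ring
    rw [e]
    exact this

/-- One round of the flow: from the radius of a hexagon to the radius of the next one. -/
lemma exists_round {d ρ r : ℝ} (hd : 0 < d) (hρ : ρ ∈ Icc (0 : ℝ) 1) (hr : r ∈ Ioo (0 : ℝ) 1)
    (h : r ≠ ρ) : ∃ T, 1 / d ≤ T ∧ Connects (Between (coneVec d ρ)) (crossing d ρ r)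
      (move rot (jump ρ r) (crossing d ρ (nextOffset ρ r))) T := by
  unfold jump nextOffset
  rcases lt_or_gt_of_ne h with h | h
  · rw [if_pos h, if_pos h]
    exact exists_round_of_lt hd hρ.2 hr.1 h
  · rw [if_neg (not_lt.2 h.le), if_neg (not_lt.2 h.le)]
    exact exists_round_of_gt hd hρ.1 hr.2 h

lemma Between.move {u : Coord} {z : Coord × Coord} (h : Between u z) (n : ℕ) {c : Coord}
    (hc : EvenPt c) : Between u (move (rot ^ n) c z) := by
  have hA := isSymm_rot_pow n
  intro c' hc' hz
  have e : (TriHex.move (rot ^ n) c z).1 - c' = (rot ^ n) (z.1 - (rot ^ n).symm (c' - c)) := by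
    simp [TriHex.move]
    abel
  rw [e] at hz ⊢
  obtain ⟨m, hm1, hm2, hm3⟩ := h _ (hA.evenPt_symm.2 (by
    rw [sub_eq_add_neg]; exact hc'.add hc.neg)) (hA.mem_hex.1 hz)
  refine ⟨n + m, ?_, ?_, ?_⟩
  · rw [pow_add]
    exact congrArg _ hm1
  · have := hA.det_apply (z.1 - (rot ^ n).symm (c' - c)) z.2
    simp only [TriHex.move]
    rw [this]
    simpa using hm2
  · rw [pow_add]
    have : ∀ y, (rot ^ n * rot ^ m).symm ((rot ^ n) y) = (rot ^ m).symm y := fun y => by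
      rw [LinearEquiv.symm_apply_eq, LinearEquiv.mul_apply, LinearEquiv.apply_symm_apply]
    rwa [this]

/-! ### The drift after one period of the rotation -/

/-- The distance from the center at which the radius is crossed in the `n`-th round. -/
noncomputable def offset (ρ r : ℝ) (n : ℕ) : ℝ := Int.fract (r - n * ρ)

/-- The center of the hexagon in which the `n`-th round starts. -/
noncomputable def center (ρ r : ℝ) (n : ℕ) : Coord :=
  ∑ i ∈ Finset.range n, (rot ^ i) (jump ρ (offset ρ r i))

/-- The state in which the `n`-th round starts. -/
noncomputable def crossingAt (d ρ r : ℝ) (n : ℕ) : Coord × Coord :=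
  move (rot ^ n) (center ρ r n) (crossing d ρ (offset ρ r n))

/-- The vector joins the centers of two hexagons that share a vertex. -/
structure UnitStep (e : Coord) : Prop where
  evenPt : EvenPt e
  ne_zero : e ≠ 0
  abs_height_le : ∀ k, |height k e| ≤ 2

lemma UnitStep.neg {e : Coord} (h : UnitStep e) : UnitStep (-e) :=
  ⟨h.evenPt.neg, neg_ne_zero.2 h.ne_zero, fun k => by
    rw [map_neg, abs_neg]; exact h.abs_height_le k⟩

lemma UnitStep.map {e : Coord} (h : UnitStep e) {s : ℤˣ} {A : Coord ≃ₗ[ℝ] Coord}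
    (hA : IsSymm s A) : UnitStep (A e) := by
  refine ⟨hA.evenPt.2 h.evenPt, ?_, fun k => ?_⟩
  · rw [Ne, LinearEquiv.map_eq_zero_iff]
    exact h.ne_zero
  · obtain ⟨σ, hσ⟩ := hA.perm
    rw [(hσ k).1]
    exact h.abs_height_le _

lemma nextOffset_offset {ρ : ℝ} (hρ : ρ ∈ Icc (0 : ℝ) 1) (r : ℝ) (n : ℕ) :
    nextOffset ρ (offset ρ r n) = offset ρ r (n + 1) := by
  set x := r - n * ρ with hx
  have h0 := Int.fract_nonneg x
  have h1 := Int.fract_lt_one x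
  have hf := Int.self_sub_floor x
  unfold offset nextOffset
  rw [← hx]
  symm
  split_ifs with h
  · refine Int.fract_eq_iff.2 ⟨by linarith [hρ.2], by linarith, ⌊x⌋ - 1, ?_⟩
    push_cast
    linarith
  · refine Int.fract_eq_iff.2 ⟨by linarith [hρ.2], by linarith [hρ.1], ⌊x⌋, ?_⟩
    push_cast
    linarith

lemma evenPt_center (ρ r : ℝ) (n : ℕ) : EvenPt (center ρ r n) := by
  induction n with
  | zero => exact evenPt_zero
  | succ n ih =>
    rw [center, Finset.sum_range_succ]
    exact ih.add ((isSymm_rot_pow n).evenPt.2 (evenPt_jump _ _))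

lemma exists_round_at {d ρ r : ℝ} {n : ℕ} (hd : 0 < d) (hρ : ρ ∈ Icc (0 : ℝ) 1)
    (h0 : offset ρ r n ≠ 0) (h : offset ρ r n ≠ ρ) :
    ∃ T, 1 / d ≤ T ∧
      Connects (Between (coneVec d ρ)) (crossingAt d ρ r n) (crossingAt d ρ r (n + 1)) T := by
  obtain ⟨T, hT, hc⟩ := exists_round hd hρ
    (r := offset ρ r n) ⟨(Int.fract_nonneg _).lt_of_ne h0.symm, Int.fract_lt_one _⟩ h
  refine ⟨T, hT, ?_⟩
  have := (isSymm_rot_pow n).connects (evenPt_center ρ r n) hc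
    fun z hz => hz.move n (evenPt_center ρ r n)
  have e : crossingAt d ρ r (n + 1) = move (rot ^ n) (center ρ r n)
      (move rot (jump ρ (offset ρ r n)) (crossing d ρ (nextOffset ρ (offset ρ r n)))) := by
    simp only [crossingAt, nextOffset_offset hρ, move, center, Finset.sum_range_succ, pow_succ,
      LinearEquiv.mul_apply, map_add]
    rw [add_assoc, add_comm (Finset.sum _ _)]
  rw [e]
  exact this

lemma offset_add {ρ r : ℝ} {P : ℤ} {Q : ℕ} (h : Q * ρ = P) (n : ℕ) :
    offset ρ r (Q + n) = offset ρ r n := by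
  unfold offset
  push_cast
  rw [add_mul, h, add_comm, ← sub_sub, Int.fract_sub_intCast]

lemma center_add {ρ r : ℝ} {P : ℤ} {Q : ℕ} (h : Q * ρ = P) (n : ℕ) :
    center ρ r (Q + n) = center ρ r Q + (rot ^ Q) (center ρ r n) := by
  unfold center
  rw [Finset.sum_range_add, map_sum]
  congr 1
  refine Finset.sum_congr rfl fun i _ => ?_
  rw [offset_add h, pow_add, LinearEquiv.mul_apply]

lemma add_rot_add_rot_rot (y : Coord) : y + rot y + rot (rot y) = 0 := by
  ext <;> simp <;> ring

lemma rot_pow_eq (n : ℕ) : rot ^ n = rot ^ (n % 3) := pow_eq_pow_mod n rot_pow_three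

/-- If the period `Q` of the rotation by `ρ` is not a multiple of three, there is no drift after
`3 Q` rounds. -/
lemma center_eq_zero {ρ r : ℝ} {P : ℤ} {Q : ℕ} (h : Q * ρ = P) (hQ : ¬ 3 ∣ Q) (m : ℕ) :
    center ρ r (3 * Q * m) = 0 := by
  have h3 : center ρ r (3 * Q) = 0 := by
    rw [show 3 * Q = Q + (Q + Q) by ring, center_add h, center_add h, map_add]
    have : Q % 3 = 1 ∨ Q % 3 = 2 := by omega
    rw [rot_pow_eq]
    rcases this with hq | hq <;> rw [hq]
    · rw [pow_one, ← add_assoc]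
      exact add_rot_add_rot_rot _
    · set y := center ρ r Q
      change y + (rot (rot y) + rot (rot (rot (rot y)))) = 0
      rw [rot_rot_rot, add_comm (rot (rot y)), ← add_assoc]
      exact add_rot_add_rot_rot _
  have h3' : ((3 * Q : ℕ) : ℝ) * ρ = ((3 * P : ℤ) : ℝ) := by
    push_cast
    rw [mul_assoc, h]
  induction m with
  | zero => simp [center]
  | succ m ih => rw [mul_add, mul_one, add_comm, center_add h3', h3, ih, map_zero, add_zero]

/-- The vectors `-2 v i`, in the cyclic order given by the rotation; `rotStep 0` belongs to `v 2`. -/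
noncomputable def rotStep (a : ZMod 3) : Coord := (rot ^ a.val) (0, 2)

lemma rotStep_natCast (n : ℕ) : rotStep n = (rot ^ n) (0, 2) := by
  rw [rotStep, ZMod.val_natCast, ← rot_pow_eq]

lemma rotStep_add (a b : ZMod 3) (hb : b ≠ 0) :
    rotStep a + rotStep (a - b) + rotStep (a - 2 * b) = 0 := by
  have h0 : rotStep 0 = (0, 2) := rfl
  have h1 : rotStep 1 = rot (0, 2) := rfl
  have h2 : rotStep 2 = rot (rot (0, 2)) := rfl
  have key := add_rot_add_rot_rot (0, 2)
  rw [← h2, ← h1, ← h0] at key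
  have key' : rotStep 0 + rotStep 2 + rotStep 1 = 0 := by rw [← key]; abel
  have key'' : rotStep 1 + rotStep 2 + rotStep 0 = 0 := by rw [← key]; abel
  have k3 : rotStep 2 + rotStep 1 + rotStep 0 = 0 := by rw [← key]; abel
  have k4 : rotStep 1 + rotStep 0 + rotStep 2 = 0 := by rw [← key]; abel
  have k5 : rotStep 2 + rotStep 0 + rotStep 1 = 0 := by rw [← key]; abel
  fin_cases a <;> fin_cases b <;> first | exact absurd rfl hb | assumption

lemma unitStep_rotStep (a : ZMod 3) : UnitStep (rotStep a) := by
  refine UnitStep.map ⟨⟨0, 1, by simp⟩, fun h => ?_, fun k => ?_⟩ (isSymm_rot_pow a.val)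
  · simpa using congrArg Prod.snd h
  · fin_cases k <;> simp

lemma sum_range_rotStep {P : ℕ} (a b : ZMod 3) (hb : b ≠ 0) (hP : ¬ 3 ∣ P) :
    UnitStep (∑ m ∈ Finset.range P, rotStep (a - m * b)) := by
  have h3 : ∀ k : ℕ, ∑ m ∈ Finset.range (3 * k), rotStep (a - m * b) = 0 := by
    intro k
    induction k with
    | zero => simp
    | succ k ih =>
      rw [mul_add, mul_one, Finset.sum_range_succ, Finset.sum_range_succ, Finset.sum_range_succ, ih,
        zero_add]
      convert rotStep_add (a - (3 * k : ℕ) * b) b hb using 3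
      · congr 1; push_cast; ring
      · push_cast; ring
  have : P = 3 * (P / 3) + 1 ∨ P = 3 * (P / 3) + 2 := by omega
  rcases this with h | h <;> rw [h]
  · rw [Finset.sum_range_succ, h3, zero_add]
    exact unitStep_rotStep _
  · have := h3 (P / 3 + 1)
    rw [mul_add, mul_one, Finset.sum_range_succ] at this
    rw [eq_neg_of_add_eq_zero_left this]
    exact (unitStep_rotStep _).neg

lemma sum_range_natCast_zmod {M : Type*} [AddCommMonoid M] (Q : ℕ) [NeZero Q] (F : ZMod Q → M) :
    ∑ n ∈ Finset.range Q, F n = ∑ x, F x :=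
  Finset.sum_bij' (fun n _ => (n : ZMod Q)) (fun x _ => x.val) (fun _ _ => Finset.mem_univ _)
    (fun x _ => Finset.mem_range.2 (ZMod.val_lt x))
    (fun _ hn => ZMod.val_cast_of_lt (Finset.mem_range.1 hn)) (fun x _ => ZMod.natCast_zmod_val x)
    fun _ _ => rfl

lemma offset_lt_iff {ρ r : ℝ} {P Q : ℕ} [NeZero Q] (h : Q * ρ = P) (n : ℕ) :
    offset ρ r n < ρ ↔ ((⌊Q * r⌋ : ZMod Q) - n * P).val < P := by
  have hQ : (0 : ℝ) < Q := by exact_mod_cast NeZero.pos Q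
  set j := ⌊Q * offset ρ r n⌋ with hj
  have h0 : 0 ≤ j := Int.floor_nonneg.2 (mul_nonneg hQ.le (Int.fract_nonneg _))
  have h1 : j < Q := by
    rw [hj, Int.floor_lt]
    exact_mod_cast mul_lt_of_lt_one_right hQ (Int.fract_lt_one (r - n * ρ))
  have e : j = ⌊Q * r⌋ - n * P - Q * ⌊r - n * ρ⌋ := by
    have : Q * offset ρ r n = Q * r - ((n * P + Q * ⌊r - n * ρ⌋ : ℤ) : ℝ) := by
      rw [offset, ← Int.self_sub_floor]
      push_cast
      rw [← h]
      ring
    rw [hj, this, Int.floor_sub_intCast]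
    ring
  have hv : ((((⌊Q * r⌋ : ZMod Q) - n * P).val : ℕ) : ℤ) = j := by
    have : (⌊Q * r⌋ : ZMod Q) - n * P = (j : ZMod Q) := by
      rw [e]
      push_cast
      simp
    rw [this, ZMod.val_intCast, Int.emod_eq_of_lt h0 h1]
  rw [← Nat.cast_lt (α := ℤ), hv, hj, Int.floor_lt]
  push_cast
  rw [← h, mul_lt_mul_iff_right₀ hQ]

/-- The set of the rounds, in a period, at which the jump is `(2, 0)` instead of `(2, -2)` is the
preimage of `P` consecutive residues under an affine bijection of `ZMod Q`, with slope `-P`. As the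
`n`-th jump is rotated by `n` thirds of a turn and `3 ∣ Q`, the sum of the jumps is a sum of `P`
consecutive terms of a periodic sequence of three vectors with sum zero. -/
lemma unitStep_center {ρ : ℝ} (r : ℝ) {P Q : ℕ} (hQ : 0 < Q) (h : Q * ρ = P) (hPQ : P.Coprime Q)
    (hle : P ≤ Q) (h3 : 3 ∣ Q) : UnitStep (center ρ r Q) := by
  have : NeZero Q := ⟨hQ.ne'⟩
  have hP3 : ¬ 3 ∣ P := fun h' => by
    have := Nat.dvd_gcd h' h3
    rw [hPQ.gcd_eq_one] at this
    omega
  set u := ZMod.unitOfCoprime P hPQ with hu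
  have hup : (u : ZMod Q) = P := ZMod.coe_unitOfCoprime P hPQ
  set φ := ZMod.castHom h3 (ZMod 3) with hφ
  set J : ZMod Q := (⌊Q * r⌋ : ZMod Q) with hJ
  set b : ZMod 3 := φ (u⁻¹ : (ZMod Q)ˣ) with hb
  have hb0 : b ≠ 0 := by
    rw [hb]
    exact (Units.map φ.toMonoidHom u⁻¹).ne_zero
  have hconst : ∀ k : ℕ, ∑ i ∈ Finset.range (3 * k), (rot ^ i) (2, -2) = (0 : Coord) := by
    intro k
    induction k with
    | zero => simp
    | succ k ih =>
      rw [mul_add, mul_one, Finset.sum_range_succ, Finset.sum_range_succ, Finset.sum_range_succ, ih,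
        zero_add, pow_add, pow_add, pow_mul, rot_pow_three, one_pow]
      exact add_rot_add_rot_rot _
  have hjump : ∀ i : ℕ, (rot ^ i) (jump ρ (offset ρ r i)) = (rot ^ i) (2, -2) +
      if (J - (i : ZMod Q) * P).val < P then rotStep (φ i) else 0 := by
    intro i
    have := offset_lt_iff (r := r) h i
    rw [map_natCast, rotStep_natCast]
    unfold jump
    by_cases hi : offset ρ r i < ρ
    · rw [if_pos hi, if_pos (this.1 hi), ← map_add]
      congr 1
      ext <;> simp
    · rw [if_neg hi, if_neg (mt this.2 hi), add_zero]
  have hsum : center ρ r Q = ∑ m ∈ Finset.range P, rotStep (φ J * b - m * b) := by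
    unfold center
    rw [Finset.sum_congr rfl fun i _ => hjump i, Finset.sum_add_distrib]
    obtain ⟨k, hk⟩ := h3
    rw [show ∑ i ∈ Finset.range Q, (rot ^ i) (2, -2) = (0 : Coord) by rw [hk]; exact hconst k,
      zero_add, sum_range_natCast_zmod Q fun x => if (J - x * P).val < P then rotStep (φ x) else 0]
    have hbij : Function.Bijective fun y : ZMod Q => (J - y) * (u⁻¹ : (ZMod Q)ˣ) := by
      rw [← Finite.injective_iff_bijective]
      intro x y hxy
      simpa using hxy
    have hval : ∀ y : ZMod Q,
        (if (J - (J - y) * (u⁻¹ : (ZMod Q)ˣ) * P).val < P then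
          rotStep (φ ((J - y) * (u⁻¹ : (ZMod Q)ˣ))) else 0) =
        if y.val < P then rotStep (φ J * b - φ y * b) else 0 := by
      intro y
      rw [mul_assoc, ← hup, Units.inv_mul, mul_one, sub_sub_cancel, map_mul, map_sub, sub_mul]
    rw [← hbij.sum_comp, Fintype.sum_congr _ _ hval,
      ← sum_range_natCast_zmod Q fun y => if y.val < P then rotStep (φ J * b - φ y * b) else 0]
    refine (Finset.sum_subset_zero_on_sdiff (Finset.range_subset_range.2 hle) ?_ ?_).symm
    · intro m hm
      simp only [Finset.mem_sdiff, Finset.mem_range] at hm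
      rw [ZMod.val_cast_of_lt hm.1, if_neg hm.2]
    · intro m hm
      rw [Finset.mem_range] at hm
      rw [ZMod.val_cast_of_lt (hm.trans_le hle), if_pos hm, map_natCast]
  rw [hsum]
  exact sum_range_rotStep _ _ hb0 hP3

/-! ### Drift-periodic orbits through a radius -/

lemma move_injective (A : Coord ≃ₗ[ℝ] Coord) (c : Coord) : Function.Injective (move A c) := by
  intro z z' h
  have h1 := congrArg Prod.fst h
  have h2 := congrArg Prod.snd h
  exact Prod.ext (A.injective (add_right_cancel h1)) (A.injective h2)

lemma IsSymm.exists_isOrbit_move {s : ℤˣ} {A : Coord ≃ₗ[ℝ] Coord} (hA : IsSymm s A) {c : Coord}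
    (hc : EvenPt c) {γ : ℝ → Coord × Coord} (hγ : IsOrbit γ) :
    ∃ γ', IsOrbit γ' ∧ ∀ t, γ t = move A c (γ' t) := by
  refine ⟨_, hA.inv.isOrbit (c := A⁻¹ (-c)) (hA.inv.evenPt.2 hc.neg) hγ, fun t => ?_⟩
  ext <;> simp [move]

lemma IsOrbit.regular {γ : ℝ → Coord × Coord} (hγ : IsOrbit γ) (t : ℝ) : Regular (γ t).1 :=
  (hγ t t).regular t ⟨le_rfl, le_rfl⟩

lemma IsOrbit.regular_of_segment_smul {γ : ℝ → Coord × Coord} (hγ : IsOrbit γ) {x w : Coord}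
    {t d τ : ℝ} (hd : 0 < d) (hτ : 0 < τ) (hz : γ t = (x, d • w))
    (h : ∀ s ∈ Ioo 0 τ, ∀ k, ¬ OnWall k (x + s • w)) : Regular (x + τ • w) := by
  have := hγ.fst_eq_of_segment (T := τ / d) hz (div_pos hτ hd) fun t ht k => by
    rw [smul_smul]
    exact h _ ⟨mul_pos ht.1 hd, (lt_div_iff₀ hd).1 ht.2⟩ k
  rw [smul_smul, div_mul_cancel₀ _ hd.ne'] at this
  rw [← this]
  exact hγ.regular _

lemma coneVec_ne_zero {d : ℝ} (hd : 0 < d) (ρ : ℝ) : coneVec d ρ ≠ 0 := by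
  intro h
  have h1 : d * (1 - ρ) = 0 := congrArg Prod.fst h
  have h2 : d * ρ = 0 := congrArg Prod.snd h
  nlinarith

lemma exists_eq_coneVec {v : Coord} (hv : v ≠ 0) (h1 : 0 ≤ v.1) (h2 : 0 ≤ v.2) :
    ∃ d ρ, 0 < d ∧ ρ ∈ Icc (0 : ℝ) 1 ∧ v = coneVec d ρ := by
  have hd : 0 < v.1 + v.2 := by
    refine (add_nonneg h1 h2).lt_of_ne fun h => hv ?_
    ext <;> simp <;> linarith
  refine ⟨v.1 + v.2, v.2 / (v.1 + v.2), hd, ⟨div_nonneg h2 hd.le, (div_le_one hd).2 (by linarith)⟩,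
    ?_⟩
  ext <;> simp [coneVec] <;> field_simp
  ring

lemma not_regular_of_two {x : Coord} {j k : Fin 3} (hjk : j ≠ k) (hj : OnWall j x)
    (hk : OnWall k x) : ¬ Regular x := fun h => hjk (h j k hj hk)

/-- If the radius is crossed at the distance `ρ` from the center, the ray ends in a vertex. -/
lemma IsOrbit.offset_ne {γ : ℝ → Coord × Coord} (hγ : IsOrbit γ) {d ρ r t : ℝ} {n : ℕ}
    (hd : 0 < d) (h0 : offset ρ r n ≠ 0) (h : γ t = crossingAt d ρ r n) : offset ρ r n ≠ ρ := by
  intro hoff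
  obtain ⟨γ', hγ', hmove⟩ := (isSymm_rot_pow n).exists_isOrbit_move (evenPt_center ρ r n) hγ
  have hρ0 : 0 < ρ := by
    rw [← hoff]
    exact (Int.fract_nonneg _).lt_of_ne h0.symm
  have hρ1 : ρ < 1 := by
    rw [← hoff]
    exact Int.fract_lt_one _
  have hz : γ' t = ((ρ, -ρ), d • (1 - ρ, ρ)) := by
    refine move_injective (rot ^ n) (center ρ r n) ?_
    rw [← hmove, h, crossingAt, hoff]
    rfl
  have := hγ'.regular_of_segment_smul hd one_pos hz fun s hs => by
    have e : ((ρ, -ρ) : Coord) + s • ((1 - ρ, ρ) : Coord) = (ρ + s * (1 - ρ), -ρ + s * ρ) := by simp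
    have h1 : 0 < s * (1 - ρ) := mul_pos hs.1 (by linarith)
    have h2 : s * (1 - ρ) < 1 - ρ := mul_lt_of_lt_one_left (by linarith) hs.2
    have h3 : 0 < s * ρ := mul_pos hs.1 hρ0
    have h4 : s * ρ < ρ := mul_lt_of_lt_one_left hρ0 hs.2
    rw [e]
    exact not_onWall_of_mem_hex (mem_hex (by linarith) (by linarith) (by linarith) (by linarith)
      (by linarith [hs.1]) (by linarith [hs.2]))
  refine not_regular_of_two (j := 1) (k := 2) (by decide) ⟨-1, ?_⟩ ⟨0, ?_⟩ this
  · simp; norm_num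
  · simp

lemma rot_pow_apply_eq_self {u : Coord} (hu : u ≠ 0) {n : ℕ} (h : (rot ^ n) u = u) : 3 ∣ n := by
  have key : rot u ≠ u := by
    intro h
    have h1 : u.2 = u.1 := congrArg Prod.fst h
    have h2 : -u.1 - u.2 = u.2 := congrArg Prod.snd h
    exact hu (Prod.ext (by simp; linarith) (by simp; linarith))
  have : n % 3 = 0 ∨ n % 3 = 1 ∨ n % 3 = 2 := by omega
  rw [rot_pow_eq] at h
  rcases this with hn | hn | hn
  · omega
  · rw [hn, pow_one] at h
    exact absurd h key
  · rw [hn] at h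
    have h' : rot (rot u) = u := h
    have h'' := congrArg rot h'
    rw [rot_rot_rot] at h''
    exact absurd h''.symm key

lemma rot_pow_eq_one {n : ℕ} (h : 3 ∣ n) : rot ^ n = 1 := by
  obtain ⟨k, rfl⟩ := h
  rw [pow_mul, rot_pow_three, one_pow]

lemma offset_succ_ne_zero {ρ r : ℝ} {n : ℕ} (hρ : ρ ∈ Icc (0 : ℝ) 1) (h0 : offset ρ r n ≠ 0)
    (h : offset ρ r n ≠ ρ) : offset ρ r (n + 1) ≠ 0 := by
  have hpos : 0 < offset ρ r n := (Int.fract_nonneg _ : 0 ≤ offset ρ r n).lt_of_ne h0.symm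
  rw [← nextOffset_offset hρ, nextOffset]
  split_ifs
  · linarith [hρ.2]
  · exact sub_ne_zero.2 h

/-- An orbit that crosses a radius continues with a round. -/
lemma IsOrbit.exists_next {γ : ℝ → Coord × Coord} (hγ : IsOrbit γ) {d ρ r t : ℝ} {n : ℕ}
    (hd : 0 < d) (hρ : ρ ∈ Icc (0 : ℝ) 1) (h0 : offset ρ r n ≠ 0)
    (h : γ t = crossingAt d ρ r n) :
    ∃ T, 1 / d ≤ T ∧ offset ρ r (n + 1) ≠ 0 ∧ γ (t + T) = crossingAt d ρ r (n + 1) ∧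
      ∀ s ∈ Ioo 0 T, Between (coneVec d ρ) (γ (t + s)) := by
  have hne := hγ.offset_ne hd h0 h
  obtain ⟨T, hT, hc⟩ := exists_round_at hd hρ h0 hne
  have := hγ.connects ((one_div_pos.2 hd).le.trans hT) hc h
  exact ⟨T, hT, offset_succ_ne_zero hρ h0 hne, this.1, this.2⟩

/-- A state of the orbit that is not between two crossings of radii is a crossing of a radius. -/
lemma IsOrbit.exists_eq_crossingAt {γ : ℝ → Coord × Coord} (hγ : IsOrbit γ) {d ρ r τ : ℝ}
    (hd : 0 < d) (hρ : ρ ∈ Icc (0 : ℝ) 1) (hτ : ¬ Between (coneVec d ρ) (γ τ)) (N n : ℕ) (t : ℝ)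
    (h0 : offset ρ r n ≠ 0) (h : γ t = crossingAt d ρ r n) (ht : t ≤ τ)
    (hN : τ - t < N * (1 / d)) :
    ∃ m, n ≤ m ∧ γ τ = crossingAt d ρ r m ∧ (m = n → τ = t) := by
  induction N generalizing n t with
  | zero => simp at hN; linarith
  | succ N ih =>
    rcases ht.eq_or_lt with rfl | hlt
    · exact ⟨n, le_rfl, h, fun _ => rfl⟩
    obtain ⟨T, hT, h0', h', hb⟩ := hγ.exists_next hd hρ h0 h
    rcases lt_or_ge τ (t + T) with hlt' | hge
    · refine absurd ?_ hτ
      have := hb (τ - t) ⟨by linarith, by linarith⟩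
      rwa [add_sub_cancel] at this
    · push_cast at hN
      obtain ⟨m, hm, hγm, -⟩ := ih (n + 1) (t + T) h0' h' hge (by linarith)
      exact ⟨m, by omega, hγm, fun e => by omega⟩

lemma crossingAt_of_dvd {d ρ r : ℝ} {n : ℕ} (hn : 3 ∣ n) :
    crossingAt d ρ r n = shift (center ρ r n) (crossing d ρ (offset ρ r n)) := by
  rw [crossingAt, rot_pow_eq_one hn]
  rfl

lemma offset_zero {ρ r : ℝ} (hr : r ∈ Ioo (0 : ℝ) 1) : offset ρ r 0 = r := by
  rw [offset, Int.fract_eq_self.2] <;> simp [hr.1.le, hr.2]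

lemma IsOrbit.exists_unitStep_of_crossing {γ : ℝ → Coord × Coord} (hγ : IsOrbit γ)
    {d ρ r t₀ T : ℝ} (hd : 0 < d) (hρ : ρ ∈ Icc (0 : ℝ) 1) (hr : r ∈ Ioo (0 : ℝ) 1)
    (h : γ t₀ = crossing d ρ r) {w : Coord} (hw : EvenPt w) (hw0 : w ≠ 0) (hT : 0 < T)
    (hdrift : γ (t₀ + T) = shift w (γ t₀)) :
    ∃ e, UnitStep e ∧ ∃ t, γ t = shift e (γ t₀) := by
  have hu := coneVec_ne_zero hd ρ
  have hoff0 := offset_zero (ρ := ρ) hr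
  have hstart : γ t₀ = crossingAt d ρ r 0 := by
    rw [h, crossingAt_of_dvd (dvd_zero 3), hoff0]
    ext <;> simp [shift, center]
  have h00 : offset ρ r 0 ≠ 0 := by rw [hoff0]; exact hr.1.ne'
  rw [h] at hdrift
  -- after the drift the orbit crosses a radius again
  have hnot : ¬ Between (coneVec d ρ) (γ (t₀ + T)) := by
    rw [hdrift]
    intro hb
    have e : (shift w (crossing d ρ r)).1 - w = (r, -r) := by simp [shift, crossing]
    obtain ⟨n, hn1, -, hn3⟩ := hb w hw (by rw [e]; exact mem_hex_radius hr.1.le hr.2)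
    rw [e, rot_pow_eq_one (rot_pow_apply_eq_self hu hn1.symm)] at hn3
    apply hn3
    change -(r + -r) = 0
    ring
  obtain ⟨N, hN⟩ := exists_nat_gt (T * d)
  obtain ⟨m, -, hm, hm0⟩ := hγ.exists_eq_crossingAt hd hρ hnot N 0 t₀ h00 hstart (by linarith)
    (by rw [mul_one_div, lt_div_iff₀ hd]; linarith)
  have hmpos : 0 < m := by
    rcases Nat.eq_zero_or_pos m with h | h
    · linarith [hm0 h]
    · exact h
  rw [hdrift] at hm
  have h3 : 3 ∣ m := rot_pow_apply_eq_self hu (congrArg Prod.snd hm).symm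
  rw [crossingAt_of_dvd h3] at hm
  -- the offset and the center are determined by the position
  have hpos := congrArg Prod.fst hm
  obtain ⟨hoff, hcenter⟩ : offset ρ r m = r ∧ center ρ r m = w := by
    have hc := evenPt_center ρ r m
    have e1 : ((r, -r) : Coord) + w - center ρ r m = (offset ρ r m, -offset ρ r m) := by
      rw [sub_eq_iff_eq_add]; exact hpos
    have e2 : ((r, -r) : Coord) + w - w = (r, -r) := add_sub_cancel_right _ _
    have := eq_of_mem_hex hc hw (x := ((r, -r) : Coord) + w)
      (by rw [e1]; exact mem_hex_radius (Int.fract_nonneg _) (Int.fract_lt_one _))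
      (by rw [e2]; exact mem_hex_radius hr.1.le hr.2)
    rw [this] at e1
    exact ⟨congrArg Prod.fst (e1.symm.trans e2), this⟩
  -- the rotation number is rational
  obtain ⟨P₀, hP₀⟩ : ∃ P₀ : ℕ, m * ρ = P₀ := by
    have := Int.self_sub_floor (r - m * ρ)
    have hf : r - m * ρ - ⌊r - m * ρ⌋ = r := this.trans hoff
    have hf' : m * ρ = ((-⌊r - m * ρ⌋ : ℤ) : ℝ) := by push_cast; linarith
    have hnn : 0 ≤ -⌊r - m * ρ⌋ := by
      have : (0 : ℝ) ≤ ((-⌊r - m * ρ⌋ : ℤ) : ℝ) := by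
        rw [← hf']
        exact mul_nonneg (Nat.cast_nonneg _) hρ.1
      exact_mod_cast this
    obtain ⟨P₀, hP₀⟩ := Int.eq_ofNat_of_zero_le hnn
    exact ⟨P₀, by rw [hf', hP₀]; simp⟩
  obtain ⟨g, P, Q, hg, hcop, hP, hQ⟩ := Nat.exists_coprime' (m := P₀) (n := m)
    (Nat.gcd_pos_of_pos_right _ hmpos)
  have hQpos : 0 < Q := Nat.pos_of_ne_zero fun h => by rw [h] at hQ; omega
  have hQρ : Q * ρ = P := by
    have hg' : (g : ℝ) ≠ 0 := by exact_mod_cast hg.ne'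
    rw [hP, hQ] at hP₀
    push_cast at hP₀
    exact mul_right_cancel₀ hg' (by linarith)
  have hPQ : P ≤ Q := by
    have : (P : ℝ) ≤ Q := by
      rw [← hQρ]
      exact mul_le_of_le_one_right (Nat.cast_nonneg _) hρ.2
    exact_mod_cast this
  by_cases h3Q : 3 ∣ Q
  · have hex : ∀ n, offset ρ r n ≠ 0 ∧ ∃ t, γ t = crossingAt d ρ r n := by
      intro n
      induction n with
      | zero => exact ⟨h00, t₀, hstart⟩
      | succ n ih =>
        obtain ⟨h0, t, ht⟩ := ih
        obtain ⟨T, -, h0', hT', -⟩ := hγ.exists_next hd hρ h0 ht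
        exact ⟨h0', t + T, hT'⟩
    obtain ⟨-, t, ht⟩ := hex Q
    refine ⟨center ρ r Q, unitStep_center r hQpos hQρ hcop hPQ h3Q, t, ?_⟩
    rw [ht, h, crossingAt_of_dvd h3Q]
    have := offset_add (r := r) (P := P) (Q := Q) (by exact_mod_cast hQρ) 0
    rw [add_zero, hoff0] at this
    rw [this]
  · exfalso
    have h3g : 3 ∣ g := by
      rw [hQ] at h3
      exact ((Nat.Prime.dvd_mul Nat.prime_three).1 h3).resolve_left h3Q
    obtain ⟨k, rfl⟩ := h3g
    apply hw0
    rw [← hcenter, hQ, show Q * (3 * k) = 3 * Q * k by ring]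
    exact center_eq_zero (P := P) (by exact_mod_cast hQρ) h3Q k

/-! ### Every orbit crosses a radius -/

lemma IsOrbit.departs {γ : ℝ → Coord × Coord} (hγ : IsOrbit γ) (t : ℝ) : Departs γ t :=
  (hγ t (t + 1)).departs t ⟨le_rfl, by linarith⟩

lemma IsOrbit.arrives {γ : ℝ → Coord × Coord} (hγ : IsOrbit γ) (t : ℝ) : Arrives γ t :=
  (hγ (t - 1) t).arrives t ⟨by linarith, le_rfl⟩

/-- An orbit meets an edge: otherwise it would be a straight line, but the heights are unbounded on
every line. -/
lemma IsOrbit.exists_onWall {γ : ℝ → Coord × Coord} (hγ : IsOrbit γ) (h0 : (γ 0).2 ≠ 0) :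
    ∃ t k, OnWall k (γ t).1 := by
  by_contra! hno
  set F : ℝ → Coord × Coord := fun t => ((γ t).1 - t • (γ t).2, (γ t).2) with hF
  have hline : ∀ {s t : ℝ} {u : Coord}, u = (γ t).2 → γ s = ((γ t).1 + (s - t) • u, u) →
      F s = F t := by
    intro s t u hu h
    subst hu
    simp only [hF, h, sub_smul]
    congr 1
    abel
  have hloc : IsLocallyConstant F := by
    rw [IsLocallyConstant.iff_eventually_eq]
    intro t
    rw [← nhdsNE_sup_pure, ← nhdsLT_sup_nhdsGT, eventually_sup, eventually_sup]
    refine ⟨⟨?_, (hγ.departs t).mono fun s hs => hline rfl hs⟩, by simp⟩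
    obtain ⟨u, hu, hev⟩ := hγ.arrives t
    exact hev.mono fun s hs => hline (hu.1 (hno t)).symm hs
  have hconst : ∀ t, γ t = ((γ 0).1 + t • (γ 0).2, (γ 0).2) := by
    intro t
    have h := hloc.apply_eq_of_isPreconnected isPreconnected_univ (mem_univ t) (mem_univ 0)
    have h2 : (γ t).2 = (γ 0).2 := (Prod.mk.inj h).2
    have h1 : (γ t).1 - t • (γ t).2 = (γ 0).1 - (0 : ℝ) • (γ 0).2 := (Prod.mk.inj h).1
    rw [h2, zero_smul, sub_zero, sub_eq_iff_eq_add] at h1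
    exact Prod.ext h1 h2
  obtain ⟨k, hk⟩ : ∃ k, height k (γ 0).2 ≠ 0 := by
    by_contra! hall
    exact h0 (Prod.ext (hall 2) (hall 0))
  refine hno ((1 - height k (γ 0).1) / height k (γ 0).2) k ⟨0, ?_⟩
  rw [hconst]
  simp only [map_add, map_smul, smul_eq_mul]
  rw [div_mul_cancel₀ _ hk]
  push_cast
  ring

/-- An orbit crosses the edges: it cannot run along an edge, because its direction would have to be
reversed at all times. -/
lemma IsOrbit.exists_mem_hex_of_edge {γ : ℝ → Coord × Coord} (hγ : IsOrbit γ) {t s : ℝ} {u : Coord}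
    (hs : s ∈ Ioo (0 : ℝ) 1) (hu : u ≠ 0) (h : γ t = ((1, -s), u)) :
    ∃ t', (γ t').1 ∈ Hex ∧ (γ t').2 ≠ 0 := by
  have hwall : ∀ q : ℝ, OnWall 2 ((1, q) : Coord) := fun q => ⟨0, by simp⟩
  -- near the edge, the point is in the hexagon as soon as `p < 1`
  have hnear : ∀ w : Coord, ∀ l ≤ 𝓝 t, (∀ᶠ x in l, (x - t) * w.1 < 0) →
      ∀ᶠ x in l, ((1, -s) : Coord) + (x - t) • w ∈ Hex := by
    intro w l hl hneg
    have hlim := tendsto_line (1, -s) w t l hl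
    have hopen : IsOpen {y : Coord | -1 < y.1 ∧ -1 < y.2 ∧ y.2 < 1 ∧ -1 < y.1 + y.2 ∧
        y.1 + y.2 < 1} := by
      simp only [Set.ofPred_and]
      refine IsOpen.inter ?_ (IsOpen.inter ?_ (IsOpen.inter ?_ (IsOpen.inter ?_ ?_))) <;>
        exact isOpen_lt (by fun_prop) (by fun_prop)
    have hmem : ((1, -s) : Coord) ∈ {y : Coord | -1 < y.1 ∧ -1 < y.2 ∧ y.2 < 1 ∧ -1 < y.1 + y.2 ∧
        y.1 + y.2 < 1} := by
      obtain ⟨h1, h2⟩ := hs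
      refine ⟨?_, ?_, ?_, ?_, ?_⟩ <;> simp <;> linarith
    filter_upwards [hlim.eventually (hopen.mem_nhds hmem), hneg] with x hx hx'
    exact mem_hex hx.1 (by simpa using hx') hx.2.1 hx.2.2.1 hx.2.2.2.1 hx.2.2.2.2
  have hdep := hγ.departs t
  rw [Departs, h] at hdep
  rcases lt_trichotomy u.1 0 with h1 | h1 | h1
  · have := hnear u (𝓝[>] t) nhdsWithin_le_nhds (by
      filter_upwards [self_mem_nhdsWithin] with x hx
      exact mul_neg_of_pos_of_neg (sub_pos.2 hx) h1)
    obtain ⟨x, hx, hx'⟩ := (this.and hdep).exists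
    exact ⟨x, by rw [hx']; exact hx, by rw [hx']; exact hu⟩
  · exfalso
    obtain ⟨b, hb, hb'⟩ := mem_nhdsGT_iff_exists_Ioo_subset.1 hdep
    obtain ⟨x, hx⟩ := exists_between (mem_Ioi.1 hb)
    have hγx : γ x = ((1, -s) + (x - t) • u, u) := hb' hx
    obtain ⟨u', hu', hev⟩ := hγ.arrives x
    obtain ⟨y, hy, hy'⟩ := (hev.and (Ioo_mem_nhdsLT hx.1)).exists
    have hγy : γ y = ((1, -s) + (y - t) • u, u) := hb' ⟨hy'.1, hy'.2.trans hx.2⟩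
    have e1 : u = u' := congrArg Prod.snd (hγy.symm.trans hy)
    have e2 := hu'.2 2 (by
      rw [hγx]
      have : ((1, -s) : Coord) + (x - t) • u = (1, -s + (x - t) * u.2) := by
        ext <;> simp [h1]
      rw [this]
      exact hwall _)
    rw [← e1, hγx] at e2
    have e3 : u.2 = -u.1 - u.2 := congrArg Prod.snd e2
    exact hu (Prod.ext h1 (by simp; linarith))
  · obtain ⟨u', hu', hev⟩ := hγ.arrives t
    rw [h] at hu' hev
    have e : u = mirror 2 u' := hu'.2 2 (hwall _)
    have e1 : u.1 = u'.1 := (congrArg Prod.fst e : u.1 = (mirror 2 u').1)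
    have := hnear u' (𝓝[<] t) nhdsWithin_le_nhds (by
      filter_upwards [self_mem_nhdsWithin] with x hx
      exact mul_neg_of_neg_of_pos (sub_neg.2 hx) (e1 ▸ h1))
    obtain ⟨x, hx, hx'⟩ := (this.and hev).exists
    refine ⟨x, by rw [hx']; exact hx, ?_⟩
    rw [hx']
    rintro rfl
    simp [e1] at h1

/-- A point on a line of edges of direction `v 2` that is not a vertex is moved, by a translation and
possibly a point reflection, onto the edge from `(1, 0)` to `(1, -1)` of the hexagon around `0`. -/
lemma exists_isSymm_edge {x : Coord} (hx : Regular x) (h2 : OnWall 2 x) :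
    ∃ A c s, IsSymm 1 A ∧ (A = 1 ∨ A = LinearEquiv.neg ℝ) ∧ EvenPt c ∧ s ∈ Ioo (0 : ℝ) 1 ∧
      x = A (1, -s) + c := by
  obtain ⟨m, hm⟩ := h2
  have h2 : OnWall 2 x := ⟨m, hm⟩
  have h0 : ¬ OnWall 0 x := fun h => absurd (hx 0 2 h h2) (by decide)
  have h1 : ¬ OnWall 1 x := fun h => absurd (hx 1 2 h h2) (by decide)
  rw [height_two] at hm
  set n := ⌊(x.2 + 1) / 2⌋ with hn
  have hle := Int.floor_le ((x.2 + 1) / 2)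
  have hlt := Int.lt_floor_add_one ((x.2 + 1) / 2)
  rw [← hn] at hle hlt
  have hle' : 2 * (n : ℝ) - 1 < x.2 := by
    refine lt_of_le_of_ne (by linarith) fun h => h0 ⟨n - 1, ?_⟩
    simp only [height_zero]
    push_cast
    linarith
  have hne : x.2 ≠ 2 * n := fun h => h1 ⟨-m - n - 1, by
    simp only [height_one, hm, h]
    push_cast
    ring⟩
  rcases lt_or_gt_of_ne hne with h | h
  · refine ⟨1, (2 * m, 2 * n), 2 * n - x.2, isSymm_one, Or.inl rfl, ⟨m, n, rfl⟩,
      ⟨by linarith, by linarith⟩, ?_⟩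
    ext <;> simp <;> linarith
  · refine ⟨LinearEquiv.neg ℝ, (2 * (m + 1), 2 * n), x.2 - 2 * n, isSymm_neg, Or.inr rfl,
      ⟨m + 1, n, by push_cast; rfl⟩, ⟨by linarith, by linarith⟩, ?_⟩
    ext <;> simp <;> linarith

lemma exists_onWall_two {x : Coord} {k : Fin 3} (h : OnWall k x) :
    ∃ (n : ℕ) (y : Coord), x = (rot ^ n) y ∧ OnWall 2 y := by
  fin_cases k
  · refine ⟨2, rot x, (rot_rot_rot x).symm, ?_⟩
    exact h
  · refine ⟨1, rot (rot x), (rot_rot_rot x).symm, ?_⟩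
    change OddInt (-x.1 - x.2)
    rw [← neg_add']
    exact h
  · exact ⟨0, x, rfl, h⟩

lemma IsOrbit.exists_mem_hex {γ : ℝ → Coord × Coord} (hγ : IsOrbit γ) (h0 : ∀ t, (γ t).2 ≠ 0) :
    ∃ t c, EvenPt c ∧ (γ t).1 - c ∈ Hex := by
  obtain ⟨t, k, hk⟩ := hγ.exists_onWall (h0 0)
  obtain ⟨n, y, hy, hy2⟩ := exists_onWall_two hk
  obtain ⟨γ₁, hγ₁, hmove₁⟩ := (isSymm_rot_pow n).exists_isOrbit_move evenPt_zero hγ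
  have e₁ : (γ₁ t).1 = y := by
    have := hmove₁ t
    apply (rot ^ n).injective
    rw [← hy, this]
    simp [move]
  obtain ⟨A, c, s, hA, -, hc, hs, hyA⟩ := exists_isSymm_edge (e₁ ▸ hγ₁.regular t) hy2
  obtain ⟨γ₂, hγ₂, hmove₂⟩ := hA.exists_isOrbit_move hc hγ₁
  have e₂ : (γ₂ t).1 = (1, -s) := by
    have := congrArg Prod.fst (hmove₂ t)
    rw [e₁, hyA] at this
    exact (A.injective (add_right_cancel this)).symm
  have hu : (γ₂ t).2 ≠ 0 := fun h => h0 t (by rw [hmove₁, move, hmove₂, move, h]; simp)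
  obtain ⟨t', ht', -⟩ := hγ₂.exists_mem_hex_of_edge hs hu (Prod.ext e₂ rfl)
  refine ⟨t', (rot ^ n) c, (isSymm_rot_pow n).evenPt.2 hc, ?_⟩
  have : (γ t').1 - (rot ^ n) c = (rot ^ n) (A (γ₂ t').1) := by
    rw [hmove₁, move, hmove₂, move]
    simp
  rw [this]
  exact (isSymm_rot_pow n).mem_hex.2 (hA.mem_hex.2 ht')

/-- An orbit does not pass through the center of a hexagon: after the next triangle it would end in
a vertex. -/
lemma IsOrbit.not_through_center {γ : ℝ → Coord × Coord} (hγ : IsOrbit γ) {t d ρ σ : ℝ}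
    (hd : 0 < d) (hρ : ρ ∈ Icc (0 : ℝ) 1) (hσ : σ • ((1 - ρ, ρ) : Coord) ∈ Hex)
    (h : γ t = (σ • (1 - ρ, ρ), coneVec d ρ)) : False := by
  obtain ⟨hσ1, hσ2⟩ : -1 < σ ∧ σ < 1 := by
    have := hσ 1
    rw [map_smul, smul_eq_mul, height_one, abs_lt] at this
    simp at this
    constructor <;> linarith
  have hhex : ∀ s ∈ Ioo 0 (1 - σ), σ • ((1 - ρ, ρ) : Coord) + s • ((1 - ρ, ρ) : Coord) ∈ Hex := by
    intro s hs
    rw [← add_smul]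
    obtain ⟨h1, h2⟩ : -1 < σ + s ∧ σ + s < 1 := ⟨by linarith [hs.1], by linarith [hs.2]⟩
    have e : (σ + s) • ((1 - ρ, ρ) : Coord) = ((σ + s) * (1 - ρ), (σ + s) * ρ) := by simp
    have h3 : |σ + s| < 1 := abs_lt.2 ⟨h1, h2⟩
    have h4 : ∀ y, 0 ≤ y → y ≤ 1 → -1 < (σ + s) * y ∧ (σ + s) * y < 1 := by
      intro y hy hy'
      rw [← abs_lt, abs_mul, abs_of_nonneg hy]
      exact (mul_le_of_le_one_right (abs_nonneg _) hy').trans_lt h3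
    obtain ⟨h5, h6⟩ := h4 (1 - ρ) (by linarith [hρ.2]) (by linarith [hρ.1])
    obtain ⟨h7, h8⟩ := h4 ρ hρ.1 hρ.2
    rw [e]
    exact mem_hex h5 h6 h7 h8 (by linarith) (by linarith)
  have hend : σ • ((1 - ρ, ρ) : Coord) + (1 - σ) • ((1 - ρ, ρ) : Coord) = (1 - ρ, ρ) := by
    rw [← add_smul, add_sub_cancel, one_smul]
  have hwall : OnWall 1 ((1 - ρ, ρ) : Coord) := ⟨-1, by simp; norm_num⟩
  have hreg := hγ.regular_of_segment_smul hd (sub_pos.2 hσ2) h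
    fun s hs => not_onWall_of_mem_hex (hhex s hs)
  rw [hend] at hreg
  have hρ0 : 0 < ρ := hρ.1.lt_of_ne fun e =>
    not_regular_of_two (j := 1) (k := 2) (by decide) hwall ⟨0, by simp [← e]⟩ hreg
  have hρ1 : ρ < 1 := hρ.2.lt_of_ne fun e =>
    not_regular_of_two (j := 1) (k := 0) (by decide) hwall ⟨0, by simp [e]⟩ hreg
  have hm : mirror 1 (1 - ρ, ρ) = (ρ, 1 - ρ) := by ext <;> simp
  have hc : Connects (fun _ => True) (σ • ((1 - ρ, ρ) : Coord), d • ((1 - ρ, ρ) : Coord))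
      ((1 - ρ, ρ), d • (ρ, 1 - ρ)) ((1 - σ) / d) := by
    refine connects_segment_smul hd (sub_pos.2 hσ2) hend
      (regular_of_not_onWall (not_onWall_of_mem_hex hσ)) hreg
      (fun s hs => not_onWall_of_mem_hex (hhex s hs)) ?_ fun _ _ => trivial
    rw [← hm, ← map_smul]
    exact hreg.refracts_mirror hwall
  have hz := (hγ.connects (div_pos (sub_pos.2 hσ2) hd).le hc h).1
  have hreg' := hγ.regular_of_segment_smul hd one_pos hz fun s hs => by
    have h1 : 0 < s * ρ := mul_pos hs.1 hρ0
    have h2 : s * ρ < ρ := mul_lt_of_lt_one_left hρ0 hs.2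
    have h3 : 0 < s * (1 - ρ) := mul_pos hs.1 (by linarith)
    have h4 : s * (1 - ρ) < 1 - ρ := mul_lt_of_lt_one_left (by linarith) hs.2
    have e : ((1 - ρ, ρ) : Coord) + s • ((ρ, 1 - ρ) : Coord) =
        (1 - ρ + s * ρ, ρ + s * (1 - ρ)) := by simp
    have := hs.1
    have := hs.2
    rw [e]
    refine not_onWall 0 0 1 ?_ ?_ ?_ <;> constructor <;> push_cast <;> linarith
  exact not_regular_of_two (j := 0) (k := 2) (by decide) ⟨0, by simp⟩ ⟨0, by simp⟩ hreg'

/-- Up to a symmetry of the tiling, every orbit through a hexagon crosses a radius. -/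
lemma IsOrbit.exists_crossing {γ : ℝ → Coord × Coord} (hγ : IsOrbit γ) {t : ℝ} {c : Coord}
    (hc : EvenPt c) (hx : (γ t).1 - c ∈ Hex) (hu : (γ t).2 ≠ 0) :
    ∃ s A γ' t' d ρ r, IsSymm s A ∧ IsOrbit γ' ∧ (∀ t, γ t = move A c (γ' t)) ∧ 0 < d ∧
      ρ ∈ Icc (0 : ℝ) 1 ∧ r ∈ Ioo (0 : ℝ) 1 ∧ γ' t' = crossing d ρ r := by
  -- a symmetry that moves the direction into the cone and the center to the left of the ray
  obtain ⟨s, hs⟩ : ∃ s : ℤˣ, 0 ≤ ((s : ℤ) : ℝ) * det ((γ t).1 - c) (γ t).2 := by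
    rcases le_total 0 (det ((γ t).1 - c) (γ t).2) with h | h
    · exact ⟨1, by simpa using h⟩
    · exact ⟨-1, by simpa using h⟩
  obtain ⟨B, hB, h1, h2⟩ := exists_isSymm_nonneg s (γ t).2
  obtain ⟨γ', hγ', hmove⟩ := hB.inv.exists_isOrbit_move hc hγ
  have e1 : (γ' t).1 = B ((γ t).1 - c) := by rw [hmove]; simp [move]
  have e2 : (γ' t).2 = B (γ t).2 := by rw [hmove]; simp [move]
  have hdet : 0 ≤ det (γ' t).1 (γ' t).2 := by rw [e1, e2, hB.det_apply]; exact hs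
  have hhex : (γ' t).1 ∈ Hex := by rw [e1]; exact hB.mem_hex.2 hx
  have hv : (γ' t).2 ≠ 0 := by rw [e2, Ne, LinearEquiv.map_eq_zero_iff]; exact hu
  obtain ⟨d, ρ, hd, hρ, hcone⟩ := exists_eq_coneVec hv (by rw [e2]; exact h1) (by rw [e2]; exact h2)
  obtain ⟨p, q, hpq⟩ : ∃ p q, (γ' t).1 = (p, q) := ⟨_, _, rfl⟩
  rw [hpq] at hhex hdet
  rw [hcone] at hdet
  set r := p * ρ - q * (1 - ρ) with hr
  have hdr : det (p, q) (coneVec d ρ) = d * r := by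
    simp [det, coneVec, hr]
    ring
  have hr0 : 0 ≤ r := nonneg_of_mul_nonneg_right (hdr ▸ hdet) hd
  have hline : ((p, q) : Coord) = (r, -r) + (p + q) • (1 - ρ, ρ) := by
    ext <;> simp [hr] <;> ring
  have hz : γ' t = ((p, q), coneVec d ρ) := Prod.ext hpq hcone
  have hrpos : 0 < r := by
    refine hr0.lt_of_ne fun h => ?_
    have hline' : ((p, q) : Coord) = (p + q) • (1 - ρ, ρ) := by
      rw [hline, ← h]; ext <;> simp
    rw [hline'] at hhex hz
    exact hγ'.not_through_center hd hρ hhex hz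
  have hr1 : r < 1 := by
    have hp := (abs_lt.1 (hhex 2)).2
    have hq := (abs_lt.1 (hhex 0)).1
    have ep : p = r + (p + q) * (1 - ρ) := by simpa using congrArg Prod.fst hline
    have eq : q = -r + (p + q) * ρ := by simpa using congrArg Prod.snd hline
    simp only [height_two, height_zero] at hp hq
    by_contra! hge
    rcases le_total 0 (p + q) with h | h
    · have := mul_nonneg h (sub_nonneg.2 hρ.2)
      linarith
    · have := mul_nonpos_of_nonpos_of_nonneg h hρ.1
      linarith
  refine ⟨s, B⁻¹, γ', t + -((p + q) / d), d, ρ, r, hB.inv, hγ', hmove, hd, hρ, ⟨hrpos, hr1⟩, ?_⟩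
  have hback : ((p, q) : Coord) + (-((p + q) / d)) • coneVec d ρ = (r, -r) := by
    rw [coneVec, smul_smul, neg_mul, div_mul_cancel₀ _ hd.ne', neg_smul]
    nth_rw 1 [hline]
    exact add_neg_cancel_right _ _
  have := hγ'.eq_of_segment hz (T := -((p + q) / d)) fun x hx => not_onWall_of_mem_hex
    (add_smul_mem_hex hhex (by rw [hback]; exact mem_hex_radius hr0 hr1) hx)
  rw [this, hback]
  rfl

/-- A drift-periodic orbit is invariant under a translation that moves hexagons to hexagons with a
common vertex. -/
theorem IsOrbit.exists_unitStep {γ : ℝ → Coord × Coord} (hγ : IsOrbit γ) (h0 : ∀ t, (γ t).2 ≠ 0)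
    {w : Coord} (hw : EvenPt w) (hw0 : w ≠ 0) {T : ℝ} (hT : ∀ t, γ (t + T) = shift w (γ t)) :
    ∃ e, UnitStep e ∧ ∃ T', ∀ t, γ (t + T') = shift e (γ t) := by
  wlog hTpos : 0 < T generalizing w T
  · rcases (not_lt.1 hTpos).lt_or_eq with h | rfl
    · refine this hw.neg (neg_ne_zero.2 hw0) (T := -T) (fun t => ?_) (neg_pos.2 h)
      have := hT (t + -T)
      rw [neg_add_cancel_right] at this
      rw [this]
      ext <;> simp [shift]
    · have := congrArg Prod.fst (hT 0)
      simp [shift] at this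
      exact absurd this hw0
  obtain ⟨t, c, hc, ht⟩ := hγ.exists_mem_hex h0
  obtain ⟨s, A, γ', t', d, ρ, r, hA, hγ', hmove, hd, hρ, hr, hcross⟩ :=
    hγ.exists_crossing hc ht (h0 t)
  have hdrift : γ' (t' + T) = shift (A.symm w) (γ' t') := by
    refine move_injective A c ?_
    rw [← hmove, hT, hmove]
    ext <;> simp [move, shift] <;> ring
  obtain ⟨e, he, t'', ht''⟩ := hγ'.exists_unitStep_of_crossing hd hρ hr hcross
    (hA.evenPt_symm.2 hw) (by rwa [Ne, LinearEquiv.map_eq_zero_iff]) hTpos hdrift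
  have hall : (fun t => γ' (t + (t'' - t'))) = fun t => shift e (γ' t) :=
    (hγ'.comp_add _).eq_of_eq (isSymm_one.isOrbit he.evenPt hγ') (t := t')
      (by simpa [move] using ht'')
  refine ⟨A e, he.map hA, t'' - t', fun t => ?_⟩
  rw [hmove, hmove, show γ' (t + (t'' - t')) = shift e (γ' t) from congrFun hall t]
  ext <;> simp [move, shift] <;> ring

/-! ### Existence of drift-periodic orbits -/

/-- Inside hexagons the state `z` has a direction obtained from `u` by a rotation, and it travels
around the center counter-clockwise if `s = 1`, clockwise if `s = -1`. -/
def Turns (s : ℤˣ) (u : Coord) (z : Coord × Coord) : Prop :=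
  ∀ c, EvenPt c → z.1 - c ∈ Hex →
    (∃ n : ℕ, z.2 = (rot ^ n) u) ∧ 0 < ((s : ℤ) : ℝ) * det (z.1 - c) z.2

lemma Between.turns {u : Coord} {z : Coord × Coord} (h : Between u z) : Turns 1 u z := by
  intro c hc hz
  obtain ⟨n, h1, h2, -⟩ := h c hc hz
  exact ⟨⟨n, h1⟩, by simpa using h2⟩

lemma Turns.move {s s' : ℤˣ} {u c : Coord} {z : Coord × Coord} {A : Coord ≃ₗ[ℝ] Coord}
    (h : Turns s u z) (hA : IsSymm s' A) (hc : EvenPt c) :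
    Turns (s' * s) (A u) (TriHex.move A c z) := by
  intro c' hc' hz
  have e : (TriHex.move A c z).1 - c' = A (z.1 - A.symm (c' - c)) := by
    simp [TriHex.move]
    abel
  rw [e] at hz ⊢
  obtain ⟨⟨n, h1⟩, h2⟩ := h _ (hA.evenPt_symm.2 (by
    rw [sub_eq_add_neg]; exact hc'.add hc.neg)) (hA.mem_hex.1 hz)
  obtain ⟨m, hm⟩ := hA.exists_rot_pow n
  refine ⟨⟨m, ?_⟩, ?_⟩
  · rw [TriHex.move, h1, hm]
  · have e2 : ((s' : ℤ) : ℝ) * ((s' : ℤ) : ℝ) = 1 := by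
      rw [← Int.cast_mul, ← Units.val_mul, Int.units_mul_self]; simp
    simp only [TriHex.move]
    rw [hA.det_apply, Units.val_mul, Int.cast_mul]
    linear_combination h2 + (((s : ℤ) : ℝ) * det (z.1 - A.symm (c' - c)) z.2) * e2.symm.le

lemma Turns.of_rot_pow {s : ℤˣ} {u : Coord} {z : Coord × Coord} {n : ℕ}
    (h : Turns s ((rot ^ n) u) z) : Turns s u z := by
  intro c hc hz
  obtain ⟨⟨m, h1⟩, h2⟩ := h c hc hz
  exact ⟨⟨m + n, by rw [h1, pow_add]; rfl⟩, h2⟩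

lemma turns_crossing {d ρ r : ℝ} (hd : 0 < d) (hr : r ∈ Ioo (0 : ℝ) 1) :
    Turns 1 (coneVec d ρ) (crossing d ρ r) := by
  intro c hc hz
  have : c = 0 := eq_of_mem_hex hc evenPt_zero hz (by
    rw [sub_zero]; exact mem_hex_radius hr.1.le hr.2)
  subst this
  refine ⟨⟨0, rfl⟩, ?_⟩
  have : det ((crossing d ρ r).1 - 0) (crossing d ρ r).2 = d * r := by
    simp [det, crossing, coneVec]
    ring
  rw [this]
  simpa using mul_pos hd hr.1

lemma turns_crossingAt {d ρ r : ℝ} (hd : 0 < d) {n : ℕ} (hn : offset ρ r n ≠ 0) :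
    Turns 1 (coneVec d ρ) (crossingAt d ρ r n) := by
  have := (turns_crossing (ρ := ρ) hd ⟨(Int.fract_nonneg _).lt_of_ne hn.symm,
    Int.fract_lt_one (r - n * ρ)⟩).move (isSymm_rot_pow n) (evenPt_center ρ r n)
  rw [one_mul] at this
  exact this.of_rot_pow

lemma EvenPt.turns_shift {s : ℤˣ} {u c : Coord} {z : Coord × Coord} (hc : EvenPt c)
    (h : Turns s u z) : Turns s u (shift c z) := by
  have := h.move isSymm_one hc
  rwa [one_mul] at this

/-- In the direction with slope parameter `P / Q`, where `3 ∣ Q`, there is a drift-periodic orbit: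
with the initial offset `1 / (2 Q)`, the orbit of the rotation by `P / Q` avoids the singularities. -/
theorem exists_isOrbit_drift {d : ℝ} (hd : 0 < d) {P Q : ℕ} (hQ : 0 < Q) (hPQ : P.Coprime Q)
    (hle : P ≤ Q) (h3 : 3 ∣ Q) :
    ∃ γ e T, IsOrbit γ ∧ (γ 0).2 = coneVec d (P / Q) ∧ UnitStep e ∧
      (∀ t, Turns 1 (coneVec d (P / Q)) (γ t)) ∧ ∀ t, γ (t + T) = shift e (γ t) := by
  have hQ' : (0 : ℝ) < Q := by exact_mod_cast hQ
  set ρ : ℝ := P / Q with hρdef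
  have hQρ : Q * ρ = P := mul_div_cancel₀ _ hQ'.ne'
  have hρ : ρ ∈ Icc (0 : ℝ) 1 :=
    ⟨by positivity, (div_le_one hQ').2 (by exact_mod_cast hle)⟩
  set r : ℝ := 1 / (2 * Q) with hrdef
  have hQr : 2 * (Q * r) = 1 := by rw [hrdef]; field_simp
  have hr : r ∈ Ioo (0 : ℝ) 1 := by
    have h1 : (1 : ℝ) ≤ Q := by exact_mod_cast hQ
    refine ⟨by positivity, ?_⟩
    rw [hrdef, div_lt_one (by positivity)]
    linarith
  -- `Q` times an offset is half an odd integer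
  have hoff : ∀ n (m : ℤ), Q * offset ρ r n ≠ m := by
    intro n m h
    rw [offset, ← Int.self_sub_floor] at h
    have h1 : (1 : ℝ) = 2 * (m + n * P + Q * ⌊r - n * ρ⌋) := by
      rw [← h, ← hQr, ← hQρ]
      ring
    have h2 : (1 : ℤ) = 2 * (m + n * P + Q * ⌊r - n * ρ⌋) := by exact_mod_cast h1
    omega
  have hoff0 : ∀ n, offset ρ r n ≠ 0 := fun n h => hoff n 0 (by rw [h]; simp)
  have hoffρ : ∀ n, offset ρ r n ≠ ρ := fun n h => hoff n P (by rw [h, hQρ]; simp)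
  have hchain : ∀ n, ∃ T, 0 < T ∧ Connects (Turns 1 (coneVec d ρ)) (crossingAt d ρ r 0)
      (crossingAt d ρ r (n + 1)) T := by
    have hround : ∀ n, ∃ T, 0 < T ∧ Connects (Turns 1 (coneVec d ρ)) (crossingAt d ρ r n)
        (crossingAt d ρ r (n + 1)) T := by
      intro n
      obtain ⟨T, hT, hc⟩ := exists_round_at hd hρ (hoff0 n) (hoffρ n)
      exact ⟨T, (one_div_pos.2 hd).trans_le hT, hc.mono fun z hz => hz.turns⟩
    intro n
    induction n with
    | zero => exact hround 0
    | succ n ih =>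
      obtain ⟨T, hT, hc⟩ := ih
      obtain ⟨T', hT', hc'⟩ := hround (n + 1)
      exact ⟨T + T', add_pos hT hT', hc.trans hT.le hT'.le (turns_crossingAt hd (hoff0 _)) hc'⟩
  obtain ⟨n, rfl⟩ := Nat.exists_eq_succ_of_ne_zero hQ.ne'
  obtain ⟨T, hT, hc⟩ := hchain n
  have he := unitStep_center r hQ hQρ hPQ hle h3
  have hend : crossingAt d ρ r (n + 1) = shift (center ρ r (n + 1)) (crossingAt d ρ r 0) := by
    have := offset_add (r := r) (P := P) (Q := n + 1) (by exact_mod_cast hQρ) 0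
    rw [add_zero] at this
    rw [crossingAt_of_dvd h3, crossingAt_of_dvd (dvd_zero 3), this]
    ext <;> simp [shift, center]
  rw [hend] at hc
  obtain ⟨γ, hγ, hγ0, hturn, hper⟩ := hc.exists_isOrbit hT he.evenPt (turns_crossingAt hd (hoff0 0))
    fun z c hc hz => hc.turns_shift hz
  exact ⟨γ, _, T, hγ, by rw [hγ0, crossingAt_of_dvd (dvd_zero 3)]; rfl, he, hturn, hper⟩

/-! ### The tiling in lattice coordinates -/

/-- The point of the plane with the coordinates `(p, q)`. -/
noncomputable def plane : Coord ≃ₗ[ℝ] ℂ where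
  toFun x := ⟨x.1 + x.2 / 2, √3 / 2 * x.2⟩
  map_add' x y := by
    apply Complex.ext <;> simp <;> ring
  map_smul' a x := by
    apply Complex.ext <;> simp <;> ring
  invFun z := (z.re - z.im / √3, 2 * z.im / √3)
  left_inv x := by
    have : √3 ≠ 0 := by positivity
    ext <;> simp <;> field_simp <;> ring
  right_inv z := by
    have : √3 ≠ 0 := by positivity
    apply Complex.ext <;> simp <;> field_simp <;> ring

lemma plane_re (x : Coord) : (plane x).re = x.1 + x.2 / 2 := rfl

lemma plane_im (x : Coord) : (plane x).im = √3 / 2 * x.2 := rfl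

/-- The coordinates of the vectors `v i`. -/
def vCoord : Fin 3 → Coord := ![(1, 0), (-1, 1), (0, -1)]

@[simp] lemma plane_vCoord (i : Fin 3) : plane (vCoord i) = v i := by
  fin_cases i <;> apply Complex.ext <;> simp [vCoord, v, plane_re, plane_im] <;> norm_num

lemma refract_plane (k : Fin 3) (u : Coord) : refract (v k) (plane u) = plane (mirror k u) := by
  have h2 : √3 ^ 2 = 3 := Real.sq_sqrt (by norm_num)
  have h3 : √3 ^ 3 = 3 * √3 := by rw [pow_succ, h2]
  fin_cases k <;> apply Complex.ext <;>
    simp [refract, v, plane_re, plane_im, Complex.inner] <;> ring_nf <;>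
      simp only [h2, h3] <;> ring

lemma intPt_iff {z : ℂ} : z ∈ lattice ↔ IntPt (plane.symm z) := by
  constructor
  · intro h
    induction h using AddSubgroup.closure_induction with
    | mem x hx =>
      obtain ⟨i, rfl⟩ := hx
      rw [← plane_vCoord, LinearEquiv.symm_apply_apply]
      fin_cases i
      · exact ⟨1, 0, by simp [vCoord]⟩
      · exact ⟨-1, 1, by simp [vCoord]⟩
      · exact ⟨0, -1, by simp [vCoord]⟩
    | zero => exact ⟨0, 0, by simp [Prod.zero_eq_mk]⟩
    | add x y _ _ hx hy =>
      obtain ⟨m, n, h⟩ := hx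
      obtain ⟨m', n', h'⟩ := hy
      exact ⟨m + m', n + n', by rw [map_add, h, h']; simp⟩
    | neg x _ hx =>
      obtain ⟨m, n, h⟩ := hx
      exact ⟨-m, -n, by rw [map_neg, h]; simp⟩
  · rintro ⟨m, n, h⟩
    have : z = m • v 0 + (-n) • v 2 := by
      rw [← plane.apply_symm_apply z, h, ← plane_vCoord, ← plane_vCoord, ← map_zsmul, ← map_zsmul,
        ← map_add]
      congr 1
      simp [vCoord]
    rw [this]
    have hv : ∀ i, v i ∈ lattice := fun i => AddSubgroup.subset_closure ⟨i, rfl⟩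
    exact add_mem (zsmul_mem (hv 0) m) (zsmul_mem (hv 2) (-n))

lemma mem_centers {z : ℂ} : z ∈ centers ↔ EvenPt (plane.symm z) := by
  rw [evenPt_iff, ← map_smul, ← intPt_iff]
  constructor
  · rintro ⟨l, hl, rfl⟩
    convert hl using 1
    rw [Complex.real_smul]
    push_cast
    ring
  · intro h
    refine ⟨_, h, ?_⟩
    rw [Complex.real_smul]
    push_cast
    ring

lemma plane_mem_centers {c : Coord} : plane c ∈ centers ↔ EvenPt c := by
  rw [mem_centers, LinearEquiv.symm_apply_apply]

lemma isVertex_iff {x : Coord} :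
    IsVertex (plane x) ↔ ∃ c, EvenPt c ∧ ∃ i, x = c + vCoord i ∨ x = c - vCoord i := by
  constructor
  · rintro ⟨c, hc, i, h⟩
    refine ⟨plane.symm c, mem_centers.1 hc, i, ?_⟩
    rw [← plane_vCoord] at h
    refine h.imp (fun h => ?_) fun h => ?_ <;> apply plane.injective <;> simp [h]
  · rintro ⟨c, hc, i, h⟩
    refine ⟨plane c, plane_mem_centers.2 hc, i, ?_⟩
    rw [← plane_vCoord, ← map_add, ← map_sub]
    exact h.imp (congrArg _) (congrArg _)

lemma isVertex_plane {x : Coord} : IsVertex (plane x) ↔ ¬ Regular x := by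
  rw [isVertex_iff]
  constructor
  · rintro ⟨c, hc, i, h⟩ hreg
    have key : ∀ y : Coord, x = c + y → ∀ j k, j ≠ k → OnWall j y → OnWall k y → False := by
      rintro y rfl j k hjk hj hk
      rw [add_comm] at hreg
      exact hjk (hreg j k ((onWall_add_even hc).2 hj) ((onWall_add_even hc).2 hk))
    rcases h with h | h
    · fin_cases i
      · exact key _ h 1 2 (by decide) ⟨-1, by simp [vCoord]; norm_num⟩ ⟨0, by simp [vCoord]⟩
      · exact key _ h 0 2 (by decide) ⟨0, by simp [vCoord]⟩ ⟨-1, by simp [vCoord]; norm_num⟩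
      · exact key _ h 0 1 (by decide) ⟨-1, by simp [vCoord]; norm_num⟩ ⟨0, by simp [vCoord]⟩
    · rw [sub_eq_add_neg] at h
      fin_cases i
      · exact key _ h 1 2 (by decide) ⟨0, by simp [vCoord]⟩ ⟨-1, by simp [vCoord]; norm_num⟩
      · exact key _ h 0 2 (by decide) ⟨-1, by simp [vCoord]; norm_num⟩ ⟨0, by simp [vCoord]⟩
      · exact key _ h 0 1 (by decide) ⟨0, by simp [vCoord]⟩ ⟨-1, by simp [vCoord]; norm_num⟩
  · intro h
    simp only [Regular, not_forall] at h
    obtain ⟨j, k, hj, hk, hjk⟩ := h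
    -- two odd heights among three with sum zero
    have h12 : ∀ m n : ℤ, x.2 = 2 * m + 1 → -(x.1 + x.2) = 2 * n + 1 → _ := fun m n h0 h1 =>
      (⟨(2 * ((-m - n - 1 : ℤ) : ℝ), 2 * ((m + 1 : ℤ) : ℝ)), ⟨_, _, rfl⟩, 2, Or.inl (Prod.ext
        (by simp [vCoord]; linarith) (by simp [vCoord]; linarith))⟩ :
        ∃ c, EvenPt c ∧ ∃ i, x = c + vCoord i ∨ x = c - vCoord i)
    have h02 : ∀ m n : ℤ, x.2 = 2 * m + 1 → x.1 = 2 * n + 1 → _ := fun m n h0 h1 =>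
      (⟨(2 * ((n + 1 : ℤ) : ℝ), 2 * (m : ℝ)), ⟨_, _, rfl⟩, 1, Or.inl (Prod.ext
        (by simp [vCoord]; linarith) (by simp [vCoord]; linarith))⟩ :
        ∃ c, EvenPt c ∧ ∃ i, x = c + vCoord i ∨ x = c - vCoord i)
    have h01 : ∀ m n : ℤ, -(x.1 + x.2) = 2 * m + 1 → x.1 = 2 * n + 1 → _ := fun m n h0 h1 =>
      (⟨(2 * (n : ℝ), 2 * ((-m - n - 1 : ℤ) : ℝ)), ⟨_, _, rfl⟩, 0, Or.inl (Prod.ext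
        (by simp [vCoord]; linarith) (by simp [vCoord]; linarith))⟩ :
        ∃ c, EvenPt c ∧ ∃ i, x = c + vCoord i ∨ x = c - vCoord i)
    obtain ⟨m, hm⟩ := hj
    obtain ⟨n, hn⟩ := hk
    fin_cases j <;> fin_cases k
    · exact absurd rfl hjk
    · exact h12 m n hm hn
    · exact h02 m n hm hn
    · exact h12 n m hn hm
    · exact absurd rfl hjk
    · exact h01 m n hm hn
    · exact h02 n m hn hm
    · exact h01 n m hn hm
    · exact absurd rfl hjk

/-- The direction of the edge from `c + v i` to `c - v j`. -/
def third (i j : Fin 3) : Fin 3 := -(i + j)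

lemma neg_v_sub_v {i j : Fin 3} (hij : i ≠ j) : -v j - v i = v (third i j) := by
  simp only [← plane_vCoord, ← map_neg, ← map_sub]
  congr 1
  fin_cases i <;> fin_cases j <;> first | exact absurd rfl hij | simp [vCoord, third]

lemma onWall_third {i j : Fin 3} (hij : i ≠ j) : OnWall (third i j) (vCoord i) := by
  fin_cases i <;> fin_cases j
  · exact absurd rfl hij
  · exact (⟨0, by simp [vCoord]⟩ : OnWall 2 (vCoord 0))
  · exact (⟨-1, by simp [vCoord]; norm_num⟩ : OnWall 1 (vCoord 0))
  · exact (⟨-1, by simp [vCoord]; norm_num⟩ : OnWall 2 (vCoord 1))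
  · exact absurd rfl hij
  · exact (⟨0, by simp [vCoord]⟩ : OnWall 0 (vCoord 1))
  · exact (⟨0, by simp [vCoord]⟩ : OnWall 1 (vCoord 2))
  · exact (⟨-1, by simp [vCoord]; norm_num⟩ : OnWall 0 (vCoord 2))
  · exact absurd rfl hij

lemma height_vCoord_self (k : Fin 3) : height k (vCoord k) = 0 := by
  fin_cases k <;> simp [vCoord]

/-- An edge lies on a line of edges. -/
lemma IsEdge.onWall {a b : ℂ} (h : IsEdge a b) {x : Coord} (hx : plane x ∈ segment ℝ a b) :
    ∃ k, b - a = v k ∧ OnWall k x := by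
  obtain ⟨c, hc, i, j, hij, rfl, rfl⟩ := h
  have e : c - v j - (c + v i) = v (third i j) := by
    rw [← neg_v_sub_v hij]
    abel
  refine ⟨third i j, e, ?_⟩
  rw [segment_eq_image'] at hx
  obtain ⟨s, -, hs⟩ := hx
  rw [e] at hs
  have hx : x = vCoord i + plane.symm c + s • vCoord (third i j) := by
    apply plane.injective
    rw [← hs]
    simp [add_comm]
  have := (onWall_add_even (x := vCoord i) (mem_centers.1 hc)).2 (onWall_third hij)
  unfold OnWall at this ⊢
  rwa [hx, map_add, map_smul, height_vCoord_self, smul_zero, add_zero]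

lemma IsSymm.regular {s : ℤˣ} {A : Coord ≃ₗ[ℝ] Coord} (hA : IsSymm s A) {x : Coord}
    (h : Regular (A x)) : Regular x := by
  obtain ⟨σ, hσ⟩ := hA.perm
  intro j k hj hk
  have key : ∀ i, OnWall i x → OnWall (σ⁻¹ i) (A x) := fun i hi => by
    refine (oddInt_iff_of_abs_eq ((hσ _).1 x)).2 ?_
    change OnWall _ x
    simpa using hi
  exact σ⁻¹.injective (h _ _ (key j hj) (key k hk))

lemma rot_pow_vCoord (n : ℕ) (i : Fin 3) : ∃ j, (rot ^ n) (vCoord i) = vCoord j := by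
  induction n with
  | zero => exact ⟨i, rfl⟩
  | succ n ih =>
    obtain ⟨j, hj⟩ := ih
    rw [pow_succ', LinearEquiv.mul_apply, hj]
    fin_cases j
    · exact ⟨2, by simp [vCoord]⟩
    · exact ⟨0, by simp [vCoord]⟩
    · exact ⟨1, by simp [vCoord]⟩

lemma isEdge_of_coord {c x : Coord} {i j : Fin 3} {s : ℝ} (hc : EvenPt c) (hij : i ≠ j)
    (hs : s ∈ Ioo (0 : ℝ) 1) (hx : x = (1 - s) • vCoord i - s • vCoord j + c) :
    ∃ a b, IsEdge a b ∧ plane x ∈ segment ℝ a b := by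
  refine ⟨plane c + v i, plane c - v j, ⟨plane c, plane_mem_centers.2 hc, i, j, hij, rfl, rfl⟩,
    1 - s, s, by linarith [hs.2], hs.1.le, by ring, ?_⟩
  rw [hx, ← plane_vCoord, ← plane_vCoord, ← map_add, ← map_sub, ← map_smul, ← map_smul, ← map_add]
  congr 1
  rw [smul_add, smul_sub, sub_smul, sub_smul, one_smul, one_smul]
  abel

/-- The lines of edges are covered by the edges. -/
lemma exists_isEdge {x : Coord} (hx : Regular x) {k : Fin 3} (hk : OnWall k x) :
    ∃ a b, IsEdge a b ∧ b - a = v k ∧ plane x ∈ segment ℝ a b := by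
  suffices h : ∃ a b, IsEdge a b ∧ plane x ∈ segment ℝ a b by
    obtain ⟨a, b, hab, hseg⟩ := h
    obtain ⟨j, hj, hj'⟩ := hab.onWall hseg
    rw [hx j k hj' hk] at hj
    exact ⟨a, b, hab, hj, hseg⟩
  obtain ⟨n, y, rfl, hy2⟩ := exists_onWall_two hk
  obtain ⟨A, c, s, -, hA, hc, hs, hyA⟩ := exists_isSymm_edge ((isSymm_rot_pow n).regular hx) hy2
  obtain ⟨i, hi⟩ := rot_pow_vCoord n 0
  obtain ⟨j, hj⟩ := rot_pow_vCoord n 1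
  have hij : i ≠ j := by
    rintro rfl
    have := (rot ^ n).injective (hi.trans hj.symm)
    simp [vCoord] at this
  have hc' := (isSymm_rot_pow n).evenPt.2 hc
  have e : ((1, -s) : Coord) = (1 - s) • vCoord 0 - s • vCoord 1 := by
    ext <;> simp [vCoord]
  rcases hA with rfl | rfl
  · refine isEdge_of_coord hc' hij hs ?_
    rw [hyA, map_add, LinearEquiv.coe_one, id, e, map_sub, map_smul, map_smul, hi, hj]
  · refine isEdge_of_coord hc' hij.symm (s := 1 - s) ⟨by linarith [hs.2], by linarith [hs.1]⟩ ?_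
    rw [hyA, map_add, LinearEquiv.neg_apply, map_neg, e, map_sub, map_smul, map_smul, hi, hj,
      sub_sub_cancel, neg_sub]

/-! ### Trajectories and orbits -/

/-- The curve in the plane with the coordinates `γ`. -/
noncomputable def toPlane (γ : ℝ → Coord × Coord) (t : ℝ) : ℂ × ℂ :=
  (plane (γ t).1, plane (γ t).2)

lemma exists_toPlane (Γ : ℝ → ℂ × ℂ) : ∃ γ, Γ = toPlane γ :=
  ⟨fun t => (plane.symm (Γ t).1, plane.symm (Γ t).2), by funext t; simp [toPlane]⟩

lemma toPlane_eq_line {γ : ℝ → Coord × Coord} {s t : ℝ} {x u : Coord} :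
    toPlane γ s = (plane x + (s - t) • plane u, plane u) ↔ γ s = (x + (s - t) • u, u) := by
  rw [← map_smul, ← map_add, toPlane, Prod.mk_inj, Prod.ext_iff, plane.injective.eq_iff,
    plane.injective.eq_iff]

lemma IsTrajectory.isOrbit {γ : ℝ → Coord × Coord} (h : IsTrajectory (toPlane γ)) :
    IsOrbit γ := by
  have hreg : ∀ t, Regular (γ t).1 := fun t => by
    by_contra hn
    exact h.not_vertex t (isVertex_plane.2 hn)
  refine fun a b => ⟨fun t _ => hreg t, fun t _ => ?_, fun t _ => ?_⟩
  · exact (h.forward t).mono fun s hs => toPlane_eq_line.1 hs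
  · by_cases hw : ∃ k, OnWall k (γ t).1
    · obtain ⟨k, hk⟩ := hw
      obtain ⟨a, b, hab, hv, hseg⟩ := exists_isEdge (hreg t) hk
      refine ⟨mirror k (γ t).2, ?_, ?_⟩
      · have := (hreg t).refracts_mirror (u := mirror k (γ t).2) hk
        rwa [mirror_mirror] at this
      · refine (h.backward_edge t a b hab hseg).mono fun s hs => toPlane_eq_line.1 ?_
        rw [hs, hv, ← refract_plane]
        rfl
    · push Not at hw
      refine ⟨(γ t).2, refracts_self hw, ?_⟩
      refine (h.backward t fun a b hab hseg => ?_).mono fun s hs => toPlane_eq_line.1 hs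
      obtain ⟨k, -, hk⟩ := hab.onWall hseg
      exact hw k hk

lemma IsOrbit.isTrajectory {γ : ℝ → Coord × Coord} (h : IsOrbit γ)
    (hunit : ∀ t, ‖plane (γ t).2‖ = 1) : IsTrajectory (toPlane γ) where
  unit_speed := hunit
  not_vertex t hv := isVertex_plane.1 hv (h.regular t)
  forward t := (h.departs t).mono fun s hs => toPlane_eq_line.2 hs
  backward t hno := by
    obtain ⟨u, hu, hev⟩ := h.arrives t
    have : (γ t).2 = u := hu.1 fun k hk => by
      obtain ⟨a, b, hab, -, hseg⟩ := exists_isEdge (h.regular t) hk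
      exact hno a b hab hseg
    rw [← this] at hev
    exact hev.mono fun s hs => toPlane_eq_line.2 hs
  backward_edge t a b hab hseg := by
    obtain ⟨u, hu, hev⟩ := h.arrives t
    obtain ⟨k, hv, hk⟩ := hab.onWall hseg
    have : u = mirror k (γ t).2 := by rw [hu.2 k hk, mirror_mirror]
    rw [this] at hev
    refine hev.mono fun s hs => ?_
    rw [toPlane_eq_line.2 hs, ← refract_plane, hv]
    rfl

lemma sq_norm_plane (u : Coord) : ‖plane u‖ ^ 2 = u.1 ^ 2 + u.1 * u.2 + u.2 ^ 2 := by
  have h2 : √3 ^ 2 = 3 := Real.sq_sqrt (by norm_num)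
  rw [Complex.sq_norm, Complex.normSq_apply, plane_re, plane_im]
  linear_combination (u.2 ^ 2 / 4) * h2

lemma norm_plane_mirror (k : Fin 3) (u : Coord) : ‖plane (mirror k u)‖ = ‖plane u‖ := by
  rw [← sq_eq_sq₀ (norm_nonneg _) (norm_nonneg _), sq_norm_plane, sq_norm_plane]
  fin_cases k <;> simp <;> ring

/-- The speed is constant along an orbit. -/
lemma IsOrbit.norm_eq {γ : ℝ → Coord × Coord} (h : IsOrbit γ) (s t : ℝ) :
    ‖plane (γ s).2‖ = ‖plane (γ t).2‖ := by
  have hloc : IsLocallyConstant fun t => ‖plane (γ t).2‖ := by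
    rw [IsLocallyConstant.iff_eventually_eq]
    intro t
    rw [← nhdsNE_sup_pure, ← nhdsLT_sup_nhdsGT, eventually_sup, eventually_sup]
    refine ⟨⟨?_, (h.departs t).mono fun s hs => by rw [hs]⟩, by simp⟩
    obtain ⟨u, hu, hev⟩ := h.arrives t
    have hnorm : ‖plane (γ t).2‖ = ‖plane u‖ := by
      by_cases hw : ∃ k, OnWall k (γ t).1
      · obtain ⟨k, hk⟩ := hw
        rw [hu.2 k hk, norm_plane_mirror]
      · push Not at hw
        rw [hu.1 hw]
    filter_upwards [hev] with s hs
    rw [hs, hnorm]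
  exact hloc.apply_eq_of_isPreconnected isPreconnected_univ (mem_univ s) (mem_univ t)

lemma invariantUnder_of_shift {Γ : ℝ → ℂ × ℂ} {w : ℂ} {T : ℝ}
    (h : ∀ t, Γ (t + T) = translate w (Γ t)) : InvariantUnder w Γ := by
  ext z
  constructor
  · rintro ⟨_, ⟨t, rfl⟩, rfl⟩
    exact ⟨t + T, h t⟩
  · rintro ⟨t, rfl⟩
    exact ⟨Γ (t - T), ⟨_, rfl⟩, by rw [← h, sub_add_cancel]⟩

lemma toPlane_shift {γ : ℝ → Coord × Coord} {e : Coord} {T : ℝ}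
    (h : ∀ t, γ (t + T) = shift e (γ t)) (t : ℝ) :
    toPlane γ (t + T) = translate (plane e) (toPlane γ t) := by
  simp [toPlane, h, shift, translate]

lemma UnitStep.exists_eq {e : Coord} (h : UnitStep e) :
    ∃ i, e = (2 : ℝ) • vCoord i ∨ e = -((2 : ℝ) • vCoord i) := by
  obtain ⟨⟨m, n, rfl⟩, hne, hle⟩ := h
  have h0 := abs_le.1 (hle 0)
  have h1 := abs_le.1 (hle 1)
  have h2 := abs_le.1 (hle 2)
  simp only [height_zero, height_one, height_two] at h0 h1 h2
  have hm : -1 ≤ m ∧ m ≤ 1 := by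
    constructor <;> (rify; linarith)
  have hn : -1 ≤ n ∧ n ≤ 1 := by
    constructor <;> (rify; linarith)
  have hmn : -1 ≤ m + n ∧ m + n ≤ 1 := by
    constructor <;> (rify; linarith)
  have hne' : ¬ (m = 0 ∧ n = 0) := by
    rintro ⟨rfl, rfl⟩
    apply hne
    simp [Prod.zero_eq_mk]
  have hcases : (m = 1 ∧ n = 0) ∨ (m = -1 ∧ n = 0) ∨ (m = -1 ∧ n = 1) ∨ (m = 1 ∧ n = -1) ∨
      (m = 0 ∧ n = -1) ∨ (m = 0 ∧ n = 1) := by omega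
  rcases hcases with h | h | h | h | h | h <;> obtain ⟨rfl, rfl⟩ := h
  · exact ⟨0, Or.inl (by simp [vCoord])⟩
  · exact ⟨0, Or.inr (by simp [vCoord])⟩
  · exact ⟨1, Or.inl (by simp [vCoord])⟩
  · exact ⟨1, Or.inr (by simp [vCoord])⟩
  · exact ⟨2, Or.inl (by simp [vCoord])⟩
  · exact ⟨2, Or.inr (by simp [vCoord])⟩

/-- A periodic drift by a unit step makes the curve invariant under twice a vector `v i`. -/
lemma invariantUnder_of_eq {γ : ℝ → Coord × Coord} {e : Coord} {T : ℝ} {i : Fin 3}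
    (h : ∀ t, γ (t + T) = shift e (γ t))
    (he : e = (2 : ℝ) • vCoord i ∨ e = -((2 : ℝ) • vCoord i)) :
    InvariantUnder (2 * v i) (toPlane γ) := by
  have hv : plane ((2 : ℝ) • vCoord i) = 2 * v i := by
    rw [map_smul, plane_vCoord, Complex.real_smul]
    push_cast
    rfl
  rcases he with rfl | rfl
  · rw [← hv]
    exact invariantUnder_of_shift (toPlane_shift h)
  · refine invariantUnder_of_shift (T := -T) fun t => ?_
    have := toPlane_shift h (t + -T)
    rw [neg_add_cancel_right, map_neg, hv] at this
    rw [this]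
    simp [translate]

/-! ### Translations, hexagons and the hexagonal norm -/

lemma norm_v (i : Fin 3) : ‖v i‖ = 1 := by
  rw [← plane_vCoord, ← pow_eq_one_iff_of_nonneg (norm_nonneg _) two_ne_zero, sq_norm_plane]
  fin_cases i <;> simp [vCoord]

/-- A closed unit disc contains `a + 1` and `a - 1` only if `a` is its center. -/
lemma eq_of_antipodal {a d : ℂ} (h₁ : ‖a + 1 - d‖ ≤ 1) (h₂ : ‖a - 1 - d‖ ≤ 1) : a = d := by
  have h := parallelogram_law_with_norm ℝ (a - d) 1
  have e1 : a - d + 1 = a + 1 - d := by ring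
  have e2 : a - d - 1 = a - 1 - d := by ring
  rw [e1, e2, norm_one] at h
  have : ‖a - d‖ = 0 := by
    nlinarith [norm_nonneg (a + 1 - d), norm_nonneg (a - 1 - d), norm_nonneg (a - d)]
  rwa [norm_eq_zero, sub_eq_zero] at this

lemma hexagon_subset_closedBall (c : ℂ) : hexagon c ⊆ Metric.closedBall c 1 := by
  refine convexHull_min ?_ (convex_closedBall c 1)
  rintro _ (⟨i, rfl⟩ | ⟨i, rfl⟩) <;> simp [dist_eq_norm, norm_v]

lemma norm_v_add_v {i j : Fin 3} (hij : i ≠ j) : ‖v i + v j‖ = 1 := by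
  rw [← norm_neg, neg_add', ← norm_v (third j i), ← neg_v_sub_v hij.symm]

lemma triangle_subset_closedBall_left (c : ℂ) {i j : Fin 3} (hij : i ≠ j) :
    triangle c i j ⊆ Metric.closedBall (c + v i) 1 := by
  refine convexHull_min ?_ (convex_closedBall _ 1)
  rintro _ (rfl | rfl | rfl)
  · simp
  · rw [Metric.mem_closedBall, dist_comm, dist_eq_norm,
      show c + v i - (c - v j) = v i + v j by ring, norm_v_add_v hij]
  · rw [Metric.mem_closedBall, dist_eq_norm, show c + v i - v j - (c + v i) = -v j by ring,
      norm_neg, norm_v]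

lemma triangle_subset_closedBall_right (c : ℂ) {i j : Fin 3} (hij : i ≠ j) :
    triangle c i j ⊆ Metric.closedBall (c - v j) 1 := by
  refine convexHull_min ?_ (convex_closedBall _ 1)
  rintro _ (rfl | rfl | rfl)
  · rw [Metric.mem_closedBall, dist_eq_norm, show c + v i - (c - v j) = v i + v j by ring,
      norm_v_add_v hij]
  · simp
  · rw [Metric.mem_closedBall, dist_eq_norm, show c + v i - v j - (c - v j) = v i by ring, norm_v]

/-- The hexagon around `0` is moved to a tile with two points at the distance two. A triangle lies in
the unit discs around two of its vertices and has no such points, and a hexagon has `w` as the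
midpoint of such points only if `w` is its center. -/
lemma IsTranslationalSymmetry.mem_centers {w : ℂ} (h : IsTranslationalSymmetry w) :
    w ∈ centers := by
  have h0 : (0 : ℂ) ∈ centers := ⟨0, zero_mem _, by simp⟩
  have hmem : (fun z => z + w) '' hexagon 0 ∈ tiles := by
    rw [← h]
    exact ⟨hexagon 0, Or.inl ⟨0, h0, rfl⟩, rfl⟩
  have hp : w + 1 ∈ (fun z => z + w) '' hexagon 0 :=
    ⟨1, subset_convexHull _ _ (Or.inl ⟨0, by simp [v]⟩), add_comm _ _⟩
  have hm : w - 1 ∈ (fun z => z + w) '' hexagon 0 :=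
    ⟨-1, subset_convexHull _ _ (Or.inr ⟨0, by simp [v]⟩), by ring⟩
  rcases hmem with ⟨c, hc, hP⟩ | ⟨c, hc, i, j, hij, hP⟩
  · rw [hP] at hp hm
    have h1 := hexagon_subset_closedBall c hp
    have h2 := hexagon_subset_closedBall c hm
    rw [Metric.mem_closedBall, dist_eq_norm] at h1 h2
    rwa [eq_of_antipodal h1 h2]
  · rw [hP] at hp hm
    have h1 := triangle_subset_closedBall_left c hij hp
    have h2 := triangle_subset_closedBall_left c hij hm
    have h3 := triangle_subset_closedBall_right c hij hp
    have h4 := triangle_subset_closedBall_right c hij hm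
    rw [Metric.mem_closedBall, dist_eq_norm] at h1 h2 h3 h4
    have e := (eq_of_antipodal h1 h2).symm.trans (eq_of_antipodal h3 h4)
    have := norm_v_add_v hij
    rw [show v i + v j = c + v i - (c - v j) by ring, e, sub_self, norm_zero] at this
    exact absurd this zero_ne_one

lemma abs_height_le_of_mem_hexagon {c z : ℂ} (hz : z ∈ hexagon c) (k : Fin 3) :
    |height k (plane.symm (z - c))| ≤ 1 := by
  set f : ℂ →ₗ[ℝ] ℝ := height k ∘ₗ plane.symm.toLinearMap with hf
  have hv : ∀ i, |f (v i)| ≤ 1 := by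
    intro i
    have : f (v i) = height k (vCoord i) := by
      rw [← plane_vCoord]
      simp only [hf, LinearMap.comp_apply, LinearEquiv.coe_coe, LinearEquiv.symm_apply_apply]
    rw [this]
    fin_cases k <;> fin_cases i <;> simp [vCoord]
  have hsub : hexagon c ⊆ f ⁻¹' Icc (f c - 1) (f c + 1) := by
    refine convexHull_min ?_ ((convex_Icc _ _).linear_preimage f)
    rintro _ (⟨i, rfl⟩ | ⟨i, rfl⟩) <;> have := abs_le.1 (hv i) <;>
      simp only [mem_preimage, map_add, map_sub, mem_Icc] <;> constructor <;> linarith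
  have h1 := hsub hz
  have h2 : height k (plane.symm (z - c)) = f z - f c := by simp [hf]
  rw [h2, abs_le]
  constructor <;> linarith [h1.1, h1.2]

lemma mem_hex_of_mem_interior {c z : ℂ} (hz : z ∈ interior (hexagon c)) :
    plane.symm (z - c) ∈ Hex := by
  intro k
  obtain ⟨y, hy⟩ : ∃ y : Coord, height k y = 1 := by
    fin_cases k
    · exact ⟨(0, 1), rfl⟩
    · exact ⟨(0, -1), by simp⟩
    · exact ⟨(1, 0), rfl⟩
  have hlim : ∀ σ : ℝ, Tendsto (fun s : ℝ => z + (s * σ) • plane y) (𝓝[>] 0) (𝓝 z) := by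
    intro σ
    have : Tendsto (fun s : ℝ => z + (s * σ) • plane y) (𝓝 0) (𝓝 (z + ((0 : ℝ) * σ) • plane y)) :=
      Continuous.tendsto (by fun_prop) 0
    simpa using this.mono_left nhdsWithin_le_nhds
  have key : ∀ σ : ℝ, ∃ s : ℝ, 0 < s ∧ |height k (plane.symm (z - c)) + s * σ| ≤ 1 := by
    intro σ
    obtain ⟨s, hs, hs0⟩ := (((hlim σ).eventually (mem_interior_iff_mem_nhds.1 hz)).and
      self_mem_nhdsWithin).exists
    refine ⟨s, hs0, ?_⟩
    have := abs_height_le_of_mem_hexagon hs k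
    rwa [add_sub_right_comm, map_add, map_smul, LinearEquiv.symm_apply_apply, map_add, map_smul, hy,
      smul_eq_mul, mul_one] at this
  obtain ⟨s, hs, h1⟩ := key 1
  obtain ⟨s', hs', h2⟩ := key (-1)
  rw [abs_le] at h1 h2
  rw [abs_lt]
  constructor <;> linarith [h1.2, h2.1]

lemma hexNorm_plane {x : Coord} {m : ℝ} (hle : ∀ k, |height k x| ≤ m)
    (hex : ∃ k, |height k x| = m) : hexNorm (plane x) = m := by
  have hiff : ∀ a b c : ℝ, plane x = a • v 0 + b • v 1 + c • v 2 ↔ x.1 = a - b ∧ x.2 = b - c := by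
    intro a b c
    simp only [← plane_vCoord, ← map_smul, ← map_add, plane.injective.eq_iff]
    simp [vCoord, Prod.ext_iff, sub_eq_add_neg]
  have h0 := abs_le.1 (hle 0)
  have h1 := abs_le.1 (hle 1)
  have h2 := abs_le.1 (hle 2)
  simp only [height_zero, height_one, height_two] at h0 h1 h2
  refine IsLeast.csInf_eq ⟨?_, ?_⟩
  · obtain ⟨k, hk⟩ := hex
    fin_cases k
    · refine ⟨0, -x.1, -x.1 - x.2, (hiff _ _ _).2 ⟨by ring, by ring⟩, ?_⟩
      change |x.2| = m at hk
      rcases abs_cases x.2 with h | h <;> rcases abs_cases (-x.1) with h' | h' <;>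
        rcases abs_cases (-x.1 - x.2) with h'' | h'' <;> simp only [abs_zero] <;> linarith
    · refine ⟨x.1, 0, -x.2, (hiff _ _ _).2 ⟨by ring, by ring⟩, ?_⟩
      change |-(x.1 + x.2)| = m at hk
      rcases abs_cases (-(x.1 + x.2)) with h | h <;> rcases abs_cases x.1 with h' | h' <;>
        rcases abs_cases (-x.2) with h'' | h'' <;> simp only [abs_zero] <;> linarith
    · refine ⟨x.1 + x.2, x.2, 0, (hiff _ _ _).2 ⟨by ring, by ring⟩, ?_⟩
      change |x.1| = m at hk
      rcases abs_cases x.1 with h | h <;> rcases abs_cases (x.1 + x.2) with h' | h' <;>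
        rcases abs_cases x.2 with h'' | h'' <;> simp only [abs_zero] <;> linarith
  · rintro _ ⟨a, b, c, h, rfl⟩
    obtain ⟨e1, e2⟩ := (hiff _ _ _).1 h
    obtain ⟨k, rfl⟩ := hex
    have ha := abs_nonneg a
    have hb := abs_nonneg b
    have hc := abs_nonneg c
    fin_cases k
    · change |x.2| ≤ _
      rw [e2]
      linarith [abs_sub b c]
    · change |-(x.1 + x.2)| ≤ _
      rw [e1, e2, show -(a - b + (b - c)) = c - a by ring]
      linarith [abs_sub c a]
    · change |x.1| ≤ _
      rw [e1]
      linarith [abs_sub a b]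

lemma im_conj_plane_mul (x u : Coord) :
    (starRingEnd ℂ (plane x) * plane u).im = √3 / 2 * det x u := by
  simp [plane_re, plane_im, det]
  ring

lemma exists_plane_rot_pow (n : ℕ) : ∃ k, ∀ u, plane ((rot ^ n) u) = v k * plane u := by
  have hrot : ∀ u, plane (rot u) = v 2 * plane u := by
    intro u
    have h2 : √3 ^ 2 = 3 := Real.sq_sqrt (by norm_num)
    apply Complex.ext
    · simp [plane_re, plane_im, v]
      ring_nf
      rw [h2]
      ring
    · simp [plane_re, plane_im, v]
      ring
  induction n with
  | zero => exact ⟨0, fun u => by simp [v]⟩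
  | succ n ih =>
    obtain ⟨k, hk⟩ := ih
    have hvk : ∃ j, v 2 * v k = v j := by
      simp only [← plane_vCoord k, ← hrot]
      obtain ⟨j, hj⟩ := rot_pow_vCoord 1 k
      exact ⟨j, by rw [← plane_vCoord, ← hj, pow_one]⟩
    obtain ⟨j, hj⟩ := hvk
    exact ⟨j, fun u => by rw [pow_succ', LinearEquiv.mul_apply, hrot, hk, ← mul_assoc, hj]⟩

lemma exists_rot_pow_vCoord (i j : Fin 3) : ∃ n : ℕ, (rot ^ n) (vCoord i) = vCoord j := by
  have h0 : rot (vCoord 0) = vCoord 2 := by simp [vCoord]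
  have h1 : rot (vCoord 1) = vCoord 0 := by simp [vCoord]
  have h2 : rot (vCoord 2) = vCoord 1 := by simp [vCoord]
  fin_cases i <;> fin_cases j
  · exact ⟨0, rfl⟩
  · exact ⟨2, (congrArg rot h0).trans h2⟩
  · exact ⟨1, h0⟩
  · exact ⟨1, h1⟩
  · exact ⟨0, rfl⟩
  · exact ⟨2, (congrArg rot h1).trans h0⟩
  · exact ⟨2, (congrArg rot h2).trans h1⟩
  · exact ⟨1, h2⟩
  · exact ⟨0, rfl⟩

/-! ### The two statements -/

theorem IsTrajectory.exists_invariantUnder {Γ : ℝ → ℂ × ℂ} (h : IsTrajectory Γ)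
    (hdrift : IsDriftPeriodic Γ) : ∃ i : Fin 3, InvariantUnder (2 * v i) Γ := by
  obtain ⟨γ, rfl⟩ := exists_toPlane Γ
  obtain ⟨w, hw0, hsymm, hinv⟩ := hdrift
  have hγ := h.isOrbit
  have hne : ∀ t, (γ t).2 ≠ 0 := fun t h0 => by
    have := h.unit_speed t
    simp [toPlane, h0] at this
  have hw := mem_centers.1 hsymm.mem_centers
  obtain ⟨T, hT⟩ : translate w (toPlane γ 0) ∈ range (toPlane γ) := by
    rw [← hinv]
    exact ⟨_, ⟨0, rfl⟩, rfl⟩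
  have hT' : γ T = shift (plane.symm w) (γ 0) := by
    refine Prod.ext (plane.injective ?_) (plane.injective ?_)
    · simpa [shift, toPlane, translate] using congrArg Prod.fst hT
    · exact congrArg Prod.snd hT
  have hall : (fun t => γ (t + T)) = fun t => shift (plane.symm w) (γ t) :=
    (hγ.comp_add T).eq_of_eq (isSymm_one.isOrbit hw hγ) (t := 0) (by simpa [move] using hT')
  obtain ⟨e, he, T', hT'⟩ := hγ.exists_unitStep hne hw
    (by rwa [Ne, LinearEquiv.map_eq_zero_iff]) (congrFun hall)
  obtain ⟨i, hi⟩ := he.exists_eq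
  exact ⟨i, invariantUnder_of_eq hT' hi⟩

/-- An orbit with the turning behaviour `Turns s u`, of unit speed, is a trajectory of the flow
restricted to the direction `u` and the sign `s`. -/
lemma IsOrbit.isTrajectoryOf {γ : ℝ → Coord × Coord} (h : IsOrbit γ) {s : ℤˣ} {u : Coord}
    (hunit : ∀ t, ‖plane (γ t).2‖ = 1) (hturn : ∀ t, Turns s u (γ t)) :
    IsTrajectoryOf (plane u) s (toPlane γ) := by
  have hmem : ∀ t, ∀ c ∈ centers, (toPlane γ t).1 ∈ interior (hexagon c) →
      (γ t).1 - plane.symm c ∈ Hex := fun t c _ hin => by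
    simpa [toPlane] using mem_hex_of_mem_interior hin
  refine ⟨h.isTrajectory hunit, fun t c hc hin => ?_, fun t c hc hin => ?_⟩
  · obtain ⟨⟨n, hn⟩, -⟩ := hturn t _ (mem_centers.1 hc) (hmem t c hc hin)
    obtain ⟨k, hk⟩ := exists_plane_rot_pow n
    exact ⟨k, by rw [toPlane, hn, hk]⟩
  · obtain ⟨-, hdet⟩ := hturn t _ (mem_centers.1 hc) (hmem t c hc hin)
    have e : (toPlane γ t).1 - c = plane ((γ t).1 - plane.symm c) := by simp [toPlane]
    have e' : (toPlane γ t).2 = plane (γ t).2 := rfl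
    rw [e, e', im_conj_plane_mul, mul_left_comm]
    positivity

/-- The normal form of a direction in `driftDirections`: up to a symmetry of the hexagon, of any
given determinant `s`, it is a vector `coneVec d (P / Q)` with `3 ∣ Q`. -/
lemma exists_coneVec_of_mem_driftDirections {θ : ℂ} (hθ : θ ∈ driftDirections) (s : ℤˣ) :
    ∃ (A : Coord ≃ₗ[ℝ] Coord) (d : ℝ) (P Q : ℕ), IsSymm s A ∧ 0 < d ∧ 0 < Q ∧ P.Coprime Q ∧ P ≤ Q ∧
      3 ∣ Q ∧ ‖θ‖ = 1 ∧ θ = plane (A (coneVec d (P / Q))) := by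
  obtain ⟨w, ⟨hw, hvis⟩, ⟨k, hk⟩, rfl⟩ := hθ
  have hw0 : w ≠ 0 := by
    rintro rfl
    exact hvis (1 / 2) (by norm_num) (by norm_num) (by rw [smul_zero]; exact zero_mem _)
  have hnorm : 0 < ‖w‖ := norm_pos_iff.2 hw0
  obtain ⟨B, hB, h1, h2⟩ := exists_isSymm_nonneg s (plane.symm w)
  obtain ⟨m, n, hmn⟩ := (hB.intPt _).2 (intPt_iff.1 hw)
  rw [hmn] at h1 h2
  obtain ⟨a, rfl⟩ := Int.eq_ofNat_of_zero_le (show 0 ≤ m from Int.cast_nonneg_iff.1 h1)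
  obtain ⟨P, rfl⟩ := Int.eq_ofNat_of_zero_le (show 0 ≤ n from Int.cast_nonneg_iff.1 h2)
  have hwB : w = plane (B⁻¹ ((a : ℝ), (P : ℝ))) := by
    apply plane.symm.injective
    apply B.injective
    rw [hmn]
    simp
  -- the hexagonal norm of `w` is the sum of the two coordinates
  have hQ : hexNorm w = ((a + P : ℕ) : ℝ) := by
    obtain ⟨σ, hσ⟩ := hB.inv.perm
    rw [hwB]
    have hval : ∀ j, |height j (B⁻¹ ((a : ℝ), (P : ℝ)))| = |height (σ j) ((a : ℝ), (P : ℝ))| :=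
      fun j => (hσ j).1 _
    have ha : (0 : ℝ) ≤ a := Nat.cast_nonneg a
    have hP : (0 : ℝ) ≤ P := Nat.cast_nonneg P
    have hheight : |height 1 ((a : ℝ), (P : ℝ))| = ((a + P : ℕ) : ℝ) := by
      rw [height_one, abs_neg, abs_of_nonneg (by positivity)]
      push_cast
      rfl
    refine hexNorm_plane (fun j => ?_) ⟨σ⁻¹ 1, ?_⟩
    · rw [hval]
      generalize σ j = i
      fin_cases i
      · change |(P : ℝ)| ≤ _
        rw [abs_of_nonneg hP]
        push_cast
        linarith
      · exact hheight.le
      · change |(a : ℝ)| ≤ _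
        rw [abs_of_nonneg ha]
        push_cast
        linarith
    · rw [hval, show σ (σ⁻¹ 1) = 1 by simp, hheight]
  have h3 : 3 ∣ a + P := by
    rw [hQ] at hk
    have : ((a + P : ℕ) : ℤ) = 3 * k := by exact_mod_cast hk
    omega
  have hQpos : 0 < a + P := by
    rcases Nat.eq_zero_or_pos (a + P) with h | h
    · refine absurd ?_ hw0
      have ha : a = 0 := by omega
      have hP : P = 0 := by omega
      rw [hwB, ha, hP, Nat.cast_zero, ← Prod.zero_eq_mk, map_zero, map_zero]
    · exact h
  -- a common divisor of the coordinates would make `w` invisible from the origin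
  have hcop : P.Coprime (a + P) := by
    rw [Nat.coprime_add_self_right]
    by_contra hne
    have hg0 : 0 < P.gcd a := by
      rcases Nat.eq_zero_or_pos (P.gcd a) with h | h
      · rw [Nat.gcd_eq_zero_iff] at h
        omega
      · exact h
    have hg1 : 1 < P.gcd a := lt_of_le_of_ne hg0 (Ne.symm hne)
    obtain ⟨P', hP'⟩ := Nat.gcd_dvd_left P a
    obtain ⟨a', ha'⟩ := Nat.gcd_dvd_right P a
    set g := P.gcd a
    have hg : (0 : ℝ) < g := by exact_mod_cast hg0
    refine hvis (g : ℝ)⁻¹ (inv_pos.2 hg) (inv_lt_one_of_one_lt₀ (by exact_mod_cast hg1)) ?_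
    rw [intPt_iff, hwB, ← map_smul, LinearEquiv.symm_apply_apply, ← map_smul, hB.inv.intPt]
    refine ⟨a', P', ?_⟩
    rw [ha', hP']
    ext <;> simp [hg.ne']
  have hQ' : ((a : ℝ) + P) ≠ 0 := by exact_mod_cast hQpos.ne'
  refine ⟨B⁻¹, ((a + P : ℕ) : ℝ) / ‖w‖, P, a + P, hB.inv, by positivity, hQpos, hcop, by omega, h3,
    ?_, ?_⟩
  · rw [norm_div, Complex.norm_real, norm_norm, div_self hnorm.ne']
  · have e : coneVec (((a + P : ℕ) : ℝ) / ‖w‖) (P / ((a + P : ℕ) : ℝ)) =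
        ‖w‖⁻¹ • ((a : ℝ), (P : ℝ)) := by
      ext <;> simp [coneVec] <;> field_simp
      ring
    rw [e, map_smul, map_smul, ← hwB, Complex.real_smul, Complex.ofReal_inv, div_eq_inv_mul]

theorem exists_isTrajectoryOf {θ : ℂ} (hθ : θ ∈ driftDirections) (s : ℤˣ) (i : Fin 3) :
    ∃ Γ : ℝ → ℂ × ℂ, IsTrajectoryOf θ s Γ ∧ InvariantUnder (2 * v i) Γ := by
  obtain ⟨A, d, P, Q, hA, hd, hQ, hPQ, hle, h3, hunit, rfl⟩ :=
    exists_coneVec_of_mem_driftDirections hθ s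
  obtain ⟨γ, e, T, hγ, hγ0, he, hturn, hper⟩ := exists_isOrbit_drift hd hQ hPQ hle h3
  set u := coneVec d (P / Q)
  -- the drift of the reflected or rotated orbit is turned into the direction of `v i`
  obtain ⟨j, hj⟩ := (he.map hA).exists_eq
  obtain ⟨n, hn⟩ := exists_rot_pow_vCoord j i
  have hR := isSymm_rot_pow n
  have hRA : IsSymm s (rot ^ n * A) := by simpa using hR.mul hA
  have hγ' := hRA.isOrbit evenPt_zero hγ
  have hturn' : ∀ t, Turns s (A u) (move (rot ^ n * A) 0 (γ t)) := fun t => by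
    have := (hturn t).move hRA evenPt_zero
    rw [mul_one] at this
    exact Turns.of_rot_pow (n := n) this
  have hnorm : ∀ t, ‖plane (move (rot ^ n * A) 0 (γ t)).2‖ = 1 := by
    intro t
    obtain ⟨k, hk⟩ := exists_plane_rot_pow n
    rw [hγ'.norm_eq t 0, show (move (rot ^ n * A) 0 (γ 0)).2 = (rot ^ n) (A (γ 0).2) from rfl, hγ0,
      hk, norm_mul, norm_v, hunit, one_mul]
  refine ⟨_, hγ'.isTrajectoryOf hnorm hturn', invariantUnder_of_eq (T := T)
    (e := (rot ^ n) (A e)) (fun t => ?_) ?_⟩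
  · rw [hper]
    simp [move, shift]
  · rw [← hn, ← map_smul, ← map_neg]
    exact hj.imp (congrArg _) (congrArg _)

end TriHex

theorem corollary5p4 :
    (∀ γ : ℝ → ℂ × ℂ, TriHex.IsTrajectory γ → TriHex.IsDriftPeriodic γ →
      ∃ i : Fin 3, TriHex.InvariantUnder (2 * TriHex.v i) γ) ∧
    (∀ θ ∈ TriHex.driftDirections, ∀ σ : ℤˣ, ∀ i : Fin 3,
      ∃ γ : ℝ → ℂ × ℂ, TriHex.IsTrajectoryOf θ σ γ ∧
        TriHex.InvariantUnder (2 * TriHex.v i) γ) :=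
  ⟨fun _ h hdrift => h.exists_invariantUnder hdrift,
    fun _ hθ s i => TriHex.exists_isTrajectoryOf hθ s i⟩
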